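/- **Setting.** Let $({\sf X},{\cal B})$ be a measurable space with ${\cal B}$ countably generated, and let $P$ be a Markov transition kernel on it that is geometrically ergodic with Lyapunov function $V:{\sf X}\to[1,\infty)$. That is, with $R_\theta=\sum_{n\ge0}(1-e^{-\theta})e^{-\theta n}P^n$ and $R=R_1$: * $P$ is $\psi$-irreducible for a nonzero $\sigma$-finite measure $\psi$ (for some $\theta>0$, $R_\theta(x,s)>0$ for all $x$ whenever $s\ge 0$ and $\psi(s)>0$), $\psi$ being maximal with this property with respect to absolute continuity, and $P$ is aperiodic ($P^t(x,s)>0$ for all large $t$, for every $x$ and every such $s$); * for some probability measure $\nu$, some $b<\infty$, $\delta>0$ and some measurable $s:{\sf X}\to(0,1]$, we have $PV-V\le-\delta V+bs$ and $R\ge s\otimes\nu$. Let $\pi$ be the invariant probability measure of $P$ and suppose $\pi(V^2)<\infty$. Let $F:{\sf X}\to[-1,1]$ be measurable with $\pi(F)=0$. For $w:{\sf X}\to(0,\infty)$ let $L_\infty^w$ be the space of measurable $h:{\sf X}\to\mathbb C$ with $\|h\|_w=\sup_x|h(x)|/w(x)<\infty$, and ${\cal M}_1^w$ the space of complex measures $\mu$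 with $|\mu|(w)<\infty$, normed by $|\mu|(w)$. For a bounded operator $T$ on $L_\infty^w$ let ${\cal S}(T)$ be the set of nonzero $z\in\mathbb C$ for which $zI-T$ has no bounded inverse, and $\xi=\lim_n\|T^n\|_w^{1/n}$. At an isolated point $z_0$ of ${\cal S}(T)$ let $Q=\frac1{2\pi i}\oint(zI-T)^{-1}dz$ (over a small circle about $z_0$). The point $z_0$ is a *pole of finite multiplicity* if $Q$ is a finite linear combination of operators $s_i\otimes\nu_j$ with $s_i\in L_\infty^w$, $\nu_j\in{\cal M}_1^w$; it is a *pole of multiplicity one* if $Q=m\,s\otimes\nu$ and ${\cal S}(T-z_0Q)\subset\{|z|\le\xi-\varepsilon\}$ for some $\varepsilon>0$. $T$ is *$w$-uniform* if, for some $\varepsilon>0$, ${\cal S}(T)\cap\{|z|\ge\xi-\varepsilon\}$ is finite and contains only poles of finite multiplicity, and there is a unique pole $\lambda$ of multiplicity one with $|\lambda|=\xi$. A kernel is $w$-uniform if it acts as a bounded, $w$-uniform operator on $L_\infty^w$; $\lambda$ is its *generalized principal eigenvalue*. For $a\in\mathbb R$ let $\widehat P_a(x,dy)=e^{aF(x)}P(x,dy)$;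 when $\widehat P_a$ is $V$-uniform, $\lambda_a$ denotes its generalized principal eigenvalue. **Proposition.** Suppose that $\widehat P_{a_0}$ is $V$-uniform for a given real $a_0$, and that some $h\in L_\infty^V$ with $\widehat P_{a_0}h=\lambda_{a_0}h$ does not vanish $\pi$-a.e. Then there is an open set $O\subset\mathbb R$ containing $a_0$ such that for every $a\in O$: $\widehat P_a$ is $V$-uniform, $\lambda_a>0$, and there are unique $\check f_a\in L_\infty^V$ and $\check\mu_a\in{\cal M}_1^V$ with $$\widehat P_a\check f_a=\lambda_a\check f_a,\qquad \check\mu_a\widehat P_a=\lambda_a\check\mu_a,\qquad \check\mu_a(\check f_a)=\check\mu_a({\sf X})=1;$$ moreover $\check f_a(x)>0$ for all $x\in{\sf X}$. There are $s_0\in L_\infty^V$, $\nu_0\in{\cal M}_1^V$ and $\varepsilon>0$ for which $zI-\widehat P_{a_0}+s_0\otimes\nu_0$ has a bounded inverse for all $|z|\ge\lambda_{a_0}-\varepsilon$. For every such $s_0,\nu_0$ and all $a$ sufficiently near $a_0$, the inverse $U=[\lambda_aI-\widehat P_a+s_0\otimes\nu_0]^{-1}$ exists as a bounded operator, and $$\check\mu_a=\frac{\nu_0U}{\nu_0U{\bf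 1}},\qquad \check f_a=\frac{Us_0}{\check\mu_aUs_0}$$ with nonzero denominators. For $a\in O$ put $\Lambda(a)=\log\lambda_a$, $\check V_a=V/\check f_a$, and let $\check P_a(x,dy)=\lambda_a^{-1}\check f_a(x)^{-1}\widehat P_a(x,dy)\check f_a(y)$ be the twisted kernel. Then $\check P_a$ is a Markov transition kernel, and: 1. $\check P_a$ is $\check V_a$-uniform. 2. $\check P_a$ has a unique invariant probability measure $\check\pi_a$, $\Lambda$ is differentiable at $a$, and $\Lambda'(a)=\check\pi_a(F)$. 3. The derivative $\widehat F_a(x)=\frac{d}{da}\log\check f_a(x)$ exists for every $x$, is $\check P_a(x,\cdot)$-integrable for every $x$, and solves the Poisson equation $\check P_a\widehat F_a=\widehat F_a-F+\check\pi_a(F)$. If $0\in O$, then for $a=0$ it is the unique real-valued solution in $L_\infty^V$ of $P\widehat F=\widehat F-F+\pi(F)$ with $\pi(\widehat F)=0$. 4. $a\mapsto\check f_a$ is differentiable at $a$ in $L_\infty^V$ and $a\mapsto\check\mu_a$ is differentiable at $a$ in ${\cal M}_1^V$; in particular $\frac{d}{da}\check f_a\in L_\infty^V$ and $\frac{d}{da}\check\mu_a\in{\cal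 M}_1^V$. 5. $\widehat F_a$ lies in $L_\infty^{1+\log^+\check V_a}$, where $\log^+=\max(\log,0)$: it is measurable and $|\widehat F_a|\le C\,(1+\log^+\check V_a)$ for a constant $C$ (depending on $a$). -/

import Mathlib

open MeasureTheory ProbabilityTheory Filter Topology
open scoped NNReal ENNReal

noncomputable section

namespace VGeo

variable {X : Type*} [MeasurableSpace X]

/-! ### The weighted spaces `L_∞^w` and `M_1^w` -/

/-- The measurable functions `h : X → ℂ` with `|h| ≤ C w` for some constant `C`. -/
def lInfSubmodule (w : X → ℝ≥0) : Submodule ℂ (X → ℂ) where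
  carrier := {h | Measurable h ∧ ∃ C : ℝ≥0, ∀ x, ‖h x‖ ≤ C * w x}
  zero_mem' := ⟨measurable_zero, 0, fun x => by simp⟩
  add_mem' := by
    rintro g h ⟨hg, C, hC⟩ ⟨hh, D, hD⟩
    refine ⟨hg.add hh, C + D, fun x => ?_⟩
    calc ‖g x + h x‖ ≤ ‖g x‖ + ‖h x‖ := norm_add_le _ _
      _ ≤ C * w x + D * w x := add_le_add (hC x) (hD x)
      _ = ((C + D : ℝ≥0) : ℝ) * w x := by push_cast; ring
  smul_mem' := by
    rintro c h ⟨hh, C, hC⟩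
    refine ⟨hh.const_smul c, ‖c‖₊ * C, fun x => ?_⟩
    calc ‖c • h x‖ = ‖c‖ * ‖h x‖ := norm_smul _ _
      _ ≤ ‖c‖ * (C * w x) := mul_le_mul_of_nonneg_left (hC x) (norm_nonneg _)
      _ = ((‖c‖₊ * C : ℝ≥0) : ℝ) * w x := by push_cast; ring

/-- The space `L_∞^w` of complex measurable functions `h` with
`‖h‖_w = sup_x |h x| / w x < ∞`, normed by `‖·‖_w`. -/
def LInf (w : X → ℝ≥0) : Type _ := ↥(lInfSubmodule w)

namespace LInf

variable {w : X → ℝ≥0}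

instance : AddCommGroup (LInf w) := inferInstanceAs (AddCommGroup ↥(lInfSubmodule w))

instance : Module ℂ (LInf w) := inferInstanceAs (Module ℂ ↥(lInfSubmodule w))

/-- The underlying function of an element of `L_∞^w`. -/
def toFun (h : LInf w) : X → ℂ := (show ↥(lInfSubmodule w) from h).1

instance : CoeFun (LInf w) (fun _ => X → ℂ) := ⟨toFun⟩

/-- The element of `L_∞^w` given by a function. -/
def mk (h : X → ℂ) (hm : Measurable h) (hb : ∃ C : ℝ≥0, ∀ x, ‖h x‖ ≤ C * w x) : LInf w :=
  show ↥(lInfSubmodule w) from ⟨h, hm, hb⟩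

theorem mk_apply (h : X → ℂ) (hm : Measurable h) (hb : ∃ C : ℝ≥0, ∀ x, ‖h x‖ ≤ C * w x)
    (x : X) : (mk h hm hb : LInf w) x = h x := rfl

theorem ext' {g h : LInf w} (e : ∀ x, g x = h x) : g = h := Subtype.ext (funext e)

theorem measurable (h : LInf w) : Measurable (h : X → ℂ) := h.2.1

theorem bound (h : LInf w) : ∃ C : ℝ≥0, ∀ x, ‖h x‖ ≤ C * w x := h.2.2

theorem add_apply (g h : LInf w) (x : X) : (g + h) x = g x + h x := rfl

theorem smul_apply (c : ℂ) (h : LInf w) (x : X) : (c • h) x = c * h x := rfl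

theorem zero_apply (x : X) : (0 : LInf w) x = 0 := rfl

theorem sub_apply (g h : LInf w) (x : X) : (g - h) x = g x - h x := rfl

instance : Norm (LInf w) := ⟨fun h => ⨆ x, ‖h x‖ / w x⟩

theorem norm_def (h : LInf w) : ‖h‖ = ⨆ x, ‖h x‖ / w x := rfl

theorem norm_le {h : LInf w} {C : ℝ} (hC : 0 ≤ C) (hb : ∀ x, ‖h x‖ ≤ C * w x) : ‖h‖ ≤ C :=
  Real.iSup_le (fun x => div_le_of_le_mul₀ (w x).2 hC (hb x)) hC

theorem le_norm (h : LInf w) (x : X) : ‖h x‖ ≤ ‖h‖ * w x := by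
  obtain ⟨C, hC⟩ := h.bound
  have hbdd : BddAbove (Set.range fun x => ‖h x‖ / (w x : ℝ)) :=
    ⟨C, by rintro _ ⟨y, rfl⟩; exact div_le_of_le_mul₀ (w y).2 C.2 (hC y)⟩
  rcases eq_or_ne (w x : ℝ) 0 with h0 | h0
  · have := hC x
    rw [h0] at this ⊢
    simpa using this
  · have h1 : ‖h x‖ / (w x : ℝ) ≤ ‖h‖ := le_ciSup hbdd x
    exact (div_le_iff₀ (lt_of_le_of_ne (w x).2 (Ne.symm h0))).1 h1

theorem norm_nonneg' (h : LInf w) : 0 ≤ ‖h‖ :=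
  Real.iSup_nonneg fun x => div_nonneg (norm_nonneg _) (w x).2

theorem core : NormedSpace.Core ℂ (LInf w) where
  norm_nonneg := norm_nonneg'
  norm_smul c h := by
    rw [norm_def, norm_def, Real.mul_iSup_of_nonneg (norm_nonneg c)]
    refine congrArg _ (funext fun x => ?_)
    rw [smul_apply, norm_mul, mul_div_assoc]
  norm_triangle g h := by
    refine norm_le (add_nonneg (norm_nonneg' g) (norm_nonneg' h)) fun x => ?_
    rw [add_apply, add_mul]
    exact (norm_add_le _ _).trans (add_le_add (le_norm g x) (le_norm h x))
  norm_eq_zero_iff h := by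
    constructor
    · intro h0
      refine ext' fun x => ?_
      have := le_norm h x
      rw [h0, zero_mul] at this
      exact norm_le_zero_iff.1 this
    · rintro rfl
      exact le_antisymm (norm_le le_rfl fun x => by simp [zero_apply]) (norm_nonneg' _)

instance : NormedAddCommGroup (LInf w) := NormedAddCommGroup.ofCore core

instance : NormedSpace ℂ (LInf w) := NormedSpace.ofCore core

instance : CompleteSpace (LInf w) := by
  refine Metric.complete_of_cauchySeq_tendsto fun u hu => ?_
  have hpt : ∀ x, CauchySeq fun n => u n x := by
    intro x
    rw [Metric.cauchySeq_iff'] at hu ⊢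
    intro ε hε
    obtain ⟨N, hN⟩ := hu (ε / (w x + 1)) (by positivity)
    refine ⟨N, fun n hn => ?_⟩
    have h1 := hN n hn
    rw [dist_eq_norm] at h1 ⊢
    have h2 := le_norm (u n - u N) x
    rw [sub_apply] at h2
    have hw : (0 : ℝ) ≤ w x := (w x).2
    calc ‖u n x - u N x‖ ≤ ‖u n - u N‖ * w x := h2
      _ ≤ ‖u n - u N‖ * (w x + 1) :=
          mul_le_mul_of_nonneg_left (by linarith) (norm_nonneg _)
      _ < ε / (w x + 1) * (w x + 1) := mul_lt_mul_of_pos_right h1 (by positivity)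
      _ = ε := div_mul_cancel₀ _ (by positivity)
  choose g hg using fun x => cauchySeq_tendsto_of_complete (hpt x)
  have key : ∀ ε > 0, ∃ N, ∀ n ≥ N, ∀ x, ‖u n x - g x‖ ≤ ε * w x := by
    intro ε hε
    obtain ⟨N, hN⟩ := Metric.cauchySeq_iff.1 hu ε hε
    refine ⟨N, fun n hn x => ?_⟩
    have hlim : Tendsto (fun m => ‖u n x - u m x‖) atTop (𝓝 ‖u n x - g x‖) :=
      (tendsto_const_nhds.sub (hg x)).norm
    refine le_of_tendsto hlim (eventually_atTop.2 ⟨N, fun m hm => ?_⟩)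
    have h1 := hN n hn m hm
    rw [dist_eq_norm] at h1
    exact (le_norm (u n - u m) x).trans (mul_le_mul_of_nonneg_right h1.le (w x).2)
  have hgm : Measurable g :=
    measurable_of_tendsto_metrizable (fun n => (u n).measurable) (tendsto_pi_nhds.2 hg)
  obtain ⟨N, hN⟩ := key 1 one_pos
  obtain ⟨C, hC⟩ := (u N).bound
  have hgb : ∃ C : ℝ≥0, ∀ x, ‖g x‖ ≤ C * w x := by
    refine ⟨C + 1, fun x => ?_⟩
    have e : g x = u N x - (u N x - g x) := by ring
    calc ‖g x‖ ≤ ‖u N x‖ + ‖u N x - g x‖ := by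
          conv_lhs => rw [e]
          exact norm_sub_le _ _
      _ ≤ C * w x + 1 * w x := add_le_add (hC x) (hN N le_rfl x)
      _ = ((C + 1 : ℝ≥0) : ℝ) * w x := by push_cast; ring
  refine ⟨mk g hgm hgb, Metric.tendsto_atTop.2 fun ε hε => ?_⟩
  obtain ⟨M, hM⟩ := key (ε / 2) (by positivity)
  refine ⟨M, fun n hn => ?_⟩
  rw [dist_eq_norm]
  refine lt_of_le_of_lt (norm_le (by positivity) fun x => ?_) (half_lt_self hε)
  exact hM n hn x

/-- The constant function `1`, as an element of `L_∞^w` when `w ≥ 1`. -/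
def one (hw : ∀ x, 1 ≤ w x) : LInf w :=
  mk (fun _ => 1) measurable_const ⟨1, fun x => by simpa using hw x⟩

theorem integrable_of_lintegral_ne_top (h : LInf w) {m : Measure X}
    (hm : ∫⁻ y, w y ∂m ≠ ∞) : Integrable (h : X → ℂ) m := by
  obtain ⟨C, hC⟩ := h.bound
  refine ⟨h.measurable.aestronglyMeasurable, ?_⟩
  have hle : ∀ y, ‖h y‖ₑ ≤ (C : ℝ≥0∞) * w y := fun y => by
    have : ‖h y‖₊ ≤ C * w y := by exact_mod_cast hC y
    rw [enorm_eq_nnnorm, ← ENNReal.coe_mul]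
    exact_mod_cast this
  refine lt_of_le_of_lt (lintegral_mono hle) ?_
  rw [lintegral_const_mul' _ _ ENNReal.coe_ne_top]
  exact ENNReal.mul_lt_top ENNReal.coe_lt_top hm.lt_top

theorem lintegral_enorm_le (h : LInf w) (m : Measure X) :
    ∫⁻ y, ‖h y‖ₑ ∂m ≤ ENNReal.ofReal ‖h‖ * ∫⁻ y, w y ∂m := by
  rw [← lintegral_const_mul' _ _ ENNReal.ofReal_ne_top]
  refine lintegral_mono fun y => ?_
  rw [← ofReal_norm, ← ENNReal.ofReal_coe_nnreal (p := w y),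
    ← ENNReal.ofReal_mul h.norm_nonneg']
  exact ENNReal.ofReal_le_ofReal (h.le_norm y)

end LInf

/-- The space `M_1^w` of complex measures `μ` with `|μ|(w) < ∞`, where `|μ|` is the total
variation. -/
structure M1 (w : X → ℝ≥0) where
  toComplexMeasure : ComplexMeasure X
  finite' : ∫⁻ y, w y ∂toComplexMeasure.variation ≠ ∞

namespace M1

variable {w : X → ℝ≥0}

/-- The integral `μ(h) = ∫ h dμ` of a function against a complex measure. -/
def integral (μ : ComplexMeasure X) (h : X → ℂ) : ℂ :=
  VectorMeasure.integral μ h (ContinuousLinearMap.mul ℝ ℂ)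

/-- The bounded linear functional `h ↦ μ(h)` on `L_∞^w` given by `μ ∈ M_1^w`.  Its operator norm
is the `w`-weighted total variation norm of `μ`. -/
def toDual (μ : M1 w) : LInf w →L[ℂ] ℂ :=
  LinearMap.mkContinuous
    { toFun := fun h => integral μ.toComplexMeasure h
      map_add' := fun g h =>
        VectorMeasure.integral_add (g.integrable_of_lintegral_ne_top μ.finite')
          (h.integrable_of_lintegral_ne_top μ.finite')
      map_smul' := fun c h =>
        setToFun_smul _ (fun c s x => by
          change c • x * _ = c • (x * _)
          rw [smul_mul_assoc]) c _ }
    (‖ContinuousLinearMap.mul ℝ ℂ‖ * (∫⁻ y, w y ∂μ.toComplexMeasure.variation).toReal)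
    (fun h => by
      have h1 := VectorMeasure.enorm_integral_le_lintegral_enorm (μ := μ.toComplexMeasure)
        (f := (h : X → ℂ)) (B := ContinuousLinearMap.mul ℝ ℂ)
      have h2 := h1.trans (mul_le_mul_right
        (h.lintegral_enorm_le μ.toComplexMeasure.variation) _)
      have h3 := ENNReal.toReal_mono (ENNReal.mul_ne_top enorm_ne_top
        (ENNReal.mul_ne_top ENNReal.ofReal_ne_top μ.finite')) h2
      rw [ENNReal.toReal_mul, ENNReal.toReal_mul, ENNReal.toReal_ofReal h.norm_nonneg',
        toReal_enorm, toReal_enorm] at h3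
      refine h3.trans (le_of_eq ?_)
      ring)

end M1

/-! ### Kernels as bounded operators on `L_∞^w` -/

/-- The kernel `Q` has finite `w`-norm: `sup_x (Q w)(x) / w x < ∞`. -/
def HasFiniteNorm (Q : Kernel X X) (w : X → ℝ≥0) : Prop :=
  ∃ C : ℝ≥0, ∀ x, ∫⁻ y, w y ∂(Q x) ≤ C * w x

theorem integrable_of_hasFiniteNorm {Q : Kernel X X} {w : X → ℝ≥0} (hQ : HasFiniteNorm Q w)
    (h : LInf w) (x : X) : Integrable (h : X → ℂ) (Q x) := by
  obtain ⟨C, hC⟩ := hQ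
  exact h.integrable_of_lintegral_ne_top
    ((hC x).trans_lt (ENNReal.mul_lt_top ENNReal.coe_lt_top ENNReal.coe_lt_top)).ne

theorem norm_integral_kernel_le {Q : Kernel X X} {w : X → ℝ≥0} {C : ℝ≥0}
    (hC : ∀ x, ∫⁻ y, w y ∂(Q x) ≤ C * w x) (h : LInf w) (x : X) :
    ‖∫ y, h y ∂(Q x)‖ ≤ ‖h‖ * C * w x := by
  have h1 : ‖∫ y, h y ∂(Q x)‖ₑ ≤ ENNReal.ofReal ‖h‖ * (C * w x) :=
    (enorm_integral_le_lintegral_enorm _).trans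
      ((h.lintegral_enorm_le (Q x)).trans (mul_le_mul_right (hC x) _))
  have h2 := ENNReal.toReal_mono (ENNReal.mul_ne_top ENNReal.ofReal_ne_top
    (ENNReal.mul_ne_top ENNReal.coe_ne_top ENNReal.coe_ne_top)) h1
  rw [toReal_enorm, ENNReal.toReal_mul, ENNReal.toReal_mul,
    ENNReal.toReal_ofReal h.norm_nonneg', ENNReal.coe_toReal, ENNReal.coe_toReal] at h2
  rw [mul_assoc]
  exact h2

/-- The function `(Q h)(x) = ∫ h(y) Q(x, dy)`, as an element of `L_∞^w`. -/
def kernelApply (Q : Kernel X X) [IsSFiniteKernel Q] {w : X → ℝ≥0} (hQ : HasFiniteNorm Q w)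
    (h : LInf w) : LInf w :=
  LInf.mk (fun x => ∫ y, h y ∂(Q x))
    (StronglyMeasurable.integral_kernel_prod_right' (κ := Q)
      (f := fun p : X × X => h p.2)
      (h.measurable.comp measurable_snd).stronglyMeasurable).measurable
    (by
      obtain ⟨C, hC⟩ := hQ
      exact ⟨‖h‖₊ * C, fun x => by exact_mod_cast norm_integral_kernel_le hC h x⟩)

/-- The bounded operator on `L_∞^w` given by a kernel of finite `w`-norm. -/
def boundedKernelOp (Q : Kernel X X) [IsSFiniteKernel Q] {w : X → ℝ≥0}
    (hQ : HasFiniteNorm Q w) : LInf w →L[ℂ] LInf w :=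
  LinearMap.mkContinuousOfExistsBound
    { toFun := kernelApply Q hQ
      map_add' := fun g h => LInf.ext' fun x =>
        integral_add (integrable_of_hasFiniteNorm hQ g x) (integrable_of_hasFiniteNorm hQ h x)
      map_smul' := fun c h => LInf.ext' fun x => integral_const_mul c (h : X → ℂ) }
    (by
      obtain ⟨C, hC⟩ := id hQ
      refine ⟨C, fun h => LInf.norm_le (mul_nonneg C.2 h.norm_nonneg') fun x => ?_⟩
      rw [mul_comm (C : ℝ)]
      exact norm_integral_kernel_le hC h x)

open scoped Classical in
/-- The operator on `L_∞^w` given by a kernel `Q`; it is only used when `Q` has finite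
`w`-norm. -/
def kernelOp (Q : Kernel X X) [IsSFiniteKernel Q] (w : X → ℝ≥0) : LInf w →L[ℂ] LInf w :=
  if hQ : HasFiniteNorm Q w then boundedKernelOp Q hQ else 0

theorem kernelOp_apply {Q : Kernel X X} [IsSFiniteKernel Q] {w : X → ℝ≥0}
    (hQ : HasFiniteNorm Q w) (h : LInf w) (x : X) :
    kernelOp Q w h x = ∫ y, h y ∂(Q x) := by
  rw [kernelOp, dif_pos hQ]
  rfl

/-! ### Spectrum, poles and `w`-uniform operators -/

section Spectrum

variable {w : X → ℝ≥0}

/-- The spectrum of a bounded operator `T` on `L_∞^w`: the nonzero `z` for which `z I - T` has no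
bounded inverse. -/
def opSpectrum (T : LInf w →L[ℂ] LInf w) : Set ℂ := {z | z ≠ 0 ∧ z ∈ spectrum ℂ T}

/-- `ξ = lim_n ‖T^n‖^{1/n}`. -/
def IsSpectralRadius (T : LInf w →L[ℂ] LInf w) (ξ : ℝ) : Prop :=
  Tendsto (fun n : ℕ => ‖T ^ n‖ ^ (1 / (n : ℝ))) atTop (𝓝 ξ)

/-- The rank one operator `s ⊗ ν : h ↦ ν(h) s`. -/
def rankOne (s : LInf w) (ν : M1 w) : LInf w →L[ℂ] LInf w := ν.toDual.smulRight s

/-- The point `z₀` is isolated in the spectrum of `T`, being the only point of the spectrum in the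
closed disc of radius `r` about `z₀` (which does not contain `0`). -/
def IsolatedWithin (T : LInf w →L[ℂ] LInf w) (z₀ : ℂ) (r : ℝ) : Prop :=
  0 < r ∧ r < ‖z₀‖ ∧ opSpectrum T ∩ Metric.closedBall z₀ r = {z₀}

/-- The projection `(2πi)⁻¹ ∮ (z I - T)⁻¹ dz` over the circle of radius `r` about `z₀`. -/
def spectralProj (T : LInf w →L[ℂ] LInf w) (z₀ : ℂ) (r : ℝ) : LInf w →L[ℂ] LInf w :=
  (2 * Real.pi * Complex.I : ℂ)⁻¹ • ∮ z in C(z₀, r), resolvent T z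

/-- `z₀` is a pole of finite multiplicity of `T`: the spectral projection at `z₀` is a finite
linear combination of operators `s_i ⊗ ν_j`. -/
def IsPoleOfFiniteMultiplicity (T : LInf w →L[ℂ] LInf w) (z₀ : ℂ) : Prop :=
  ∃ r, IsolatedWithin T z₀ r ∧
    ∃ (n : ℕ) (m : Fin n → Fin n → ℂ) (s : Fin n → LInf w) (ν : Fin n → M1 w),
      spectralProj T z₀ r = ∑ i, ∑ j, m i j • rankOne (s i) (ν j)

/-- `z₀` is a pole of multiplicity one of `T`, where `ξ` is the spectral radius of `T`: the
spectral projection `P` at `z₀` is `m s ⊗ ν`, and the spectrum of `T - z₀ P` lies in a disc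
`|z| ≤ ξ - ε`. -/
def IsPoleOfMultiplicityOne (T : LInf w →L[ℂ] LInf w) (ξ : ℝ) (z₀ : ℂ) : Prop :=
  ∃ r, IsolatedWithin T z₀ r ∧
    (∃ (m : ℂ) (s : LInf w) (ν : M1 w), spectralProj T z₀ r = m • rankOne s ν) ∧
    ∃ ε > 0, ∀ z ∈ opSpectrum (T - z₀ • spectralProj T z₀ r), ‖z‖ ≤ ξ - ε

/-- `T` has a spectral gap, where `ξ` is the spectral radius of `T`. -/
def HasSpectralGap (T : LInf w →L[ℂ] LInf w) (ξ : ℝ) : Prop :=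
  ∃ ε > 0, (opSpectrum T ∩ {z | ξ - ε ≤ ‖z‖}).Finite ∧
    ∀ z ∈ opSpectrum T ∩ {z | ξ - ε ≤ ‖z‖}, IsPoleOfFiniteMultiplicity T z

/-- `T` is `w`-uniform with generalized principal eigenvalue `lam`: `T` has a spectral gap, and
`lam` is the unique pole of multiplicity one whose modulus is the spectral radius. -/
def IsUniformOpWith (T : LInf w →L[ℂ] LInf w) (lam : ℂ) : Prop :=
  ∃ ξ : ℝ, IsSpectralRadius T ξ ∧ HasSpectralGap T ξ ∧
    (IsPoleOfMultiplicityOne T ξ lam ∧ ‖lam‖ = ξ) ∧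
    ∀ lam' : ℂ, IsPoleOfMultiplicityOne T ξ lam' ∧ ‖lam'‖ = ξ → lam' = lam

/-- The potential operator `[z I - (T - s ⊗ ν)]⁻¹`. -/
def potential (T : LInf w →L[ℂ] LInf w) (s : LInf w) (ν : M1 w) (z : ℂ) :
    LInf w →L[ℂ] LInf w := resolvent (T - rankOne s ν) z

/-- `z I - (T - s ⊗ ν)` has a bounded inverse. -/
def HasPotential (T : LInf w →L[ℂ] LInf w) (s : LInf w) (ν : M1 w) (z : ℂ) : Prop :=
  IsUnit (algebraMap ℂ (LInf w →L[ℂ] LInf w) z - (T - rankOne s ν))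

end Spectrum

/-- The kernel `Q` is `w`-uniform with generalized principal eigenvalue `lam`. -/
def IsGPE (Q : Kernel X X) [IsSFiniteKernel Q] (w : X → ℝ≥0) (lam : ℂ) : Prop :=
  HasFiniteNorm Q w ∧ IsUniformOpWith (kernelOp Q w) lam

/-- The kernel `Q` is `w`-uniform. -/
def IsUniform (Q : Kernel X X) [IsSFiniteKernel Q] (w : X → ℝ≥0) : Prop :=
  ∃ lam : ℂ, IsGPE Q w lam

/-- `h ∈ L_∞^w` and `ν ∈ M_1^w` are an eigenfunction and an eigenmeasure of `Q` with eigenvalue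
`lam`, normalized by `ν(h) = ν(X) = 1`. -/
structure IsNormalizedEigenpair (Q : Kernel X X) [IsSFiniteKernel Q] {w : X → ℝ≥0} (lam : ℂ)
    (h : LInf w) (ν : M1 w) : Prop where
  eigenfunction : kernelOp Q w h = lam • h
  eigenmeasure : ν.toDual.comp (kernelOp Q w) = lam • ν.toDual
  pairing : ν.toDual h = 1
  mass : ν.toComplexMeasure Set.univ = 1

/-! ### Geometric ergodicity -/

/-- `(R_θ s)(x)`, where `R_θ = ∑_n (1 - e^{-θ}) e^{-θ n} P^n` is the resolvent kernel. -/
def resolventKernel (P : Kernel X X) (θ : ℝ) (s : X → ℝ≥0∞) (x : X) : ℝ≥0∞ :=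
  ∑' n : ℕ, ENNReal.ofReal ((1 - Real.exp (-θ)) * Real.exp (-θ * n)) *
    ∫⁻ y, s y ∂((P ^ n) x)

/-- `ψ` is an irreducibility measure for `P`. -/
def IsIrreducibilityMeasure (P : Kernel X X) (ψ : Measure X) : Prop :=
  SigmaFinite ψ ∧ ψ ≠ 0 ∧ ∃ θ : ℝ, 0 < θ ∧ ∀ s : X → ℝ≥0, Measurable s →
    0 < ∫⁻ y, s y ∂ψ → ∀ x, 0 < resolventKernel P θ (fun y => s y) x

/-- `ψ` is a maximal irreducibility measure for `P`. -/
def IsMaximalIrreducibilityMeasure (P : Kernel X X) (ψ : Measure X) : Prop :=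
  IsIrreducibilityMeasure P ψ ∧ ∀ ψ', IsIrreducibilityMeasure P ψ' → ψ' ≪ ψ

/-- `P` is aperiodic: `(P^t s)(x) > 0` for all large `t`, for all `ψ`-positive `s` and all `x`. -/
def IsAperiodic (P : Kernel X X) (ψ : Measure X) : Prop :=
  ∀ s : X → ℝ≥0, Measurable s → 0 < ∫⁻ y, s y ∂ψ →
    ∀ x, ∀ᶠ t : ℕ in atTop, 0 < ∫⁻ y, s y ∂((P ^ t) x)

/-- The geometric drift condition: `P V - V ≤ -δ V + b s` and `R ≥ s ⊗ ν`, where `R = R_1`. -/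
def DriftV4 (P : Kernel X X) (V : X → ℝ≥0) : Prop :=
  ∃ (ν : Measure X) (b δ : ℝ≥0) (s : X → ℝ≥0), IsProbabilityMeasure ν ∧ 0 < δ ∧
    Measurable s ∧ (∀ x, 0 < s x ∧ s x ≤ 1) ∧
    (∀ x, ∫⁻ y, V y ∂(P x) + δ * V x ≤ V x + b * s x) ∧
    ∀ x A, MeasurableSet A → s x * ν A ≤ resolventKernel P 1 (A.indicator 1) x

/-- The chain with transition kernel `P` is geometrically ergodic with Lyapunov function `V`. -/
def IsGeometricallyErgodic (P : Kernel X X) (V : X → ℝ≥0) : Prop :=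
  (∃ ψ, IsMaximalIrreducibilityMeasure P ψ ∧ IsAperiodic P ψ) ∧ DriftV4 P V

/-! ### The tilted and the twisted kernels -/

/-- The kernel `e^{a F(x)} P(x, dy)`. -/
def tilted (P : Kernel X X) [IsSFiniteKernel P] (F : X → ℝ) (a : ℝ) : Kernel X X :=
  P.withDensity fun x _ => ((Real.exp (a * F x)).toNNReal : ℝ≥0∞)

instance (P : Kernel X X) [IsSFiniteKernel P] (F : X → ℝ) (a : ℝ) :
    IsSFiniteKernel (tilted P F a) :=
  inferInstanceAs (IsSFiniteKernel (P.withDensity fun x (_ : X) =>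
    ((Real.exp (a * F x)).toNNReal : ℝ≥0∞)))

/-- The twisted kernel `lam⁻¹ f(x)⁻¹ e^{a F(x)} P(x, dy) f(y)`, for `lam > 0` and a positive
function `f`. -/
def twisted (P : Kernel X X) [IsSFiniteKernel P] (F : X → ℝ) (a lam : ℝ) (f : X → ℝ) :
    Kernel X X :=
  (tilted P F a).withDensity fun x y => ((lam⁻¹ * (f x)⁻¹ * f y).toNNReal : ℝ≥0∞)

instance (P : Kernel X X) [IsSFiniteKernel P] (F : X → ℝ) (a lam : ℝ) (f : X → ℝ) :
    IsSFiniteKernel (twisted P F a lam f) :=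
  inferInstanceAs (IsSFiniteKernel ((tilted P F a).withDensity fun x y =>
    ((lam⁻¹ * (f x)⁻¹ * f y).toNNReal : ℝ≥0∞)))

/-- The weight `V / f`, for a positive function `f`. -/
def twistedWeight (V : X → ℝ≥0) (f : X → ℝ) : X → ℝ≥0 := fun x => V x / (f x).toNNReal

end VGeo

end

/-!
`V`-uniformity of a kernel gives a simple eigenvalue `lam`, a right eigenvector `f` and a left
eigenvector `φ` with `φ f = 1`, such that deflating the operator by `lam • φ ⊗ f` leaves a spectral
radius less than `|lam|`. Such a triple survives a small perturbation of the operator and depends on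
it smoothly: with `U_z` the inverse of `z - T + s ⊗ φ`, the eigenvalue solves `φ (U_z s) = 1`, and
the eigenvectors are multiples of `U_z s` and `φ U_z`. Since `a ↦ P̂_a` is an exponential series in
the operator norm, everything is smooth in `a`.

Positivity comes from the kernel. As `|lam|ⁿ |f| ≤ P̂ⁿ |f|`, the modulus of `f` is itself an
eigenfunction, for the eigenvalue `|lam|`, which is therefore `lam`; its zeros form an absorbing
set, and by irreducibility a nonempty absorbing set has full measure under an invariant measure of
`P`, which is excluded. The left eigenvector is a limit of the measures `lam⁻ⁿ P̂ⁿ(x, ·) / f x`,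
hence a measure.

Multiplication by `f` conjugates the twisted kernel to `lam⁻¹ P̂_a`, which gives it a spectral gap
with eigenvalue `1`. Differentiating `P̂_a f_a = lam_a f_a` and dividing by `lam_a f_a` gives the
Poisson equation. Finally a function `h` of the weighted space whose one-step increment is bounded
grows at most logarithmically: after `n ≈ log⁺ w x` steps the mean of `h` is within a constant of
its limit, while each step has moved it by a bounded amount.
-/

noncomputable section

namespace VGeo

section Banach

theorem pow_apply_of_eigenvector {R M : Type*} [CommSemiring R] [AddCommMonoid M] [Module R M]
    [TopologicalSpace M] {T : M →L[R] M} {κ : R} {g : M} (hg : T g = κ • g) (n : ℕ) :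
    (T ^ n) g = κ ^ n • g := by
  induction n with
  | zero => simp
  | succ n ih => rw [pow_succ, mul_apply_eq_comp, hg, map_smul, ih, smul_smul, pow_succ']

theorem apply_pow_of_left_eigenvector {R M : Type*} [CommSemiring R] [TopologicalSpace R]
    [AddCommMonoid M] [Module R M] [TopologicalSpace M] {T : M →L[R] M} {κ : R} {ψ : M →L[R] R}
    (hψ : ∀ g, ψ (T g) = κ * ψ g) (n : ℕ) (g : M) : ψ ((T ^ n) g) = κ ^ n * ψ g := by
  induction n with
  | zero => simp
  | succ n ih => rw [pow_succ', mul_apply_eq_comp, hψ, ih, pow_succ', mul_assoc]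

theorem exists_norm_pow_le_of_spectralRadius_lt {A : Type*} [NormedRing A] [NormedAlgebra ℂ A]
    [CompleteSpace A] (N : A) {ρ : ℝ} (hρ : 0 < ρ)
    (h : spectralRadius ℂ N < ENNReal.ofReal ρ) : ∃ C : ℝ, 0 ≤ C ∧ ∀ n, ‖N ^ n‖ ≤ C * ρ ^ n := by
  have hbig : ∀ᶠ n : ℕ in atTop, ‖N ^ n‖ ≤ 1 * ‖ρ ^ n‖ := by
    filter_upwards [(spectrum.pow_norm_pow_one_div_tendsto_nhds_spectralRadius
      N).eventually_lt_const h, eventually_ne_atTop 0] with n hn hn0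
    rw [ENNReal.ofReal_lt_ofReal_iff hρ] at hn
    have := pow_le_pow_left₀ (by positivity) hn.le n
    rwa [one_div, Real.rpow_inv_natCast_pow (norm_nonneg _) hn0,
      ← Real.norm_of_nonneg (pow_nonneg hρ.le n), ← one_mul ‖ρ ^ n‖] at this
  obtain ⟨C, hC, hbound⟩ := Asymptotics.bound_of_isBigO_nat_atTop
    (Asymptotics.IsBigO.of_bound 1 hbig)
  refine ⟨C, hC.le, fun n => ?_⟩
  have := hbound (x := n) (pow_ne_zero n hρ.ne')
  rwa [Real.norm_of_nonneg (pow_nonneg hρ.le n)] at this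

theorem exists_norm_pow_le_of_spectrum {A : Type*} [NormedRing A] [NormedAlgebra ℂ A]
    [CompleteSpace A] (N : A) {r ρ : ℝ} (hr : 0 ≤ r) (hrρ : r < ρ)
    (h : ∀ z ∈ spectrum ℂ N, ‖z‖ ≤ r) : ∃ C : ℝ, 0 ≤ C ∧ ∀ n, ‖N ^ n‖ ≤ C * ρ ^ n := by
  have hρ : 0 < ρ := hr.trans_lt hrρ
  refine exists_norm_pow_le_of_spectralRadius_lt N hρ
    (lt_of_le_of_lt (iSup₂_le fun z hz => ?_) ((ENNReal.ofReal_lt_ofReal_iff hρ).2 hrρ))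
  rw [← enorm_eq_nnnorm, ← ofReal_norm]
  exact ENNReal.ofReal_le_ofReal (h z hz)

variable {E : Type*} [NormedAddCommGroup E] [NormedSpace ℂ E]

theorem eigenvector_of_tendsto_inv_pow_smul {T : E →L[ℂ] E} {κ : ℂ} (hκ : κ ≠ 0) {g u : E}
    (h : Tendsto (fun n : ℕ => (κ ^ n)⁻¹ • (T ^ n) g) atTop (𝓝 u)) : T u = κ • u := by
  refine tendsto_nhds_unique (((T.continuous.tendsto u).comp h).congr fun n => ?_)
    (((tendsto_add_atTop_iff_nat 1).2 h).const_smul κ)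
  rw [Function.comp_apply, map_smul, smul_smul, pow_succ' T, mul_apply_eq_comp, pow_succ', mul_inv,
    mul_inv_cancel_left₀ hκ]

/-- `f` and `φ` are a right and a left eigenvector of `T` with the same eigenvalue `lam`,
normalized by `φ f = 1`. -/
structure IsEigentriple (T : E →L[ℂ] E) (lam : ℂ) (f : E) (φ : E →L[ℂ] ℂ) : Prop where
  eig : T f = lam • f
  adj : ∀ h, φ (T h) = lam * φ h
  pair : φ f = 1

/-- `lam` is a simple eigenvalue of `T`, with normalized right and left eigenvectors `f` and `φ`,
and it dominates the rest of the spectrum in modulus: deflating `T` by its eigenprojection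
`φ ⊗ f` leaves an operator with spectral radius less than `|lam|`. -/
structure IsDominant (T : E →L[ℂ] E) (lam : ℂ) (f : E) (φ : E →L[ℂ] ℂ) : Prop
    extends IsEigentriple T lam f φ where
  gap : ∃ r, 0 ≤ r ∧ r < ‖lam‖ ∧ ∀ z ∈ spectrum ℂ (T - lam • φ.smulRight f), ‖z‖ ≤ r

variable {T : E →L[ℂ] E} {lam : ℂ} {f : E} {φ : E →L[ℂ] ℂ}

namespace IsEigentriple

theorem vec_ne_zero (h : IsEigentriple T lam f φ) : f ≠ 0 := by
  rintro rfl
  simpa using h.pair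

theorem eigenvalue_eq (h : IsEigentriple T lam f φ) {κ : ℂ} {g : E} (hg : T g = κ • g)
    (hφ : φ g ≠ 0) : κ = lam := by
  have := h.adj g
  rw [hg, map_smul, smul_eq_mul] at this
  exact mul_right_cancel₀ hφ this

theorem rescale (h : IsEigentriple T lam f φ) {c : ℂ} (hc : c ≠ 0) :
    IsEigentriple T lam (c⁻¹ • f) (c • φ) where
  eig := by rw [map_smul, h.eig, smul_comm]
  adj g := by simp only [smul_apply, h.adj, smul_eq_mul]; ring
  pair := by simp [h.pair, hc]

theorem deflation_pow_apply (h : IsEigentriple T lam f φ) (n : ℕ) (g : E) :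
    ((T - lam • φ.smulRight f) ^ n) (g - φ g • f) = (T ^ n) g - (lam ^ n * φ g) • f := by
  have hker : ∀ (n : ℕ) (u : E), φ u = 0 → ((T - lam • φ.smulRight f) ^ n) u = (T ^ n) u := by
    intro n
    induction n with
    | zero => simp
    | succ n ih =>
      intro u hu
      have hTu : (T - lam • φ.smulRight f) u = T u := by simp [hu]
      rw [pow_succ, pow_succ, mul_apply_eq_comp, mul_apply_eq_comp, hTu,
        ih _ (by rw [h.adj, hu, mul_zero])]
  rw [hker n _ (by simp [h.pair]), map_sub, map_smul, pow_apply_of_eigenvector h.eig, smul_smul,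
    mul_comm]

end IsEigentriple

namespace IsDominant

theorem norm_pos (h : IsDominant T lam f φ) : 0 < ‖lam‖ := by
  obtain ⟨r, hr, hrlam, -⟩ := h.gap
  exact hr.trans_lt hrlam

theorem ne_zero (h : IsDominant T lam f φ) : lam ≠ 0 := norm_pos_iff.1 h.norm_pos

theorem rescale (h : IsDominant T lam f φ) {c : ℂ} (hc : c ≠ 0) :
    IsDominant T lam (c⁻¹ • f) (c • φ) where
  toIsEigentriple := h.toIsEigentriple.rescale hc
  gap := by
    have hproj : (c • φ).smulRight (c⁻¹ • f) = φ.smulRight f := by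
      ext g
      simp only [ContinuousLinearMap.smulRight_apply, smul_apply, smul_smul, smul_eq_mul]
      rw [mul_right_comm, mul_inv_cancel₀ hc, one_mul]
    rw [hproj]
    exact h.gap

variable [CompleteSpace E]

theorem norm_pow_sub_le (h : IsDominant T lam f φ) :
    ∃ C ρ : ℝ, 0 ≤ C ∧ 0 < ρ ∧ ρ < 1 ∧
      ∀ n g, ‖(T ^ n) g - (lam ^ n * φ g) • f‖ ≤ C * (ρ * ‖lam‖) ^ n * ‖g‖ := by
  obtain ⟨r, hr, hrlam, hspec⟩ := h.gap
  have hlam := h.norm_pos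
  obtain ⟨C, hC, hN⟩ := exists_norm_pow_le_of_spectrum _ hr (left_lt_add_div_two.2 hrlam) hspec
  refine ⟨C * (1 + ‖φ‖ * ‖f‖), (r + ‖lam‖) / 2 / ‖lam‖, by positivity, by positivity,
    (div_lt_one hlam).2 (add_div_two_lt_right.2 hrlam), fun n g => ?_⟩
  have hproj : ‖g - φ g • f‖ ≤ (1 + ‖φ‖ * ‖f‖) * ‖g‖ := by
    calc ‖g - φ g • f‖ ≤ ‖g‖ + ‖φ g‖ * ‖f‖ := by
          rw [← norm_smul]; exact norm_sub_le _ _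
      _ ≤ ‖g‖ + ‖φ‖ * ‖g‖ * ‖f‖ := by gcongr; exact φ.le_opNorm g
      _ = (1 + ‖φ‖ * ‖f‖) * ‖g‖ := by ring
  rw [div_mul_cancel₀ _ hlam.ne', ← h.deflation_pow_apply]
  calc _ ≤ ‖(T - lam • φ.smulRight f) ^ n‖ * ‖g - φ g • f‖ := ContinuousLinearMap.le_opNorm _ _
    _ ≤ (C * ((r + ‖lam‖) / 2) ^ n) * ((1 + ‖φ‖ * ‖f‖) * ‖g‖) := by
        gcongr
        exact hN n
    _ = _ := by ring

theorem norm_inv_pow_smul_sub_le (h : IsDominant T lam f φ) :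
    ∃ C ρ : ℝ, 0 ≤ C ∧ 0 < ρ ∧ ρ < 1 ∧
      ∀ n g, ‖(lam ^ n)⁻¹ • (T ^ n) g - φ g • f‖ ≤ C * ρ ^ n * ‖g‖ := by
  obtain ⟨C, ρ, hC, hρ, hρ1, hpow⟩ := h.norm_pow_sub_le
  refine ⟨C, ρ, hC, hρ, hρ1, fun n g => ?_⟩
  have hlamn : lam ^ n ≠ 0 := pow_ne_zero _ h.ne_zero
  have hfactor : (lam ^ n)⁻¹ • (T ^ n) g - φ g • f
      = (lam ^ n)⁻¹ • ((T ^ n) g - (lam ^ n * φ g) • f) := by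
    rw [smul_sub, smul_smul, inv_mul_cancel_left₀ hlamn]
  rw [hfactor, norm_smul, norm_inv, inv_mul_le_iff₀ (norm_pos_iff.2 hlamn)]
  refine (hpow n g).trans (le_of_eq ?_)
  rw [norm_pow, mul_pow]; ring

theorem tendsto_inv_pow_smul (h : IsDominant T lam f φ) (g : E) :
    Tendsto (fun n : ℕ => (lam ^ n)⁻¹ • (T ^ n) g) atTop (𝓝 (φ g • f)) := by
  obtain ⟨C, ρ, -, hρ, hρ1, hpow⟩ := h.norm_inv_pow_smul_sub_le
  refine tendsto_iff_norm_sub_tendsto_zero.2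
    (squeeze_zero (fun _ => norm_nonneg _) (fun n => hpow n g) ?_)
  simpa using ((tendsto_pow_atTop_nhds_zero_of_lt_one hρ.le hρ1).const_mul C).mul_const ‖g‖

theorem eq_smul_of_eig (h : IsDominant T lam f φ) {g : E} (hg : T g = lam • g) :
    g = φ g • f := by
  refine tendsto_nhds_unique (tendsto_const_nhds.congr fun n => ?_) (h.tendsto_inv_pow_smul g)
  rw [pow_apply_of_eigenvector hg, inv_smul_smul₀ (pow_ne_zero _ h.ne_zero)]

theorem eq_smul_of_adj (h : IsDominant T lam f φ) {ψ : E →L[ℂ] ℂ}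
    (hψ : ∀ g, ψ (T g) = lam * ψ g) : ψ = ψ f • φ := by
  ext g
  have hlim := (ψ.continuous.tendsto _).comp (h.tendsto_inv_pow_smul g)
  rw [map_smul, smul_eq_mul, mul_comm] at hlim
  refine tendsto_nhds_unique (tendsto_const_nhds.congr fun n => ?_) hlim
  rw [Function.comp_apply, map_smul, apply_pow_of_left_eigenvector hψ, smul_eq_mul,
    inv_mul_cancel_left₀ (pow_ne_zero _ h.ne_zero)]

theorem norm_eigenvalue_lt (h : IsDominant T lam f φ) {κ : ℂ} {g : E}
    (hg : T g = κ • g) (hφ : φ g = 0) (hg0 : g ≠ 0) : ‖κ‖ < ‖lam‖ := by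
  by_contra! hle
  have hlim := (h.tendsto_inv_pow_smul g).norm
  rw [hφ, zero_smul, norm_zero] at hlim
  refine hg0 (norm_le_zero_iff.1 (ge_of_tendsto hlim (Eventually.of_forall fun n => ?_)))
  rw [pow_apply_of_eigenvector hg, smul_smul, norm_smul, norm_mul, norm_inv, norm_pow, norm_pow,
    ← inv_pow, ← mul_pow, inv_mul_eq_div]
  exact le_mul_of_one_le_left (norm_nonneg _) (one_le_pow₀ ((one_le_div h.norm_pos).2 hle))

theorem eigenvalue_unique (h : IsDominant T lam f φ) {lam' : ℂ} {f' : E}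
    {φ' : E →L[ℂ] ℂ} (h' : IsDominant T lam' f' φ') : lam' = lam := by
  by_cases hφf' : φ f' = 0
  · have hlt := h.norm_eigenvalue_lt h'.eig hφf' h'.vec_ne_zero
    by_cases hφ'f : φ' f = 0
    · exact absurd (h'.norm_eigenvalue_lt h.eig hφ'f h.vec_ne_zero) hlt.not_gt
    · exact (h'.eigenvalue_eq h.eig hφ'f).symm
  · exact h.eigenvalue_eq h'.eig hφf'

theorem unique_of_normalized (h : IsDominant T lam f φ) {lam' : ℂ} {f' : E}
    {φ' : E →L[ℂ] ℂ} (h' : IsDominant T lam' f' φ') {e : E} (he : φ e = 1) (he' : φ' e = 1) :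
    lam' = lam ∧ f' = f ∧ φ' = φ := by
  obtain rfl := h.eigenvalue_unique h'
  have hφ' := h.eq_smul_of_adj h'.adj
  have hφ'f : φ' f = 1 := by
    simpa [he, he'] using (DFunLike.congr_fun hφ' e).symm
  rw [hφ'f, one_smul] at hφ'
  have hf' := h.eq_smul_of_eig h'.eig
  rw [← hφ', h'.pair, one_smul] at hf'
  exact ⟨rfl, hf', hφ'⟩

end IsDominant

end Banach

section Eigenvectors

variable {E : Type*} [NormedAddCommGroup E] [NormedSpace ℂ E] {T : E →L[ℂ] E} {κ : ℂ} {f : E}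

theorem mem_spectrum_of_eigenvector (hf : T f = κ • f) (hf0 : f ≠ 0) : κ ∈ spectrum ℂ T := by
  intro hunit
  have hinv := DFunLike.congr_fun (Ring.inverse_mul_cancel _ hunit) f
  rw [mul_apply_eq_comp, sub_apply, ContinuousLinearMap.algebraMap_apply, hf, sub_self, map_zero]
    at hinv
  exact hf0 hinv.symm

theorem resolvent_apply_of_eigenvector (hf : T f = κ • f) {z : ℂ} (hz : z ∈ resolventSet ℂ T)
    (hzκ : z ≠ κ) : resolvent T z f = (z - κ)⁻¹ • f := by
  have hinv := DFunLike.congr_fun (Ring.inverse_mul_cancel _ hz) f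
  rw [mul_apply_eq_comp, sub_apply, ContinuousLinearMap.algebraMap_apply, hf, ← sub_smul, map_smul]
    at hinv
  rw [eq_inv_smul_iff₀ (sub_ne_zero.2 hzκ)]
  exact hinv

end Eigenvectors

section BorderedResolvent

variable {E : Type*} [NormedAddCommGroup E] [NormedSpace ℂ E]
  {T : E →L[ℂ] E} {φ : E →L[ℂ] ℂ} {s : E} {z : ℂ}

theorem apply_resolvent_sub_smulRight (hz : z ∈ resolventSet ℂ (T - φ.smulRight s)) (v : E) :
    T (resolvent (T - φ.smulRight s) z v) = z • resolvent (T - φ.smulRight s) z v - v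
      + φ (resolvent (T - φ.smulRight s) z v) • s := by
  have h := DFunLike.congr_fun (Ring.mul_inverse_cancel _ hz) v
  simp only [mul_apply_eq_comp, sub_apply, ContinuousLinearMap.algebraMap_apply,
    ContinuousLinearMap.smulRight_apply, one_apply_eq_self] at h
  simp only [resolvent]
  linear_combination (norm := module) -h

theorem resolvent_sub_smulRight_apply (hz : z ∈ resolventSet ℂ (T - φ.smulRight s)) (v : E) :
    resolvent (T - φ.smulRight s) z (T v) = z • resolvent (T - φ.smulRight s) z v - v
      + φ v • resolvent (T - φ.smulRight s) z s := by
  have h := DFunLike.congr_fun (Ring.inverse_mul_cancel _ hz) v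
  simp only [mul_apply_eq_comp, sub_apply, ContinuousLinearMap.algebraMap_apply,
    ContinuousLinearMap.smulRight_apply, one_apply_eq_self, map_sub, map_smul] at h
  simp only [resolvent]
  linear_combination (norm := module) -h

theorem eq_smul_resolvent_of_eigenvector (hz : z ∈ resolventSet ℂ (T - φ.smulRight s)) {f : E}
    (hf : T f = z • f) : f = φ f • resolvent (T - φ.smulRight s) z s := by
  have h := resolvent_sub_smulRight_apply hz f
  rw [hf, map_smul, sub_add, eq_comm, sub_eq_self, sub_eq_zero] at h
  exact h

theorem left_eigenvector_apply_eq (hz : z ∈ resolventSet ℂ (T - φ.smulRight s)) {ψ : E →L[ℂ] ℂ}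
    (hψ : ∀ v, ψ (T v) = z * ψ v) (v : E) :
    ψ v = ψ s * φ (resolvent (T - φ.smulRight s) z v) := by
  have h := congrArg ψ (apply_resolvent_sub_smulRight hz v)
  simp only [hψ, map_add, map_sub, map_smul, smul_eq_mul] at h
  linear_combination h

theorem isEigentriple_of_apply_resolvent_eq_one (hz : z ∈ resolventSet ℂ (T - φ.smulRight s))
    (h : φ (resolvent (T - φ.smulRight s) z s) = 1) {c : ℂ}
    (hc : φ (resolvent (T - φ.smulRight s) z (resolvent (T - φ.smulRight s) z s)) = c)
    (hc0 : c ≠ 0) :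
    IsEigentriple T z (resolvent (T - φ.smulRight s) z s)
      (c⁻¹ • φ.comp (resolvent (T - φ.smulRight s) z)) where
  eig := by rw [apply_resolvent_sub_smulRight hz, h, one_smul, sub_add_cancel]
  adj v := by
    simp only [smul_apply, ContinuousLinearMap.comp_apply, smul_eq_mul,
      resolvent_sub_smulRight_apply hz, map_add, map_sub, map_smul, h]
    ring
  pair := by
    rw [smul_apply, ContinuousLinearMap.comp_apply, hc, smul_eq_mul, inv_mul_cancel₀ hc0]

theorem IsDominant.exists_forall_mem_resolventSet {lam : ℂ} {f : E} (h : IsDominant T lam f φ) :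
    ∃ ε > 0, ∀ z : ℂ, ‖lam‖ - ε ≤ ‖z‖ → z ∈ resolventSet ℂ (T - φ.smulRight (lam • f)) := by
  obtain ⟨r, -, hrlam, hspec⟩ := h.gap
  have hsmul : φ.smulRight (lam • f) = lam • φ.smulRight f := by
    ext g; simp [smul_smul, mul_comm]
  refine ⟨(‖lam‖ - r) / 2, by linarith, fun z hz => spectrum.notMem_iff.1 fun hmem => ?_⟩
  have := hspec z (hsmul ▸ hmem)
  linarith

theorem IsDominant.mem_resolventSet {lam : ℂ} {f : E} (h : IsDominant T lam f φ) :
    lam ∈ resolventSet ℂ (T - φ.smulRight (lam • f)) := by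
  obtain ⟨ε, hε, hmem⟩ := h.exists_forall_mem_resolventSet
  exact hmem lam (by linarith)

end BorderedResolvent

section Perturbation

theorem eventually_spectrum_norm_le {A ι : Type*} [NormedRing A] [NormedAlgebra ℂ A]
    [CompleteSpace A] {l : Filter ι} {N : ι → A} {N₀ : A} (hN : Tendsto N l (𝓝 N₀)) {r r' : ℝ}
    (hr : r < r') (h : ∀ z ∈ spectrum ℂ N₀, ‖z‖ ≤ r) :
    ∀ᶠ i in l, ∀ z ∈ spectrum ℂ (N i), ‖z‖ ≤ r' := by
  have hopen := upperHemicontinuous_iff_forall_isOpen.1 (upperHemicontinuous_spectrum ℂ A) N₀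
    (Metric.ball 0 r') Metric.isOpen_ball fun z hz => by simpa using (h z hz).trans_lt hr
  filter_upwards [hN.eventually hopen] with i hi z hz
  simpa using (Metric.mem_ball.1 (hi hz)).le

theorem eventually_mem_resolventSet {A : Type*} [NormedRing A] [NormedAlgebra ℂ A]
    [CompleteSpace A] {G : Type*} [TopologicalSpace G] {z : G → ℂ} {T : G → A} {a : G}
    (hz : ContinuousAt z a) (hT : ContinuousAt T a) (h : z a ∈ resolventSet ℂ (T a)) :
    ∀ᶠ t in 𝓝 a, z t ∈ resolventSet ℂ (T t) :=
  (((algebraMapCLM ℂ A).continuous.continuousAt.comp hz).sub hT).eventually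
    (Units.isOpen.mem_nhds h)

variable {G : Type*} [NormedAddCommGroup G] [NormedSpace ℝ G] {n : WithTop ℕ∞} {a₀ : G}

theorem contDiffAt_resolvent {A : Type*} [NormedRing A] [NormedAlgebra ℂ A] [CompleteSpace A]
    {B : G → A} {z : G → ℂ} (hB : ContDiffAt ℝ n B a₀) (hz : ContDiffAt ℝ n z a₀)
    (hmem : z a₀ ∈ resolventSet ℂ (B a₀)) :
    ContDiffAt ℝ n (fun a => resolvent (B a) (z a)) a₀ := by
  obtain ⟨u, hu⟩ := hmem
  have hinv : ContDiffAt ℝ n Ring.inverse (algebraMap ℂ A (z a₀) - B a₀) :=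
    hu ▸ contDiffAt_ringInverse ℝ u
  exact hinv.comp a₀ ((((algebraMapCLM ℂ A).restrictScalars ℝ).contDiff.contDiffAt.comp a₀ hz).sub
    hB)

variable {E : Type*} [NormedAddCommGroup E] [NormedSpace ℂ E]

section RestrictScalars

variable {F : Type*} [NormedAddCommGroup F] [NormedSpace ℂ F] {A : G → E →L[ℂ] F} {u : G → E}

theorem contDiffAt_complexCLM_apply (hA : ContDiffAt ℝ n A a₀) (hu : ContDiffAt ℝ n u a₀) :
    ContDiffAt ℝ n (fun a => A a (u a)) a₀ :=
  ((ContinuousLinearMap.restrictScalarsL ℂ E F ℝ ℝ).contDiff.contDiffAt.comp a₀ hA).clm_apply hu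

end RestrictScalars

variable [CompleteSpace E] {lam : ℂ} {f : E} {φ : E →L[ℂ] ℂ}

theorem IsDominant.eventually_isDominant {ι : Type*} {l : Filter ι} {S : E →L[ℂ] E}
    (h : IsDominant S lam f φ) {T : ι → E →L[ℂ] E} {κ : ι → ℂ} {g : ι → E} {ψ : ι → E →L[ℂ] ℂ}
    (hT : Tendsto T l (𝓝 S)) (hκ : Tendsto κ l (𝓝 lam)) (hg : Tendsto g l (𝓝 f))
    (hψ : Tendsto ψ l (𝓝 φ)) (heig : ∀ᶠ i in l, IsEigentriple (T i) (κ i) (g i) (ψ i)) :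
    ∀ᶠ i in l, IsDominant (T i) (κ i) (g i) (ψ i) := by
  obtain ⟨r, hr, hrlam, hspec⟩ := h.gap
  have hproj : Tendsto (fun i => (ψ i).smulRight (g i)) l (𝓝 (φ.smulRight f)) :=
    ((isBoundedBilinearMap_smulRight (𝕜 := ℂ) (E := E) (F := E)).continuous.tendsto
      (φ, f)).comp (hψ.prodMk_nhds hg)
  filter_upwards [heig, hκ.norm.eventually_const_lt (add_div_two_lt_right.2 hrlam),
    eventually_spectrum_norm_le (hT.sub (hκ.smul hproj)) (left_lt_add_div_two.2 hrlam) hspec]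
    with i heig hlt hle
  exact ⟨heig, (r + ‖lam‖) / 2, by positivity, hlt, hle⟩

variable [CompleteSpace G]

/- `φ(U_z s) = lam / z` at the base point, so its `z`-derivative is invertible and the
equation `φ(U_z s) = 1`, which characterizes eigenvalues, can be solved for `z`. -/
theorem IsDominant.exists_contDiffAt_eigenvalue {T : G → E →L[ℂ] E} (hn : n ≠ 0)
    (hT : ContDiffAt ℝ n T a₀) (h : IsDominant (T a₀) lam f φ) :
    ∃ l : G → ℂ, l a₀ = lam ∧ ContDiffAt ℝ n l a₀ ∧
      ∀ᶠ a in 𝓝 a₀, φ (resolvent (T a - φ.smulRight (lam • f)) (l a) (lam • f)) = 1 := by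
  have hlam := h.ne_zero
  set N : G → E →L[ℂ] E := fun a => T a - φ.smulRight (lam • f)
  set g : G × ℂ → ℂ := fun p => φ (resolvent (N p.1) p.2 (lam • f))
  have hres : ContDiffAt ℝ n (fun p : G × ℂ => resolvent (N p.1) p.2) (a₀, lam) :=
    contDiffAt_resolvent ((hT.sub contDiffAt_const).comp (a₀, lam) contDiffAt_fst) contDiffAt_snd
      h.mem_resolventSet
  have hg : ContDiffAt ℝ n g (a₀, lam) :=
    (φ.restrictScalars ℝ).contDiff.contDiffAt.comp _
      (contDiffAt_complexCLM_apply hres contDiffAt_const)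
  have hgz : (fun z => g (a₀, z)) =ᶠ[𝓝 lam] fun z => lam * z⁻¹ := by
    filter_upwards [spectrum.isOpen_resolventSet (𝕜 := ℂ) (N a₀) |>.mem_nhds h.mem_resolventSet,
      eventually_ne_nhds hlam] with z hz hz0
    have hNf : N a₀ f = (0 : ℂ) • f := by simp [N, h.eig, h.pair]
    change φ (resolvent (N a₀) z (lam • f)) = lam * z⁻¹
    rw [map_smul, resolvent_apply_of_eigenvector hNf hz hz0, sub_zero, map_smul, map_smul, h.pair]
    simp only [smul_eq_mul, mul_one]
  have hpartial : fderiv ℝ g (a₀, lam) ∘L .inr ℝ G ℂ = (-lam⁻¹) • ContinuousLinearMap.id ℝ ℂ := by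
    have hcomp : HasFDerivAt (fun z => g (a₀, z)) (fderiv ℝ g (a₀, lam) ∘L .inr ℝ G ℂ) lam :=
      HasFDerivAt.comp (g := g) lam (hg.differentiableAt hn).hasFDerivAt
        (hasFDerivAt_prodMk_right a₀ lam)
    have hderiv : HasDerivAt (fun z : ℂ => lam * z⁻¹) (-lam⁻¹) lam := by
      have := (hasDerivAt_inv hlam).const_mul lam
      rwa [mul_neg, pow_two, mul_inv, mul_inv_cancel_left₀ hlam] at this
    rw [hcomp.unique ((hderiv.congr_of_eventuallyEq hgz).hasFDerivAt.restrictScalars ℝ)]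
    ext; simp [mul_comm]
  have hinv : (fderiv ℝ g (a₀, lam) ∘L .inr ℝ G ℂ).IsInvertible := by
    rw [hpartial]
    refine .of_inverse (g := (-lam) • ContinuousLinearMap.id ℝ ℂ) ?_ ?_ <;>
    · ext; simp [hlam]
  have hg1 : g (a₀, lam) = 1 := hgz.self_of_nhds.trans (mul_inv_cancel₀ hlam)
  exact ⟨hg.implicitFunction hn hinv, hg.implicitFunction_apply_self hn hinv,
    hg.contDiffAt_implicitFunction hn hinv,
    hg1 ▸ hg.eventually_apply_implicitFunction hn hinv⟩

theorem IsDominant.exists_perturbation {T : G → E →L[ℂ] E} (hn : n ≠ 0)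
    (hT : ContDiffAt ℝ n T a₀) (h : IsDominant (T a₀) lam f φ) :
    ∃ (l : G → ℂ) (g : G → E) (ψ : G → E →L[ℂ] ℂ), l a₀ = lam ∧ g a₀ = f ∧ ψ a₀ = φ ∧
      ContDiffAt ℝ n l a₀ ∧ ContDiffAt ℝ n g a₀ ∧ ContDiffAt ℝ n ψ a₀ ∧
      ∀ᶠ a in 𝓝 a₀, IsDominant (T a) (l a) (g a) (ψ a) := by
  have hlam := h.ne_zero
  obtain ⟨l, hl₀, hl, hl1⟩ := h.exists_contDiffAt_eigenvalue hn hT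
  set N : G → E →L[ℂ] E := fun a => T a - φ.smulRight (lam • f)
  set U : G → E →L[ℂ] E := fun a => resolvent (N a) (l a)
  have hN : ContDiffAt ℝ n N a₀ := hT.sub contDiffAt_const
  have hmem : l a₀ ∈ resolventSet ℂ (N a₀) := hl₀ ▸ h.mem_resolventSet
  have hU : ContDiffAt ℝ n U a₀ := contDiffAt_resolvent hN hl hmem
  set g : G → E := fun a => U a (lam • f)
  set c : G → ℂ := fun a => φ (U a (g a))
  set ψ : G → E →L[ℂ] ℂ := fun a => (c a)⁻¹ • φ.comp (U a)
  have hg : ContDiffAt ℝ n g a₀ := contDiffAt_complexCLM_apply hU contDiffAt_const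
  have hc : ContDiffAt ℝ n c a₀ :=
    (φ.restrictScalars ℝ).contDiff.contDiffAt.comp a₀ (contDiffAt_complexCLM_apply hU hg)
  have hφU : ∀ v, φ (U a₀ v) = lam⁻¹ * φ v := fun v => by
    have := left_eigenvector_apply_eq hmem (fun v => (hl₀ ▸ h.adj v : φ (T a₀ v) = l a₀ * φ v)) v
    rw [this, map_smul, h.pair, smul_eq_mul, mul_one, inv_mul_cancel_left₀ hlam]
  have hg₀ : g a₀ = f := by
    rw [← one_smul ℂ (g a₀), ← h.pair]
    exact (eq_smul_resolvent_of_eigenvector hmem (hl₀ ▸ h.eig : T a₀ f = l a₀ • f)).symm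
  have hc₀ : c a₀ = lam⁻¹ := by simp only [c, hφU, hg₀, h.pair, mul_one]
  have hψ₀ : ψ a₀ = φ := by
    ext v
    simp only [ψ, smul_apply, ContinuousLinearMap.comp_apply, hφU, hc₀, inv_inv, smul_eq_mul,
      mul_inv_cancel_left₀ hlam]
  have hc_ne : c a₀ ≠ 0 := hc₀ ▸ inv_ne_zero hlam
  have hψ : ContDiffAt ℝ n ψ a₀ := (hc.inv hc_ne).smul
    (((ContinuousLinearMap.compL ℂ E E ℂ φ).restrictScalars ℝ).contDiff.contDiffAt.comp a₀ hU)
  refine ⟨l, g, ψ, hl₀, hg₀, hψ₀, hl, hg, hψ, h.eventually_isDominant hT.continuousAt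
    (hl₀ ▸ hl.continuousAt) (hg₀ ▸ hg.continuousAt) (hψ₀ ▸ hψ.continuousAt) ?_⟩
  have hmem_nhds : ∀ᶠ a in 𝓝 a₀, l a ∈ resolventSet ℂ (N a) :=
    eventually_mem_resolventSet hl.continuousAt hN.continuousAt hmem
  filter_upwards [hl1, hmem_nhds, hc.continuousAt.eventually_ne hc_ne] with a h1 hmem hca
  exact isEigentriple_of_apply_resolvent_eq_one hmem h1 rfl hca

end Perturbation

section Contour

theorem clm_circleIntegral {F G : Type*} [NormedAddCommGroup F] [NormedSpace ℂ F]
    [CompleteSpace F] [NormedAddCommGroup G] [NormedSpace ℂ G] [CompleteSpace G] (L : F →L[ℂ] G)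
    {u : ℂ → F} {c : ℂ} {r : ℝ} (hu : CircleIntegrable u c r) :
    L (∮ z in C(c, r), u z) = ∮ z in C(c, r), L (u z) := by
  simp only [circleIntegral, ← L.intervalIntegral_comp_comm hu.out, map_smul]

theorem circleIntegral_sub_inv_of_notMem {c w : ℂ} {r : ℝ} (hr : 0 ≤ r)
    (hw : w ∉ Metric.closedBall c r) : (∮ z in C(c, r), (z - w)⁻¹) = 0 := by
  refine DiffContOnCl.circleIntegral_eq_zero hr (DifferentiableOn.diffContOnCl fun z hz => ?_)
  have hzw : z - w ≠ 0 := sub_ne_zero.2 <| by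
    rintro rfl
    exact hw (Metric.closure_ball_subset_closedBall hz)
  exact ((differentiableAt_id.sub_const w).inv hzw).differentiableWithinAt

section Resolvent

variable {A : Type*} [NormedRing A] [NormedAlgebra ℂ A] [CompleteSpace A] {a : A} {c : ℂ} {r : ℝ}

theorem circleIntegrable_resolvent (hr : 0 ≤ r) (hs : Metric.sphere c r ⊆ resolventSet ℂ a) :
    CircleIntegrable (resolvent a) c r :=
  (HasDerivAt.continuousOn fun _ hz =>
    spectrum.hasDerivAt_resolvent_const_left (hs hz)).circleIntegrable hr

theorem circleIntegral_resolvent_eq_zero (hr : 0 ≤ r)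
    (hs : Metric.closedBall c r ⊆ resolventSet ℂ a) : (∮ z in C(c, r), resolvent a z) = 0 :=
  DiffContOnCl.circleIntegral_eq_zero hr (DifferentiableOn.diffContOnCl fun _ hz =>
    (spectrum.hasDerivAt_resolvent_const_left
      (hs (Metric.closure_ball_subset_closedBall hz))).differentiableAt.differentiableWithinAt)

end Resolvent

theorem commute_resolvent {R A : Type*} [CommSemiring R] [Ring A] [Algebra R A] {a : A} {z : R}
    (hz : z ∈ resolventSet R a) : Commute a (resolvent a z) := by
  obtain ⟨u, hu⟩ := hz
  have hcomm : Commute a (algebraMap R A z - a) :=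
    Commute.sub_right (Algebra.commutes z a).symm (Commute.refl a)
  rw [← hu] at hcomm
  rw [resolvent, ← hu, Ring.inverse_unit]
  exact hcomm.units_inv_right

theorem inverse_sub_smul_idempotent {K A : Type*} [Field K] [Ring A] [Algebra K A] {B Q : A}
    {z c : K} (hB : IsUnit B) (hQ : IsIdempotentElem Q) (hBQ : B * Q = z • Q)
    (hQB : Q * B = z • Q) (hz : z ≠ 0) (hzc : z ≠ c) :
    IsUnit (B - c • Q) ∧
      Ring.inverse (B - c • Q) = Ring.inverse B + ((z - c)⁻¹ - z⁻¹) • Q := by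
  have hzc' : z - c ≠ 0 := sub_ne_zero.2 hzc
  have hinvQ : Ring.inverse B * Q = z⁻¹ • Q := by
    rw [eq_inv_smul_iff₀ hz, ← mul_smul_comm, ← hBQ, Ring.inverse_mul_cancel_left _ _ hB]
  have hQinv : Q * Ring.inverse B = z⁻¹ • Q := by
    rw [eq_inv_smul_iff₀ hz, ← smul_mul_assoc, ← hQB, Ring.mul_inverse_cancel_right _ _ hB]
  have hcoef : ((z - c)⁻¹ - z⁻¹) * z - c * z⁻¹ - c * ((z - c)⁻¹ - z⁻¹) = 0 := by
    field_simp; ring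
  have hright : (B - c • Q) * (Ring.inverse B + ((z - c)⁻¹ - z⁻¹) • Q) = 1 := by
    rw [sub_mul, mul_add, mul_add, Ring.mul_inverse_cancel _ hB, smul_mul_assoc, smul_mul_assoc,
      mul_smul_comm, mul_smul_comm, hBQ, hQinv, hQ.eq]
    linear_combination (norm := module) hcoef • Q
  have hleft : (Ring.inverse B + ((z - c)⁻¹ - z⁻¹) • Q) * (B - c • Q) = 1 := by
    rw [mul_sub, add_mul, add_mul, Ring.inverse_mul_cancel _ hB, smul_mul_assoc, smul_mul_assoc,
      mul_smul_comm, mul_smul_comm, hQB, hinvQ, hQ.eq]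
    linear_combination (norm := module) hcoef • Q
  exact ⟨(Units.mk _ _ hright hleft).isUnit, Ring.inverse_unit (Units.mk _ _ hright hleft)⟩

variable {E : Type*} [NormedAddCommGroup E] [NormedSpace ℂ E]

/-- The Riesz projection `(2πi)⁻¹ ∮ (z - T)⁻¹ dz` of `T` over the circle of centre `z₀` and radius
`r`. -/
def rieszProj (T : E →L[ℂ] E) (z₀ : ℂ) (r : ℝ) : E →L[ℂ] E :=
  (2 * Real.pi * Complex.I : ℂ)⁻¹ • ∮ z in C(z₀, r), resolvent T z

section RieszProj

variable [CompleteSpace E] {T : E →L[ℂ] E} {z₀ : ℂ} {r : ℝ}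

theorem rieszProj_commute (hr : 0 ≤ r) (hs : Metric.sphere z₀ r ⊆ resolventSet ℂ T) :
    Commute T (rieszProj T z₀ r) := by
  have hint := circleIntegrable_resolvent hr hs
  have hleft := clm_circleIntegral (ContinuousLinearMap.mul ℂ (E →L[ℂ] E) T) hint
  have hright := clm_circleIntegral ((ContinuousLinearMap.mul ℂ (E →L[ℂ] E)).flip T) hint
  simp only [ContinuousLinearMap.mul_apply', ContinuousLinearMap.flip_apply] at hleft hright
  refine Commute.smul_right ?_ _
  rw [commute_iff_eq, hleft, hright]
  exact circleIntegral.integral_congr hr fun z hz => (commute_resolvent (hs hz)).eq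

theorem rieszProj_apply_of_eigenvector (hr : 0 ≤ r)
    (hs : Metric.sphere z₀ r ⊆ resolventSet ℂ T) {κ : ℂ} {f : E} (hf : T f = κ • f)
    (hf0 : f ≠ 0) :
    rieszProj T z₀ r f = ((2 * Real.pi * Complex.I)⁻¹ * ∮ z in C(z₀, r), (z - κ)⁻¹) • f := by
  have hκ := mem_spectrum_of_eigenvector hf hf0
  rw [rieszProj, smul_apply, ← smul_smul, ← circleIntegral.integral_smul_const]
  congr 1
  refine (clm_circleIntegral (ContinuousLinearMap.apply ℂ E f)
    (circleIntegrable_resolvent hr hs)).trans (circleIntegral.integral_congr hr fun z hz => ?_)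
  exact resolvent_apply_of_eigenvector hf (hs hz) fun hzκ => hκ (hzκ ▸ hs hz)

theorem rieszProj_apply_of_eigenvector_of_mem (hr : 0 ≤ r)
    (hs : Metric.sphere z₀ r ⊆ resolventSet ℂ T) {κ : ℂ} {f : E} (hf : T f = κ • f)
    (hκ : κ ∈ Metric.ball z₀ r) : rieszProj T z₀ r f = f := by
  rcases eq_or_ne f 0 with rfl | hf0
  · exact map_zero _
  · rw [rieszProj_apply_of_eigenvector hr hs hf hf0, circleIntegral.integral_sub_inv_of_mem_ball hκ,
      inv_mul_cancel₀ Complex.two_pi_I_ne_zero, one_smul]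

theorem rieszProj_apply_of_eigenvector_of_notMem (hr : 0 ≤ r)
    (hs : Metric.sphere z₀ r ⊆ resolventSet ℂ T) {κ : ℂ} {f : E} (hf : T f = κ • f)
    (hκ : κ ∉ Metric.closedBall z₀ r) : rieszProj T z₀ r f = 0 := by
  rcases eq_or_ne f 0 with rfl | hf0
  · exact map_zero _
  · rw [rieszProj_apply_of_eigenvector hr hs hf hf0, circleIntegral_sub_inv_of_notMem hr hκ,
      mul_zero, zero_smul]

end RieszProj

namespace IsDominant

variable {T : E →L[ℂ] E} {lam : ℂ} {f : E} {φ : E →L[ℂ] ℂ}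

theorem resolvent_eq (h : IsDominant T lam f φ) {z : ℂ} (hz0 : z ≠ 0) (hzlam : z ≠ lam)
    (hz : z ∈ resolventSet ℂ (T - lam • φ.smulRight f)) :
    z ∈ resolventSet ℂ T ∧ resolvent T z = resolvent (T - lam • φ.smulRight f) z
      + ((z - lam)⁻¹ - z⁻¹) • φ.smulRight f := by
  set Q : E →L[ℂ] E := φ.smulRight f
  have hdefl : algebraMap ℂ (E →L[ℂ] E) z - T
      = algebraMap ℂ (E →L[ℂ] E) z - (T - lam • Q) - lam • Q := by abel
  rw [resolvent, spectrum.mem_resolventSet_iff, hdefl]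
  refine inverse_sub_smul_idempotent hz ?_ ?_ ?_ hz0 hzlam
  · ext v; simp [Q, h.pair]
  · ext v; simp [Q, h.pair, h.eig, smul_smul, mul_comm]
  · ext v; simp [Q, h.pair, h.adj, smul_smul]

theorem mem_spectrum (h : IsDominant T lam f φ) : lam ∈ spectrum ℂ T :=
  mem_spectrum_of_eigenvector h.eig h.vec_ne_zero

theorem spectrum_subset (h : IsDominant T lam f φ) :
    ∃ r, 0 ≤ r ∧ r < ‖lam‖ ∧ (∀ z ∈ spectrum ℂ (T - lam • φ.smulRight f), ‖z‖ ≤ r) ∧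
      ∀ z ∈ spectrum ℂ T, z ≠ lam → ‖z‖ ≤ r := by
  obtain ⟨r, hr, hrlam, hspec⟩ := h.gap
  refine ⟨r, hr, hrlam, hspec, fun z hz hzlam => ?_⟩
  by_contra! hrz
  exact hz (h.resolvent_eq (norm_pos_iff.1 (hr.trans_lt hrz)) hzlam
    (spectrum.notMem_iff.1 fun hmem => (hspec z hmem).not_gt hrz)).1

theorem spectralRadius_eq (h : IsDominant T lam f φ) : spectralRadius ℂ T = ‖lam‖ₑ := by
  obtain ⟨r, -, hrlam, -, hspec⟩ := h.spectrum_subset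
  refine le_antisymm (iSup₂_le fun z hz => ?_)
    (le_iSup₂ (f := fun (z : ℂ) (_ : z ∈ spectrum ℂ T) => (‖z‖₊ : ℝ≥0∞)) lam h.mem_spectrum)
  rw [← enorm_eq_nnnorm, enorm_le_iff_norm_le]
  rcases eq_or_ne z lam with rfl | hzlam
  · exact le_rfl
  · exact (hspec z hz hzlam).trans hrlam.le

variable [CompleteSpace E]

theorem tendsto_norm_pow (h : IsDominant T lam f φ) :
    Tendsto (fun n : ℕ => ‖T ^ n‖ ^ (1 / (n : ℝ))) atTop (𝓝 ‖lam‖) := by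
  have hlim := spectrum.pow_norm_pow_one_div_tendsto_nhds_spectralRadius T
  rw [h.spectralRadius_eq] at hlim
  refine ((ENNReal.tendsto_toReal enorm_ne_top).comp hlim).congr fun n => ?_
  exact ENNReal.toReal_ofReal (by positivity)

theorem rieszProj_eq_of_closedBall (h : IsDominant T lam f φ) {ρ : ℝ} (hρ : 0 < ρ)
    (hρlam : ρ < ‖lam‖)
    (hres : Metric.closedBall lam ρ ⊆ resolventSet ℂ (T - lam • φ.smulRight f)) :
    rieszProj T lam ρ = φ.smulRight f := by
  have h0 : (0 : ℂ) ∉ Metric.closedBall lam ρ := by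
    rw [Metric.mem_closedBall, dist_zero_left]; exact hρlam.not_ge
  have hsphere := Metric.sphere_subset_closedBall (x := lam) (ε := ρ)
  have hlam : lam ∉ Metric.sphere lam ρ := by simpa using hρ.ne
  have hresolvent : (∮ z in C(lam, ρ), resolvent T z) = ∮ z in C(lam, ρ),
      (resolvent (T - lam • φ.smulRight f) z + ((z - lam)⁻¹ - (z - 0)⁻¹) • φ.smulRight f) := by
    refine circleIntegral.integral_congr hρ.le fun z hz => ?_
    rw [sub_zero]
    exact (h.resolvent_eq (ne_of_mem_of_not_mem (hsphere hz) h0) (ne_of_mem_of_not_mem hz hlam)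
      (hres (hsphere hz))).2
  have hint_lam : CircleIntegrable (fun z : ℂ => (z - lam)⁻¹) lam ρ :=
    circleIntegrable_sub_inv_iff.2 (.inr (by rwa [abs_of_pos hρ]))
  have hint_zero : CircleIntegrable (fun z : ℂ => (z - 0)⁻¹) lam ρ :=
    circleIntegrable_sub_inv_iff.2 (.inr (by rw [abs_of_pos hρ]; exact fun hm => h0 (hsphere hm)))
  have hint : CircleIntegrable
      (fun z : ℂ => ((z - lam)⁻¹ - (z - 0)⁻¹) • φ.smulRight f) lam ρ :=
    (hint_lam.sub hint_zero).smul_continuousOn continuousOn_const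
  rw [rieszProj, hresolvent, circleIntegral.integral_add
      (circleIntegrable_resolvent hρ.le (hsphere.trans hres)) hint,
    circleIntegral_resolvent_eq_zero hρ.le hres, zero_add, circleIntegral.integral_smul_const,
    circleIntegral.integral_sub hint_lam hint_zero,
    circleIntegral.integral_sub_inv_of_mem_ball (Metric.mem_ball_self hρ),
    circleIntegral_sub_inv_of_notMem hρ.le h0, sub_zero, smul_smul,
    inv_mul_cancel₀ Complex.two_pi_I_ne_zero, one_smul]

theorem exists_rieszProj_eq (h : IsDominant T lam f φ) :
    ∃ ρ, 0 < ρ ∧ ρ < ‖lam‖ ∧ spectrum ℂ T ∩ Metric.closedBall lam ρ = {lam} ∧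
      rieszProj T lam ρ = φ.smulRight f := by
  obtain ⟨r, hr, hrlam, hdefl, hspec⟩ := h.spectrum_subset
  have hρ : 0 < (‖lam‖ - r) / 2 := half_pos (sub_pos.2 hrlam)
  have hρlam : (‖lam‖ - r) / 2 < ‖lam‖ := by linarith
  have hball : ∀ z ∈ Metric.closedBall lam ((‖lam‖ - r) / 2), r < ‖z‖ := by
    intro z hz
    rw [Metric.mem_closedBall, dist_comm, dist_eq_norm] at hz
    linarith [norm_sub_norm_le lam z]
  refine ⟨(‖lam‖ - r) / 2, hρ, hρlam, ?_, h.rieszProj_eq_of_closedBall hρ hρlam fun z hz =>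
    spectrum.notMem_iff.1 fun hmem => (hdefl z hmem).not_gt (hball z hz)⟩
  refine Set.Subset.antisymm (fun z hz => ?_)
    (Set.singleton_subset_iff.2 ⟨h.mem_spectrum, Metric.mem_closedBall_self hρ.le⟩)
  by_contra hzlam
  exact (hspec z hz.1 hzlam).not_gt (hball z hz.2)

end IsDominant

theorem exists_eigenvalue_of_commute_smulRight {T : E →L[ℂ] E} {f : E} {φ : E →L[ℂ] ℂ}
    (hf : f ≠ 0) (hφ : φ ≠ 0) (hcomm : Commute T (φ.smulRight f)) :
    ∃ κ : ℂ, T f = κ • f ∧ ∀ v, φ (T v) = κ * φ v := by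
  have happly : ∀ v, φ v • T f = φ (T v) • f := fun v => by
    simpa using DFunLike.congr_fun hcomm.eq v
  obtain ⟨g, hg⟩ : ∃ g, φ g ≠ 0 := by
    by_contra! hzero
    exact hφ (ContinuousLinearMap.ext hzero)
  have hTf : T f = ((φ g)⁻¹ * φ (T g)) • f := by
    rw [mul_smul, ← happly, inv_smul_smul₀ hg]
  refine ⟨_, hTf, fun v => smul_left_injective ℂ hf ?_⟩
  simp only [← happly v, mul_comm _ (φ v), mul_smul, hTf]

theorem mem_resolventSet_of_sub_smulRight {T : E →L[ℂ] E} {z c : ℂ} {f : E} {φ : E →L[ℂ] ℂ}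
    (hcomm : Commute T (φ.smulRight f)) (hφf : φ f = 0)
    (hz : z ∈ resolventSet ℂ (T - c • φ.smulRight f)) : z ∈ resolventSet ℂ T := by
  have hnil : IsNilpotent (-(c • φ.smulRight f) : E →L[ℂ] E) :=
    ⟨2, by ext v; simp [pow_two, hφf]⟩
  have hcomm' : Commute (-(c • φ.smulRight f) : E →L[ℂ] E)
      (algebraMap ℂ (E →L[ℂ] E) z - (T - c • φ.smulRight f)) :=
    .neg_left (.sub_right (Algebra.commutes z _).symm
      (.sub_right (hcomm.smul_right c).symm (.refl _)))
  rw [spectrum.mem_resolventSet_iff] at hz ⊢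
  convert hnil.isUnit_add_left_of_commute hz hcomm' using 1
  abel

theorem isDominant_of_rieszProj [CompleteSpace E] {T : E →L[ℂ] E} {z₀ : ℂ} {r ρ : ℝ} (hr : 0 < r)
    (hiso : spectrum ℂ T ∩ Metric.closedBall z₀ r = {z₀}) {f : E} {φ : E →L[ℂ] ℂ}
    (hQ : rieszProj T z₀ r = φ.smulRight f) (hρ0 : 0 ≤ ρ) (hρ : ρ < ‖z₀‖)
    (hgap : ∀ z ∈ spectrum ℂ (T - z₀ • φ.smulRight f), ‖z‖ ≤ ρ) : IsDominant T z₀ f φ := by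
  have eq_of_mem : ∀ {z}, z ∈ spectrum ℂ T → z ∈ Metric.closedBall z₀ r → z = z₀ :=
    fun hz hzr => (hiso.subset ⟨hz, hzr⟩ : _ ∈ ({z₀} : Set ℂ))
  have hz₀ : z₀ ∈ spectrum ℂ T := (hiso.superset (Set.mem_singleton z₀)).1
  have hz₀' : z₀ ∈ resolventSet ℂ (T - z₀ • φ.smulRight f) :=
    spectrum.notMem_iff.1 fun hmem => (hgap z₀ hmem).not_gt hρ
  have hs : Metric.sphere z₀ r ⊆ resolventSet ℂ T := fun z hz => spectrum.notMem_iff.1 fun hmem =>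
    Metric.ne_of_mem_sphere hz hr.ne' (eq_of_mem hmem (Metric.sphere_subset_closedBall hz))
  have hcomm : Commute T (φ.smulRight f) := hQ ▸ rieszProj_commute hr.le hs
  have hφf : φ f ≠ 0 := fun h0 => hz₀ (mem_resolventSet_of_sub_smulRight hcomm h0 hz₀')
  have hf : f ≠ 0 := by rintro rfl; exact hφf (map_zero φ)
  obtain ⟨κ, hTf, hφT⟩ := exists_eigenvalue_of_commute_smulRight hf
    (by rintro rfl; exact hφf rfl) hcomm
  have hκr : κ ∈ Metric.closedBall z₀ r := by
    by_contra hκ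
    have hzero := rieszProj_apply_of_eigenvector_of_notMem hr.le hs hTf hκ
    rw [hQ] at hzero
    exact smul_ne_zero hφf hf hzero
  obtain rfl := eq_of_mem (mem_spectrum_of_eigenvector hTf hf) hκr
  have hfix := rieszProj_apply_of_eigenvector_of_mem hr.le hs hTf (Metric.mem_ball_self hr)
  rw [hQ] at hfix
  exact ⟨⟨hTf, hφT, smul_left_injective ℂ hf (hfix.trans (one_smul ℂ f).symm)⟩,
    ρ, hρ0, hρ, hgap⟩

end Contour

section Uniform

variable {X : Type*} [MeasurableSpace X] {w : X → ℝ≥0} {T : LInf w →L[ℂ] LInf w} {lam : ℂ}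

theorem spectrum_inter_closedBall_of_isolatedWithin {r : ℝ} (h : IsolatedWithin T lam r) :
    spectrum ℂ T ∩ Metric.closedBall lam r = {lam} := by
  obtain ⟨-, hrlam, hiso⟩ := h
  rw [← hiso]
  refine Set.Subset.antisymm (fun z hz => ⟨⟨?_, hz.1⟩, hz.2⟩) fun z hz => ⟨hz.1.2, hz.2⟩
  rintro rfl
  exact hrlam.not_ge (by simpa using hz.2)

theorem IsPoleOfMultiplicityOne.exists_isDominant (h : IsPoleOfMultiplicityOne T ‖lam‖ lam) :
    ∃ (f : LInf w) (ν : M1 w), IsDominant T lam f ν.toDual := by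
  obtain ⟨r, hiso, ⟨m, s, ν, hQ⟩, ε, hε, hgap⟩ := h
  have hproj : rieszProj T lam r = ν.toDual.smulRight (m • s) :=
    hQ.trans (by ext1 v; exact smul_comm m (ν.toDual v) s)
  refine ⟨m • s, ν, isDominant_of_rieszProj hiso.1
    (spectrum_inter_closedBall_of_isolatedWithin hiso) hproj (le_max_left 0 (‖lam‖ - ε))
    (max_lt (hiso.1.trans hiso.2.1) (sub_lt_self _ hε)) fun z hz => ?_⟩
  rcases eq_or_ne z 0 with rfl | hz0
  · simp
  · rw [← hproj] at hz
    exact (hgap z ⟨hz0, hz⟩).trans (le_max_right _ _)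

theorem IsUniformOpWith.exists_isDominant (h : IsUniformOpWith T lam) :
    ∃ (f : LInf w) (ν : M1 w), IsDominant T lam f ν.toDual := by
  obtain ⟨ξ, -, -, ⟨hpole, rfl⟩, -⟩ := h
  exact hpole.exists_isDominant

namespace IsDominant

variable {f : LInf w} {ν : M1 w}

theorem exists_isolatedWithin (h : IsDominant T lam f ν.toDual) :
    ∃ ρ, IsolatedWithin T lam ρ ∧ spectralProj T lam ρ = rankOne f ν := by
  obtain ⟨ρ, hρ, hρlam, hiso, hproj⟩ := h.exists_rieszProj_eq
  refine ⟨ρ, ⟨hρ, hρlam, ?_⟩, hproj⟩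
  refine Set.Subset.antisymm (fun z hz => hiso.subset ⟨hz.1.2, hz.2⟩) ?_
  exact Set.singleton_subset_iff.2
    ⟨⟨h.ne_zero, h.mem_spectrum⟩, Metric.mem_closedBall_self hρ.le⟩

theorem isPoleOfMultiplicityOne (h : IsDominant T lam f ν.toDual) :
    IsPoleOfMultiplicityOne T ‖lam‖ lam := by
  obtain ⟨ρ, hiso, hproj⟩ := h.exists_isolatedWithin
  obtain ⟨r, -, hrlam, hdefl⟩ := h.gap
  refine ⟨ρ, hiso, ⟨1, f, ν, by rw [hproj, one_smul]⟩, ‖lam‖ - r, sub_pos.2 hrlam, fun z hz => ?_⟩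
  rw [hproj] at hz
  rw [sub_sub_cancel]
  exact hdefl z hz.2

theorem isUniformOpWith (h : IsDominant T lam f ν.toDual) : IsUniformOpWith T lam := by
  obtain ⟨ρ, hiso, hproj⟩ := h.exists_isolatedWithin
  obtain ⟨r, -, hrlam, -, hspec⟩ := h.spectrum_subset
  have eq_lam : ∀ z ∈ spectrum ℂ T, r < ‖z‖ → z = lam := fun z hz hrz => by
    by_contra hzlam
    exact (hspec z hz hzlam).not_gt hrz
  have hr : r < ‖lam‖ - (‖lam‖ - r) / 2 := by linarith
  refine ⟨‖lam‖, h.tendsto_norm_pow, ⟨(‖lam‖ - r) / 2, half_pos (sub_pos.2 hrlam), ?_, ?_⟩,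
    ⟨h.isPoleOfMultiplicityOne, rfl⟩, ?_⟩
  · exact (Set.finite_singleton lam).subset fun z hz => eq_lam z hz.1.2 (hr.trans_le hz.2)
  · intro z hz
    obtain rfl := eq_lam z hz.1.2 (hr.trans_le hz.2)
    exact ⟨ρ, hiso, 1, fun _ _ => 1, fun _ => f, fun _ => ν, by simp [hproj]⟩
  · rintro z ⟨⟨ρ', ⟨-, -, hz⟩, -⟩, hzlam⟩
    exact eq_lam z (hz.superset (Set.mem_singleton z)).1.2 (hzlam.symm ▸ hrlam)

end IsDominant

end Uniform

section SigmaContinuous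

variable {X : Type*} [MeasurableSpace X] {w : X → ℝ≥0}

namespace LInf

/-- Evaluation at a point, as a bounded functional on `L_∞^w`. -/
def eval (w : X → ℝ≥0) (x : X) : LInf w →L[ℂ] ℂ :=
  LinearMap.mkContinuous
    { toFun := fun h => h x
      map_add' := fun _ _ => rfl
      map_smul' := fun _ _ => rfl } (w x) fun h => by
        rw [mul_comm]; exact h.le_norm x

theorem sum_apply {ι : Type*} (s : Finset ι) (h : ι → LInf w) (x : X) :
    (∑ i ∈ s, h i : LInf w) x = ∑ i ∈ s, h i x :=
  map_sum (eval w x) h s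

open scoped Classical in
/-- The indicator function of a measurable set, as an element of `L_∞^w` for a weight `w` that is
bounded away from `0`. It is `0` for a set that is not measurable. -/
def ind (hw : ∃ C : ℝ≥0, ∀ x, 1 ≤ C * w x) (A : Set X) : LInf w :=
  if hA : MeasurableSet A then
    mk (A.indicator fun _ => 1) (measurable_const.indicator hA) (by
      obtain ⟨C, hC⟩ := hw
      refine ⟨C, fun x => (norm_indicator_le_norm_self _ _).trans ?_⟩
      rw [norm_one]
      exact_mod_cast hC x)
  else 0

variable {hw : ∃ C : ℝ≥0, ∀ x, 1 ≤ C * w x}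

theorem coe_ind {A : Set X} (hA : MeasurableSet A) :
    (ind hw A : X → ℂ) = A.indicator fun _ => 1 := by
  rw [ind, dif_pos hA]; rfl

theorem ind_apply {A : Set X} (hA : MeasurableSet A) (x : X) :
    ind hw A x = A.indicator (fun _ => 1) x :=
  congrFun (coe_ind hA) x

theorem ind_of_not_measurableSet {A : Set X} (hA : ¬MeasurableSet A) : ind hw A = 0 :=
  dif_neg hA

theorem norm_ind_le {C : ℝ≥0} (hC : ∀ x, 1 ≤ C * w x) (A : Set X) : ‖ind hw A‖ ≤ C := by
  by_cases hA : MeasurableSet A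
  · refine norm_le C.2 fun x => ?_
    rw [ind_apply hA]
    refine (norm_indicator_le_norm_self _ _).trans ?_
    rw [norm_one]
    exact_mod_cast hC x
  · rw [ind_of_not_measurableSet hA, norm_zero]; exact C.2

theorem sum_ind {ι : Type*} {s : Finset ι} {A : ι → Set X} (hA : ∀ i ∈ s, MeasurableSet (A i))
    (hd : (s : Set ι).PairwiseDisjoint A) : ∑ i ∈ s, ind hw (A i) = ind hw (⋃ i ∈ s, A i) := by
  refine ext' fun x => ?_
  rw [sum_apply, ind_apply (Finset.measurableSet_biUnion s hA), Finset.indicator_biUnion s A hd]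
  exact Finset.sum_congr rfl fun i hi => ind_apply (hA i hi) x

theorem norm_sum_smul_ind_le {ι : Type*} {s : Finset ι} {A : ι → Set X} {c : ι → ℂ}
    (hA : ∀ i ∈ s, MeasurableSet (A i)) (hd : (s : Set ι).PairwiseDisjoint A)
    (hc : ∀ i ∈ s, ∀ x ∈ A i, ‖c i‖ ≤ w x) : ‖∑ i ∈ s, c i • ind hw (A i)‖ ≤ 1 := by
  refine norm_le zero_le_one fun x => ?_
  have hterm : ∀ i ∈ s, (c i • ind hw (A i)) x = (A i).indicator (fun _ => c i) x := by
    intro i hi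
    rw [smul_apply, ind_apply (hA i hi), ← Set.indicator_const_mul, mul_one]
  rw [sum_apply, Finset.sum_congr rfl hterm, one_mul]
  by_cases hx : ∃ j ∈ s, x ∈ A j
  · obtain ⟨j, hj, hxj⟩ := hx
    rw [Finset.sum_eq_single_of_mem j hj fun i hi hij => Set.indicator_of_notMem
      (Set.disjoint_right.1 (hd hi hj hij) hxj) _, Set.indicator_of_mem hxj]
    exact hc j hj x hxj
  · push Not at hx
    rw [Finset.sum_eq_zero fun i hi => Set.indicator_of_notMem (hx i hi) _, norm_zero]
    exact (w x).2

theorem sum_mul_norm_apply_ind_le (φ : LInf w →L[ℂ] ℂ) {ι : Type*} {s : Finset ι}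
    {A : ι → Set X} {c : ι → ℝ≥0} (hA : ∀ i ∈ s, MeasurableSet (A i))
    (hd : (s : Set ι).PairwiseDisjoint A) (hc : ∀ i ∈ s, ∀ x ∈ A i, c i ≤ w x) :
    ∑ i ∈ s, (c i : ℝ) * ‖φ (ind hw (A i))‖ ≤ ‖φ‖ := by
  choose phase norm_phase phase_mul using fun z : ℂ => RCLike.exists_norm_eq_mul_self z
  set u : LInf w := ∑ i ∈ s, (((c i : ℝ) : ℂ) * phase (φ (ind hw (A i)))) • ind hw (A i) with hu
  have hφu : φ u = ((∑ i ∈ s, (c i : ℝ) * ‖φ (ind hw (A i))‖ : ℝ) : ℂ) := by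
    simp only [hu, map_sum, map_smul, smul_eq_mul, mul_assoc, ← phase_mul]
    push_cast
    rfl
  have hu1 : ‖u‖ ≤ 1 := norm_sum_smul_ind_le hA hd fun i hi x hx => by
    rw [norm_mul, norm_phase, mul_one, Complex.norm_real, NNReal.norm_eq]
    exact_mod_cast hc i hi x hx
  calc ∑ i ∈ s, (c i : ℝ) * ‖φ (ind hw (A i))‖ ≤ ‖φ u‖ := by
        rw [hφu, Complex.norm_real]; exact le_abs_self _
    _ ≤ ‖φ‖ := φ.unit_le_opNorm u hu1

theorem eq_sum_smul_ind (g : SimpleFunc X ℂ) (h : LInf w) (hg : ∀ x, h x = g x) :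
    h = ∑ y ∈ g.range, y • ind hw (g ⁻¹' {y}) := by
  refine ext' fun x => ?_
  have hterm : ∀ y, (y • ind hw (g ⁻¹' {y})) x = if g x = y then y else 0 := by
    intro y
    rw [smul_apply, ind_apply (g.measurableSet_fiber y), ← Set.indicator_const_mul, mul_one]
    rfl
  rw [sum_apply, hg, Finset.sum_congr rfl fun y _ => hterm y, Finset.sum_ite_eq,
    if_pos (g.mem_range_self x)]

theorem exists_simpleFunc_tendsto (g : LInf w) : ∃ (s : ℕ → SimpleFunc X ℂ) (S : ℕ → LInf w),
    (∀ n x, S n x = s n x) ∧ (∀ n, ‖S n‖ ≤ 2 * ‖g‖) ∧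
      ∀ x, Tendsto (fun n => S n x) atTop (𝓝 (g x)) := by
  set s : ℕ → SimpleFunc X ℂ :=
    SimpleFunc.approxOn g g.measurable Set.univ 0 (Set.mem_univ _)
  have hbound : ∀ n x, ‖s n x‖ ≤ 2 * ‖g‖ * w x := fun n x =>
    calc ‖s n x‖ ≤ ‖g x‖ + ‖g x‖ :=
          SimpleFunc.norm_approxOn_zero_le g.measurable (Set.mem_univ (0 : ℂ)) x n
      _ ≤ 2 * ‖g‖ * w x := by linarith [g.le_norm x]
  refine ⟨s, fun n => mk (s n) (s n).measurable ⟨⟨2 * ‖g‖, by positivity⟩, hbound n⟩,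
    fun _ _ => rfl, fun n => norm_le (by positivity) (hbound n), fun x => ?_⟩
  exact SimpleFunc.tendsto_approxOn g.measurable (Set.mem_univ (0 : ℂ)) (by simp)

end LInf

/-- A functional on `L_∞^w` is `σ`-continuous if it preserves limits of dominated pointwise
convergent sequences. -/
def IsSigmaCont (φ : LInf w →L[ℂ] ℂ) : Prop :=
  ∀ (h : ℕ → LInf w) (g : LInf w) (C : ℝ), (∀ n, ‖h n‖ ≤ C) →
    (∀ x, Tendsto (fun n => h n x) atTop (𝓝 (g x))) →
    Tendsto (fun n => φ (h n)) atTop (𝓝 (φ g))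

theorem exists_tendsto_sum_enorm_variation (m : ComplexMeasure X) {A : Set X}
    (hA : MeasurableSet A) : ∃ P : ℕ → Finset (Set X), (∀ n, ∀ t ∈ P n, t ⊆ A) ∧
      (∀ n, ((P n : Finset (Set X)) : Set (Set X)).PairwiseDisjoint id) ∧
      (∀ n, ∀ t ∈ P n, MeasurableSet t) ∧
      Tendsto (fun n => ∑ t ∈ P n, ‖m t‖ₑ) atTop (𝓝 (m.variation A)) := by
  rcases eq_or_ne (m.variation A) 0 with h0 | h0
  · exact ⟨fun _ => ∅, by simp [h0]⟩
  · obtain ⟨u, -, hu, hlim⟩ := exists_seq_strictMono_tendsto' (pos_iff_ne_zero.2 h0)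
    choose P hsub hd hmeas hlt using fun n => m.exists_lt_sum_of_lt_variation hA (hu n).2
    exact ⟨P, hsub, hd, hmeas, tendsto_of_tendsto_of_tendsto_of_le_of_le hlim tendsto_const_nhds
      (fun n => (hlt n).le) fun n => m.le_variation hA (hsub n) (hd n)⟩

namespace IsSigmaCont

variable {φ ψ : LInf w →L[ℂ] ℂ}

theorem eval (x : X) : IsSigmaCont (LInf.eval w x) := fun _ _ _ _ h => h x

theorem smul (hφ : IsSigmaCont φ) (c : ℂ) : IsSigmaCont (c • φ) :=
  fun h g C hC hl => (hφ h g C hC hl).const_mul c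

theorem sub (hφ : IsSigmaCont φ) (hψ : IsSigmaCont ψ) : IsSigmaCont (φ - ψ) :=
  fun h g C hC hl => (hφ h g C hC hl).sub (hψ h g C hC hl)

theorem of_tendsto {ι : Type*} {l : Filter ι} [l.NeBot] {Φ : ι → LInf w →L[ℂ] ℂ}
    (hΦ : ∀ᶠ i in l, IsSigmaCont (Φ i)) (hl : Tendsto Φ l (𝓝 φ)) : IsSigmaCont φ := by
  intro h g C hC hlim
  have hnorm : Tendsto (fun i => ‖φ - Φ i‖ * C) l (𝓝 0) := by
    simpa using ((tendsto_const_nhds (x := φ)).sub hl).norm.mul_const C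
  have hunif : TendstoUniformly (fun i n => Φ i (h n)) (fun n => φ (h n)) l := by
    rw [Metric.tendstoUniformly_iff]
    intro ε hε
    filter_upwards [hnorm.eventually_lt_const hε] with i hi n
    rw [dist_eq_norm]
    exact ((φ - Φ i).le_opNorm_of_le (hC n)).trans_lt hi
  exact hunif.tendsto_of_eventually_tendsto (hΦ.mono fun i hi => hi h g C hC hlim)
    (((ContinuousLinearMap.apply ℂ ℂ g).continuous.tendsto φ).comp hl)

theorem ext_ind (hφ : IsSigmaCont φ) (hψ : IsSigmaCont ψ) (hw : ∃ C : ℝ≥0, ∀ x, 1 ≤ C * w x)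
    (h : ∀ A, MeasurableSet A → φ (LInf.ind hw A) = ψ (LInf.ind hw A)) : φ = ψ := by
  ext g
  obtain ⟨s, S, hs, hS, hlim⟩ := g.exists_simpleFunc_tendsto
  refine tendsto_nhds_unique (hφ S g _ hS hlim) ((hψ S g _ hS hlim).congr fun n => ?_)
  rw [LInf.eq_sum_smul_ind (hw := hw) (s n) (S n) (hs n), map_sum, map_sum]
  exact Finset.sum_congr rfl fun y _ => by
    rw [map_smul, map_smul, h _ ((s n).measurableSet_fiber y)]

theorem hasSum_ind (hφ : IsSigmaCont φ) (hw : ∃ C : ℝ≥0, ∀ x, 1 ≤ C * w x) {A : ℕ → Set X}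
    (hA : ∀ i, MeasurableSet (A i)) (hd : Pairwise (Function.onFun Disjoint A)) :
    HasSum (fun i => φ (LInf.ind hw (A i))) (φ (LInf.ind hw (⋃ i, A i))) := by
  obtain ⟨C, hC⟩ := id hw
  have hfin : ∀ s : Finset ℕ,
      ∑ i ∈ s, φ (LInf.ind hw (A i)) = φ (LInf.ind hw (⋃ i ∈ s, A i)) := fun s => by
    rw [← map_sum, LInf.sum_ind (fun i _ => hA i) fun i _ j _ hij => hd hij]
  rw [HasSum, SummationFilter.unconditional_filter, tendsto_iff_seq_tendsto]
  intro s hs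
  simp only [Function.comp_def, hfin]
  refine hφ _ _ C (fun n => LInf.norm_ind_le hC _) fun x => ?_
  simp only [LInf.ind_apply (Finset.measurableSet_biUnion _ fun i _ => hA i),
    LInf.ind_apply (MeasurableSet.iUnion hA)]
  exact (tendsto_indicator_biUnion_finset A (fun _ => (1 : ℂ)) x).comp hs |>.mono_right
    (pure_le_nhds _)

/-- The complex measure `A ↦ φ(1_A)` of a `σ`-continuous functional `φ`. -/
def toComplexMeasure (hφ : IsSigmaCont φ) (hw : ∃ C : ℝ≥0, ∀ x, 1 ≤ C * w x) :
    ComplexMeasure X where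
  measureOf' A := φ (LInf.ind hw A)
  empty' := by
    have : LInf.ind hw (∅ : Set X) = 0 := LInf.ext' fun x => by
      rw [LInf.ind_apply MeasurableSet.empty, Set.indicator_empty]; rfl
    rw [this, map_zero]
  not_measurable' A hA := by rw [LInf.ind_of_not_measurableSet hA, map_zero]
  m_iUnion' _ hA hd := hφ.hasSum_ind hw hA hd

theorem toComplexMeasure_apply (hφ : IsSigmaCont φ) (hw : ∃ C : ℝ≥0, ∀ x, 1 ≤ C * w x)
    (A : Set X) : hφ.toComplexMeasure hw A = φ (LInf.ind hw A) := rfl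

theorem sum_mul_variation_le (hφ : IsSigmaCont φ) (hw : ∃ C : ℝ≥0, ∀ x, 1 ≤ C * w x)
    (g : SimpleFunc X ℝ≥0) (hg : ∀ x, g x ≤ w x) :
    ∑ y ∈ g.range, (y : ℝ≥0∞) * (hφ.toComplexMeasure hw).variation (g ⁻¹' {y}) ≤
      ENNReal.ofReal ‖φ‖ := by
  choose P hsub hd hmeas hlim using fun y : ℝ≥0 =>
    exists_tendsto_sum_enorm_variation (hφ.toComplexMeasure hw) (g.measurableSet_fiber y)
  refine le_of_tendsto' (tendsto_finsetSum _ fun y _ =>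
    ENNReal.Tendsto.const_mul (hlim y) (Or.inr ENNReal.coe_ne_top)) fun n => ?_
  have hdisj : ((g.range.sigma fun y => P y n : Finset (Σ _ : ℝ≥0, Set X)) :
      Set (Σ _ : ℝ≥0, Set X)).PairwiseDisjoint Sigma.snd := by
    rintro ⟨y, t⟩ hyt ⟨y', t'⟩ hyt' hne
    simp only [Finset.mem_coe, Finset.mem_sigma] at hyt hyt'
    rcases eq_or_ne y y' with rfl | hy
    · exact hd y n hyt.2 hyt'.2 fun h => hne (by rw [h])
    · exact Set.disjoint_of_subset (hsub y n t hyt.2) (hsub y' n t' hyt'.2)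
        ((Set.disjoint_singleton.2 hy).preimage g)
  have hle := LInf.sum_mul_norm_apply_ind_le (hw := hw) φ (c := Sigma.fst)
    (fun i hi => hmeas i.1 n i.2 (Finset.mem_sigma.1 hi).2) hdisj fun i hi x hx => by
      rw [← hsub i.1 n i.2 (Finset.mem_sigma.1 hi).2 hx]; exact hg x
  rw [Finset.sum_sigma] at hle
  refine le_trans (le_of_eq ?_) (ENNReal.ofReal_le_ofReal hle)
  rw [ENNReal.ofReal_sum_of_nonneg fun y _ => by positivity]
  refine Finset.sum_congr rfl fun y _ => ?_
  rw [Finset.mul_sum, ENNReal.ofReal_sum_of_nonneg fun t _ => by positivity]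
  exact Finset.sum_congr rfl fun t _ => by
    rw [ENNReal.ofReal_mul (NNReal.coe_nonneg y), ENNReal.ofReal_coe_nnreal, ofReal_norm,
      toComplexMeasure_apply]

theorem lintegral_variation_le (hφ : IsSigmaCont φ) (hw : ∃ C : ℝ≥0, ∀ x, 1 ≤ C * w x) :
    ∫⁻ y, w y ∂(hφ.toComplexMeasure hw).variation ≤ ENNReal.ofReal ‖φ‖ := by
  rw [lintegral_eq_nnreal]
  refine iSup₂_le fun g hg => ?_
  rw [SimpleFunc.map_lintegral]
  exact hφ.sum_mul_variation_le hw g fun x => by exact_mod_cast hg x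

end IsSigmaCont

namespace M1

theorem variation_univ_ne_top (hw : ∃ C : ℝ≥0, ∀ x, 1 ≤ C * w x) (μ : M1 w) :
    μ.toComplexMeasure.variation Set.univ ≠ ∞ := by
  obtain ⟨C, hC⟩ := hw
  have hle : μ.toComplexMeasure.variation Set.univ
      ≤ C * ∫⁻ y, w y ∂μ.toComplexMeasure.variation := by
    rw [← lintegral_const_mul' _ _ ENNReal.coe_ne_top, ← lintegral_one]
    exact lintegral_mono fun x => by change (1 : ℝ≥0∞) ≤ _; exact_mod_cast hC x
  exact (hle.trans_lt (ENNReal.mul_lt_top ENNReal.coe_lt_top μ.finite'.lt_top)).ne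

theorem toDual_ind (hw : ∃ C : ℝ≥0, ∀ x, 1 ≤ C * w x) (μ : M1 w) {A : Set X}
    (hA : MeasurableSet A) : μ.toDual (LInf.ind hw A) = μ.toComplexMeasure A := by
  have : IsFiniteMeasure μ.toComplexMeasure.variation := ⟨(μ.variation_univ_ne_top hw).lt_top⟩
  change integral μ.toComplexMeasure (LInf.ind hw A) = μ.toComplexMeasure A
  rw [integral, LInf.coe_ind hA, VectorMeasure.integral_indicator_const _ hA,
    ContinuousLinearMap.mul_apply', one_mul]

theorem isSigmaCont (hwm : Measurable w) (μ : M1 w) : IsSigmaCont μ.toDual := by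
  intro h g C hC hl
  have hwi : Integrable (fun x => (w x : ℝ)) μ.toComplexMeasure.variation :=
    integrable_toReal_of_lintegral_ne_top hwm.coe_nnreal_ennreal.aemeasurable μ.finite'
  exact VectorMeasure.tendsto_integral_of_dominated_convergence (fun x => C * w x)
    (fun n => (h n).measurable.aestronglyMeasurable) (hwi.const_mul C)
    (fun n => Eventually.of_forall fun x =>
      ((h n).le_norm x).trans (mul_le_mul_of_nonneg_right (hC n) (w x).2)) (Eventually.of_forall hl)

theorem toDual_injective (hw : ∃ C : ℝ≥0, ∀ x, 1 ≤ C * w x) :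
    Function.Injective (toDual : M1 w → LInf w →L[ℂ] ℂ) := by
  intro μ ν h
  have : μ.toComplexMeasure = ν.toComplexMeasure := VectorMeasure.ext fun A hA => by
    rw [← μ.toDual_ind hw hA, ← ν.toDual_ind hw hA, h]
  cases μ; cases ν; congr

end M1

theorem IsSigmaCont.exists_M1 {φ : LInf w →L[ℂ] ℂ} (hφ : IsSigmaCont φ) (hwm : Measurable w)
    (hw : ∃ C : ℝ≥0, ∀ x, 1 ≤ C * w x) : ∃ μ : M1 w, μ.toDual = φ := by
  let μ : M1 w := ⟨hφ.toComplexMeasure hw,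
    ((hφ.lintegral_variation_le hw).trans_lt ENNReal.ofReal_lt_top).ne⟩
  refine ⟨μ, (μ.isSigmaCont hwm).ext_ind hφ hw fun A hA => ?_⟩
  rw [μ.toDual_ind hw hA, hφ.toComplexMeasure_apply]

/-- The functional `h ↦ ∫ h dm` on `L_∞^w`. -/
def integralCLM (m : Measure X) (hm : ∫⁻ y, w y ∂m ≠ ∞) : LInf w →L[ℂ] ℂ :=
  LinearMap.mkContinuous
    { toFun := fun h => ∫ y, h y ∂m
      map_add' := fun g h => integral_add (g.integrable_of_lintegral_ne_top hm)
        (h.integrable_of_lintegral_ne_top hm)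
      map_smul' := fun c h => integral_const_mul c (h : X → ℂ) }
    (∫⁻ y, w y ∂m).toReal (fun h => by
      have hle := ENNReal.toReal_mono (ENNReal.mul_ne_top ENNReal.ofReal_ne_top hm)
        ((enorm_integral_le_lintegral_enorm (h : X → ℂ)).trans (h.lintegral_enorm_le m))
      rwa [toReal_enorm, ENNReal.toReal_mul, ENNReal.toReal_ofReal h.norm_nonneg',
        mul_comm] at hle)

theorem integralCLM_apply (m : Measure X) (hm : ∫⁻ y, w y ∂m ≠ ∞) (h : LInf w) :
    integralCLM m hm h = ∫ y, h y ∂m := rfl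

theorem integral_ind (hw : ∃ C : ℝ≥0, ∀ x, 1 ≤ C * w x) (m : Measure X) {A : Set X}
    (hA : MeasurableSet A) : ∫ y, LInf.ind hw A y ∂m = (m.real A : ℂ) := by
  rw [LInf.coe_ind hA, integral_indicator_const _ hA, Complex.real_smul, mul_one]

theorem isSigmaCont_integralCLM {m : Measure X} (hwm : Measurable w) (hm : ∫⁻ y, w y ∂m ≠ ∞) :
    IsSigmaCont (integralCLM m hm) := by
  intro h g C hC hl
  have hwi : Integrable (fun x => (w x : ℝ)) m :=
    integrable_toReal_of_lintegral_ne_top hwm.coe_nnreal_ennreal.aemeasurable hm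
  exact tendsto_integral_of_dominated_convergence (fun x => C * w x)
    (fun n => (h n).measurable.aestronglyMeasurable) (hwi.const_mul C)
    (fun n => Eventually.of_forall fun x =>
      ((h n).le_norm x).trans (mul_le_mul_of_nonneg_right (hC n) (w x).2)) (Eventually.of_forall hl)

theorem HasFiniteNorm.lintegral_ne_top {Q : Kernel X X} (hQ : HasFiniteNorm Q w) (x : X) :
    ∫⁻ y, w y ∂(Q x) ≠ ∞ := by
  obtain ⟨D, hD⟩ := hQ
  exact ((hD x).trans_lt (ENNReal.mul_lt_top ENNReal.coe_lt_top ENNReal.coe_lt_top)).ne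

theorem IsSigmaCont.comp_kernelOp {φ : LInf w →L[ℂ] ℂ} (hφ : IsSigmaCont φ) (hwm : Measurable w)
    {Q : Kernel X X} [IsSFiniteKernel Q] (hQ : HasFiniteNorm Q w) :
    IsSigmaCont (φ.comp (kernelOp Q w)) := by
  intro h g C hC hl
  refine hφ (fun n => kernelOp Q w (h n)) (kernelOp Q w g) (‖kernelOp Q w‖ * C)
    (fun n => (kernelOp Q w).le_opNorm_of_le (hC n)) fun x => ?_
  simp only [kernelOp_apply hQ]
  exact isSigmaCont_integralCLM hwm (hQ.lintegral_ne_top x) h g C hC hl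

theorem IsSigmaCont.exists_measure {φ : LInf w →L[ℂ] ℂ} (hφ : IsSigmaCont φ)
    (hwm : Measurable w) (hw : ∃ C : ℝ≥0, ∀ x, 1 ≤ C * w x)
    (hpos : ∀ A, MeasurableSet A → φ (LInf.ind hw A) = (‖φ (LInf.ind hw A)‖ : ℂ)) :
    ∃ (m : Measure X) (hm : ∫⁻ y, w y ∂m ≠ ∞), φ = integralCLM m hm := by
  set μ := hφ.toComplexMeasure hw
  have hre : ∀ A, MeasurableSet A → ComplexMeasure.re μ A = ‖μ A‖ := fun A hA =>
    congrArg Complex.re (hpos A hA)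
  have hnonneg : 0 ≤[Set.univ] ComplexMeasure.re μ := by
    rw [VectorMeasure.le_restrict_univ_iff_le, VectorMeasure.le_iff]
    exact fun A hA => (norm_nonneg _).trans_eq (hre A hA).symm
  set m := (ComplexMeasure.re μ).toMeasureOfZeroLE Set.univ MeasurableSet.univ hnonneg
  have hm_real : ∀ A, MeasurableSet A → m.real A = ‖μ A‖ := fun A hA => by
    rw [SignedMeasure.toMeasureOfZeroLE_real_apply _ hnonneg _ hA, Set.univ_inter, hre A hA]
  have hm_le : m ≤ μ.variation := Measure.le_intro fun A hA _ => by
    rw [← ofReal_measureReal, hm_real A hA, ofReal_norm]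
    exact μ.enorm_measure_le_variation A
  have hm : ∫⁻ y, w y ∂m ≠ ∞ := ((lintegral_mono' hm_le le_rfl).trans_lt
    ((hφ.lintegral_variation_le hw).trans_lt ENNReal.ofReal_lt_top)).ne
  refine ⟨m, hm, hφ.ext_ind (isSigmaCont_integralCLM hwm hm) hw fun A hA => ?_⟩
  rw [integralCLM_apply, integral_ind hw m hA, hm_real A hA, hpos A hA,
    hφ.toComplexMeasure_apply hw]

end SigmaContinuous

section Perron

variable {X : Type*} [MeasurableSpace X] {w : X → ℝ≥0}

theorem LInf.exists_apply_ne_zero {h : LInf w} (hh : h ≠ 0) : ∃ x, h x ≠ 0 := by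
  by_contra! h0
  exact hh (LInf.ext' h0)

theorem LInf.tendsto_apply {ι : Type*} {l : Filter ι} {u : ι → LInf w} {g : LInf w}
    (h : Tendsto u l (𝓝 g)) (x : X) : Tendsto (fun i => u i x) l (𝓝 (g x)) :=
  ((LInf.eval w x).continuous.tendsto g).comp h

/-- `h` takes values in `[0, ∞)`. -/
def IsNonneg (h : LInf w) : Prop := ∀ x, h x = (‖h x‖ : ℂ)

theorem IsNonneg.im_eq_zero {h : LInf w} (hh : IsNonneg h) (x : X) : (h x).im = 0 := by
  rw [hh x, Complex.ofReal_im]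

theorem IsNonneg.smul {h : LInf w} (hh : IsNonneg h) {c : ℂ} (hc : c = (‖c‖ : ℂ)) :
    IsNonneg (c • h) := fun x => by
  rw [LInf.smul_apply, norm_mul, Complex.ofReal_mul, ← hc, ← hh x]

theorem LInf.isNonneg_ind (hw : ∃ C : ℝ≥0, ∀ x, 1 ≤ C * w x) {A : Set X}
    (hA : MeasurableSet A) : IsNonneg (LInf.ind hw A) := fun x => by
  rw [LInf.ind_apply hA]
  by_cases hx : x ∈ A <;> simp [hx]

theorem LInf.isNonneg_one (hw : ∀ x, 1 ≤ w x) : IsNonneg (LInf.one hw) := fun x => by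
  simp [LInf.one, LInf.mk_apply]

/-- The pointwise modulus `|h|`. -/
def LInf.abs (h : LInf w) : LInf w :=
  LInf.mk (fun x => (‖h x‖ : ℂ)) (Complex.measurable_ofReal.comp h.measurable.norm)
    (h.bound.imp fun C hC x => by simpa using hC x)

theorem LInf.abs_apply (h : LInf w) (x : X) : h.abs x = (‖h x‖ : ℂ) := rfl

theorem LInf.norm_abs_apply (h : LInf w) (x : X) : ‖h.abs x‖ = ‖h x‖ := by
  rw [LInf.abs_apply, Complex.norm_real, norm_norm]

theorem LInf.isNonneg_abs (h : LInf w) : IsNonneg h.abs := fun x => by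
  rw [LInf.norm_abs_apply, LInf.abs_apply]

theorem LInf.norm_abs_sub_abs_le (g h : LInf w) : ‖g.abs - h.abs‖ ≤ ‖g - h‖ :=
  LInf.norm_le (norm_nonneg _) fun x => by
    refine le_trans ?_ (LInf.le_norm (g - h) x)
    rw [LInf.sub_apply, LInf.sub_apply, LInf.abs_apply, LInf.abs_apply, ← Complex.ofReal_sub,
      Complex.norm_real]
    exact abs_norm_sub_norm_le _ _

theorem LInf.continuous_abs : Continuous (LInf.abs : LInf w → LInf w) :=
  (LipschitzWith.of_dist_le_mul (K := 1) fun g h => by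
    simpa only [dist_eq_norm, NNReal.coe_one, one_mul] using
      LInf.norm_abs_sub_abs_le g h).continuous

theorem IsNonneg.abs_eq {h : LInf w} (hh : IsNonneg h) : h.abs = h :=
  LInf.ext' fun x => (hh x).symm

theorem LInf.abs_smul (c : ℂ) (h : LInf w) : (c • h).abs = (‖c‖ : ℂ) • h.abs :=
  LInf.ext' fun x => by
    rw [LInf.abs_apply, LInf.smul_apply, LInf.smul_apply, norm_mul, Complex.ofReal_mul,
      LInf.abs_apply]

variable {K : Kernel X X} [IsSFiniteKernel K]

theorem kernelOp_apply_of_isNonneg (hK : HasFiniteNorm K w) {h : LInf w} (hh : IsNonneg h)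
    (x : X) : kernelOp K w h x = ((∫ y, ‖h y‖ ∂(K x) : ℝ) : ℂ) := by
  rw [kernelOp_apply hK, ← integral_complex_ofReal]
  exact integral_congr_ae (Eventually.of_forall hh)

theorem norm_kernelOp_apply_of_isNonneg (hK : HasFiniteNorm K w) {h : LInf w} (hh : IsNonneg h)
    (x : X) : ‖kernelOp K w h x‖ = ∫ y, ‖h y‖ ∂(K x) := by
  rw [kernelOp_apply_of_isNonneg hK hh, Complex.norm_real,
    Real.norm_of_nonneg (integral_nonneg fun _ => norm_nonneg _)]

theorem IsNonneg.kernelOp (hK : HasFiniteNorm K w) {h : LInf w} (hh : IsNonneg h) :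
    IsNonneg (kernelOp K w h) := fun x => by
  rw [norm_kernelOp_apply_of_isNonneg hK hh, kernelOp_apply_of_isNonneg hK hh]

theorem IsNonneg.kernelOp_pow (hK : HasFiniteNorm K w) {h : LInf w} (hh : IsNonneg h) (n : ℕ) :
    IsNonneg ((VGeo.kernelOp K w ^ n) h) := by
  induction n with
  | zero => exact hh
  | succ n ih => rw [pow_succ', mul_apply_eq_comp]; exact ih.kernelOp hK

theorem norm_kernelOp_mono (hK : HasFiniteNorm K w) {g h : LInf w} (hh : IsNonneg h)
    (hgh : ∀ x, ‖g x‖ ≤ ‖h x‖) (x : X) : ‖kernelOp K w g x‖ ≤ ‖kernelOp K w h x‖ := by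
  rw [norm_kernelOp_apply_of_isNonneg hK hh, kernelOp_apply hK]
  exact (norm_integral_le_integral_norm _).trans
    (integral_mono (integrable_of_hasFiniteNorm hK g x).norm
      (integrable_of_hasFiniteNorm hK h x).norm hgh)

theorem norm_kernelOp_pow_le_abs (hK : HasFiniteNorm K w) (h : LInf w) (n : ℕ) (x : X) :
    ‖(kernelOp K w ^ n) h x‖ ≤ ‖(kernelOp K w ^ n) h.abs x‖ := by
  induction n generalizing x with
  | zero => exact (h.norm_abs_apply x).ge
  | succ n ih =>
    rw [pow_succ', mul_apply_eq_comp, mul_apply_eq_comp]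
    exact norm_kernelOp_mono hK (h.isNonneg_abs.kernelOp_pow hK n) ih x

variable {lam : ℂ} {f : LInf w} {φ : LInf w →L[ℂ] ℂ}

namespace IsDominant

theorem hasFiniteNorm (h : IsDominant (kernelOp K w) lam f φ) : HasFiniteNorm K w := by
  by_contra hK
  have hf : lam • f = 0 := by rw [← h.eig, kernelOp, dif_neg hK, zero_apply]
  exact (smul_ne_zero h.ne_zero h.vec_ne_zero) hf

/-- `|K^n f| = |lam|^n |f| ≤ K^n |f|`, and `lam⁻ⁿ K^n |f|` converges to `φ |f| • f`. -/
theorem apply_abs_ne_zero (h : IsDominant (kernelOp K w) lam f φ) : φ f.abs ≠ 0 := by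
  obtain ⟨x, hx⟩ := LInf.exists_apply_ne_zero h.vec_ne_zero
  have hlim := (LInf.tendsto_apply (h.tendsto_inv_pow_smul f.abs) x).norm
  have hle : ‖f x‖ ≤ ‖(φ f.abs • f) x‖ := ge_of_tendsto' hlim fun n => by
    have hn := norm_kernelOp_pow_le_abs h.hasFiniteNorm f n x
    rw [pow_apply_of_eigenvector h.eig, LInf.smul_apply, norm_mul, norm_pow] at hn
    rwa [LInf.smul_apply, norm_mul, norm_inv, norm_pow, inv_mul_eq_div,
      le_div_iff₀ (pow_pos h.norm_pos n), mul_comm]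
  intro h0
  rw [h0, zero_smul, LInf.zero_apply, norm_zero] at hle
  exact hx (norm_le_zero_iff.1 hle)

theorem kernelOp_abs (h : IsDominant (kernelOp K w) lam f φ) :
    kernelOp K w f.abs = (‖lam‖ : ℂ) • f.abs := by
  have hlim : Tendsto (fun n : ℕ => ((‖lam‖ : ℂ) ^ n)⁻¹ • (kernelOp K w ^ n) f.abs) atTop
      (𝓝 ((‖φ f.abs‖ : ℂ) • f.abs)) := by
    rw [← LInf.abs_smul]
    refine ((LInf.continuous_abs.tendsto _).comp (h.tendsto_inv_pow_smul f.abs)).congr fun n => ?_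
    rw [Function.comp_apply, LInf.abs_smul, norm_inv, norm_pow, Complex.ofReal_inv,
      Complex.ofReal_pow, (f.isNonneg_abs.kernelOp_pow h.hasFiniteNorm n).abs_eq]
  have heig := eigenvector_of_tendsto_inv_pow_smul
    (by exact_mod_cast h.norm_pos.ne' : (‖lam‖ : ℂ) ≠ 0) hlim
  rw [map_smul, smul_comm] at heig
  exact smul_right_injective _
    (by exact_mod_cast norm_ne_zero_iff.2 h.apply_abs_ne_zero : (‖φ f.abs‖ : ℂ) ≠ 0) heig

theorem eq_norm (h : IsDominant (kernelOp K w) lam f φ) : lam = (‖lam‖ : ℂ) :=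
  (h.eigenvalue_eq h.kernelOp_abs h.apply_abs_ne_zero).symm

theorem exists_abs (h : IsDominant (kernelOp K w) lam f φ) :
    ∃ ψ, IsDominant (kernelOp K w) lam f.abs ψ := by
  have heig : kernelOp K w f.abs = lam • f.abs := h.kernelOp_abs.trans (by rw [← h.eq_norm])
  have hψ := h.rescale (inv_ne_zero h.apply_abs_ne_zero)
  rw [inv_inv, ← h.eq_smul_of_eig heig] at hψ
  exact ⟨_, hψ⟩

theorem map_isNonneg (h : IsDominant (kernelOp K w) lam f φ) (hf : IsNonneg f) {g : LInf w}
    (hg : IsNonneg g) : φ g = (‖φ g‖ : ℂ) := by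
  obtain ⟨x, hx⟩ := LInf.exists_apply_ne_zero h.vec_ne_zero
  have hlim := LInf.tendsto_apply (h.tendsto_inv_pow_smul g) x
  have hpos : (φ g • f) x = (‖(φ g • f) x‖ : ℂ) := by
    refine tendsto_nhds_unique hlim
      (((Complex.continuous_ofReal.tendsto _).comp hlim.norm).congr fun n => ?_)
    refine ((hg.kernelOp_pow h.hasFiniteNorm n).smul ?_ x).symm
    rw [h.eq_norm]
    simp
  rw [LInf.smul_apply, norm_mul, Complex.ofReal_mul, ← hf x] at hpos
  exact mul_right_cancel₀ hx hpos

/-- `φ` is the norm limit of the functionals `g ↦ lam⁻ⁿ K^n g (x) / f x`. -/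
theorem isSigmaCont (h : IsDominant (kernelOp K w) lam f φ) (hwm : Measurable w) :
    IsSigmaCont φ := by
  obtain ⟨x, hx⟩ := LInf.exists_apply_ne_zero h.vec_ne_zero
  have hpow : ∀ n : ℕ, IsSigmaCont ((LInf.eval w x).comp (kernelOp K w ^ n)) := by
    intro n
    induction n with
    | zero => exact IsSigmaCont.eval x
    | succ n ih =>
      rw [pow_succ]
      exact ih.comp_kernelOp hwm h.hasFiniteNorm
  obtain ⟨C, ρ, hC, hρ0, hρ1, hbound⟩ := h.norm_inv_pow_smul_sub_le
  have hlim : Tendsto (fun n : ℕ => (lam ^ n)⁻¹ • (LInf.eval w x).comp (kernelOp K w ^ n)) atTop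
      (𝓝 (f x • φ)) := by
    rw [tendsto_iff_norm_sub_tendsto_zero]
    have hzero : Tendsto (fun n : ℕ => C * ρ ^ n * w x) atTop (𝓝 0) := by
      simpa using ((tendsto_pow_atTop_nhds_zero_of_lt_one hρ0.le hρ1).const_mul C).mul_const _
    refine squeeze_zero (fun _ => norm_nonneg _) (fun n => ?_) hzero
    refine ContinuousLinearMap.opNorm_le_bound _ (by positivity) fun g => ?_
    calc ‖((lam ^ n)⁻¹ • (LInf.eval w x).comp (kernelOp K w ^ n) - f x • φ) g‖
        = ‖((lam ^ n)⁻¹ • (kernelOp K w ^ n) g - φ g • f) x‖ := by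
          rw [LInf.sub_apply, LInf.smul_apply, LInf.smul_apply, mul_comm (φ g)]
          rfl
      _ ≤ C * ρ ^ n * ‖g‖ * w x :=
          (LInf.le_norm _ x).trans (mul_le_mul_of_nonneg_right (hbound n g) (w x).2)
      _ = C * ρ ^ n * w x * ‖g‖ := by ring
  have hsmul := (IsSigmaCont.of_tendsto (Eventually.of_forall fun n => (hpow n).smul _) hlim).smul
    (f x)⁻¹
  rwa [smul_smul, inv_mul_cancel₀ hx, one_smul] at hsmul

theorem apply_one_ne_zero (h : IsDominant (kernelOp K w) lam f φ) (hf : IsNonneg f)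
    (hwm : Measurable w) (hw : ∀ x, 1 ≤ w x) : φ (LInf.one hw) ≠ 0 := by
  have hw' : ∃ C : ℝ≥0, ∀ x, 1 ≤ C * w x := ⟨1, fun x => by rw [one_mul]; exact hw x⟩
  obtain ⟨m, hm, rfl⟩ := (h.isSigmaCont hwm).exists_measure hwm hw' fun A hA =>
    h.map_isNonneg hf (LInf.isNonneg_ind hw' hA)
  intro h0
  have hpair := h.pair
  rw [integralCLM_apply] at h0 hpair
  have hone : ∫ y, LInf.one hw y ∂m = (m.real Set.univ : ℂ) := by
    simp [LInf.one, LInf.mk_apply]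
  have hfinite : m Set.univ ≠ ∞ := by
    rw [← lintegral_one]
    exact ne_top_of_le_ne_top hm (lintegral_mono fun y => ENNReal.one_le_coe_iff.2 (hw y))
  rw [hone, Complex.ofReal_eq_zero, measureReal_def, ENNReal.toReal_eq_zero_iff,
    or_iff_left hfinite, Measure.measure_univ_eq_zero] at h0
  simp [h0] at hpair

end IsDominant

/-- `lam` is the dominant eigenvalue of `K`, with a positive eigenfunction `f` and an
eigenfunctional `φ`, normalized by `φ f = φ 1 = 1`. -/
structure IsPrincipal (K : Kernel X X) [IsSFiniteKernel K] (hw : ∀ x, 1 ≤ w x) (lam : ℝ)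
    (f : LInf w) (φ : LInf w →L[ℂ] ℂ) : Prop where
  dom : IsDominant (kernelOp K w) (lam : ℂ) f φ
  isNonneg : IsNonneg f
  apply_ne : ∀ x, f x ≠ 0
  mass : φ (LInf.one hw) = 1

theorem IsDominant.exists_isPrincipal (h : IsDominant (kernelOp K w) lam f φ) (hf : ∀ x, f x ≠ 0)
    (hwm : Measurable w) (hw : ∀ x, 1 ≤ w x) :
    ∃ (g : LInf w) (ψ : LInf w →L[ℂ] ℂ), IsPrincipal K hw ‖lam‖ g ψ := by
  obtain ⟨ψ, hψ⟩ := h.exists_abs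
  have hmass : ψ (LInf.one hw) ≠ 0 := hψ.apply_one_ne_zero f.isNonneg_abs hwm hw
  have hnorm := hψ.map_isNonneg f.isNonneg_abs (LInf.isNonneg_one hw)
  have hdom := hψ.rescale (inv_ne_zero hmass)
  rw [inv_inv] at hdom
  refine ⟨_, _, ⟨by rwa [← h.eq_norm], f.isNonneg_abs.smul hnorm, fun x => ?_,
    inv_mul_cancel₀ hmass⟩⟩
  rw [LInf.smul_apply, LInf.abs_apply]
  exact mul_ne_zero hmass (by exact_mod_cast norm_ne_zero_iff.2 (hf x))

namespace IsPrincipal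

variable {hw : ∀ x, 1 ≤ w x} {r : ℝ}

theorem pos (h : IsPrincipal K hw r f φ) : 0 < r := by
  have hr : r = ‖(r : ℂ)‖ := by exact_mod_cast h.dom.eq_norm
  exact hr ▸ h.dom.norm_pos

theorem unique (h : IsPrincipal K hw r f φ) {r' : ℝ} {f' : LInf w} {φ' : LInf w →L[ℂ] ℂ}
    (h' : IsPrincipal K hw r' f' φ') : r' = r ∧ f' = f ∧ φ' = φ := by
  obtain ⟨hr, hf, hφ⟩ := h.dom.unique_of_normalized h'.dom h.mass h'.mass
  exact ⟨by exact_mod_cast hr, hf, hφ⟩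

end IsPrincipal

end Perron

section Markov

variable {X : Type*} [MeasurableSpace X] {K : Kernel X X}

instance isMarkovKernel_pow [IsMarkovKernel K] (n : ℕ) : IsMarkovKernel (K ^ n) := by
  induction n with
  | zero => exact inferInstanceAs (IsMarkovKernel (Kernel.id : Kernel X X))
  | succ n ih => rw [pow_succ]; exact inferInstanceAs (IsMarkovKernel ((K ^ n) ∘ₖ K))

theorem invariant_pow {m : Measure X} (hm : Kernel.Invariant K m) (n : ℕ) :
    Kernel.Invariant (K ^ n) m := by
  induction n with
  | zero => exact Measure.id_comp
  | succ n ih => rw [pow_succ]; exact ih.comp hm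

theorem pow_apply_eq_zero_of_absorbing {Z : Set X} (hZ : MeasurableSet Z)
    (habs : ∀ x ∈ Z, K x Zᶜ = 0) (n : ℕ) {x : X} (hx : x ∈ Z) : (K ^ n) x Zᶜ = 0 := by
  induction n generalizing x with
  | zero =>
    change Kernel.id x Zᶜ = 0
    rw [Kernel.id_apply, Measure.dirac_apply' _ hZ.compl]
    simpa using hx
  | succ n ih =>
    rw [add_comm, Kernel.pow_add_apply_eq_lintegral _ _ _ _ hZ.compl, pow_one,
      lintegral_eq_zero_iff ((K ^ n).measurable_coe hZ.compl)]
    filter_upwards [measure_eq_zero_iff_ae_notMem.1 (habs x hx)] with y hy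
    exact ih (Set.notMem_compl_iff.1 hy)

theorem ae_apply_eq_zero_of_absorbing [IsMarkovKernel K] {m : Measure X} [IsFiniteMeasure m]
    (hm : Kernel.Invariant K m) {Z : Set X} (hZ : MeasurableSet Z) (habs : ∀ x ∈ Z, K x Zᶜ = 0) :
    ∀ᵐ x ∂m.restrict Zᶜ, K x Z = 0 := by
  have hstay : ∫⁻ x in Z, K x Z ∂m = m Z := by
    rw [← setLIntegral_one Z]
    exact setLIntegral_congr_fun hZ fun x hx => (prob_compl_eq_zero_iff hZ).1 (habs x hx)
  have htotal : ∫⁻ x, K x Z ∂m = m Z := by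
    rw [← Measure.bind_apply hZ K.aemeasurable, hm.def]
  rw [← lintegral_add_compl _ hZ, hstay] at htotal
  exact (lintegral_eq_zero_iff (K.measurable_coe hZ)).1
    ((ENNReal.add_right_inj (measure_ne_top m Z)).1 (htotal.trans (add_zero _).symm))

theorem IsIrreducibilityMeasure.exists_pow_apply_ne_zero {ψ : Measure X}
    (hψ : IsIrreducibilityMeasure K ψ) {A : Set X} (hA : MeasurableSet A) (hψA : ψ A ≠ 0) (x : X) :
    ∃ n, (K ^ n) x A ≠ 0 := by
  obtain ⟨-, -, θ, -, hpos⟩ := hψ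
  by_contra! hzero
  have hcoe : ∀ y, ((A.indicator 1 y : ℝ≥0) : ℝ≥0∞) = A.indicator 1 y := fun y => by
    by_cases hy : y ∈ A <;> simp [hy]
  have hres := hpos (A.indicator 1) (measurable_one.indicator hA)
    (by simpa only [hcoe, lintegral_indicator_one hA] using pos_iff_ne_zero.2 hψA) x
  simp [resolventKernel, hcoe, lintegral_indicator_one hA, hzero] at hres

/-- A nonempty absorbing set is `ψ`-full, hence reached from every point, whereas the invariant
measure does not charge the set of points outside of it from which it is reached. -/
theorem measure_compl_eq_zero_of_absorbing [IsMarkovKernel K] {ψ : Measure X}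
    (hψ : IsIrreducibilityMeasure K ψ) {m : Measure X} [IsFiniteMeasure m]
    (hm : Kernel.Invariant K m) {Z : Set X} (hZ : MeasurableSet Z) (hne : Z.Nonempty)
    (habs : ∀ x ∈ Z, K x Zᶜ = 0) : m Zᶜ = 0 := by
  obtain ⟨x, hx⟩ := hne
  have hpow : ∀ n, ∀ y ∈ Z, (K ^ n) y Zᶜ = 0 := fun n y hy =>
    pow_apply_eq_zero_of_absorbing hZ habs n hy
  have hψZc : ψ Zᶜ = 0 := by
    by_contra h0
    obtain ⟨n, hn⟩ := hψ.exists_pow_apply_ne_zero hZ.compl h0 x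
    exact hn (hpow n x hx)
  have hψZ : ψ Z ≠ 0 := fun h0 => hψ.2.1 <| Measure.measure_univ_eq_zero.1 <| by
    rw [← measure_add_measure_compl hZ, h0, hψZc, add_zero]
  have hunreached : ∀ᵐ y ∂m.restrict Zᶜ, ∀ n, (K ^ n) y Z = 0 :=
    ae_all_iff.2 fun n => ae_apply_eq_zero_of_absorbing (invariant_pow hm n) hZ (hpow n)
  have hfalse : ∀ᵐ _ ∂m.restrict Zᶜ, False := hunreached.mono fun y hy => by
    obtain ⟨n, hn⟩ := hψ.exists_pow_apply_ne_zero hZ hψZ y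
    exact hn (hy n)
  simpa [ae_iff] using hfalse

theorem eq_of_invariant_of_tendsto {m ρ : Measure X} [IsProbabilityMeasure ρ] [IsMarkovKernel K]
    (hρ : Kernel.Invariant K ρ)
    (h : ∀ A, MeasurableSet A → ∀ x, Tendsto (fun n => (K ^ n) x A) atTop (𝓝 (m A))) : ρ = m := by
  refine Measure.ext fun A hA => ?_
  have hlim := tendsto_lintegral_of_dominated_convergence (μ := ρ) 1
    (fun n => (K ^ n).measurable_coe hA) (fun n => Eventually.of_forall fun x => prob_le_one)
    (by simp) (Eventually.of_forall (h A hA))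
  have hconst : ∀ n, ∫⁻ x, (K ^ n) x A ∂ρ = ρ A := fun n => by
    rw [← Measure.bind_apply hA (K ^ n).aemeasurable, (invariant_pow hρ n).def]
  simp only [hconst, lintegral_const, measure_univ, mul_one] at hlim
  exact tendsto_nhds_unique tendsto_const_nhds hlim

end Markov

section Tilted

variable {X : Type*} [MeasurableSpace X] {w : X → ℝ≥0} {F : X → ℝ}

theorem tilted_apply (hFm : Measurable F) (P : Kernel X X) [IsSFiniteKernel P] (a : ℝ) (x : X) :
    tilted P F a x = ENNReal.ofReal (Real.exp (a * F x)) • P x := by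
  rw [tilted, Kernel.withDensity_apply _ (by fun_prop)]
  exact withDensity_const _

theorem tilted_zero (P : Kernel X X) [IsSFiniteKernel P] : tilted P F 0 = P := by
  simp [tilted]

theorem tilted_tilted (hFm : Measurable F) (P : Kernel X X) [IsSFiniteKernel P] (a b : ℝ) :
    tilted (tilted P F a) F b = tilted P F (b + a) := by
  ext1 x
  rw [tilted_apply hFm, tilted_apply hFm, tilted_apply hFm, smul_smul, add_mul, Real.exp_add,
    ENNReal.ofReal_mul (Real.exp_nonneg _)]

variable {c : ℝ≥0} (hFm : Measurable F) (hF : ∀ x, |F x| ≤ c)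

include hF in
theorem norm_ofReal_mul_apply_le (h : LInf w) (x : X) : ‖(F x : ℂ) * h x‖ ≤ c * ‖h‖ * w x := by
  rw [norm_mul, Complex.norm_real, mul_assoc]
  exact mul_le_mul (hF x) (h.le_norm x) (norm_nonneg _) c.2

/-- Multiplication by a bounded measurable function, as an operator on `L_∞^w`. -/
def mulOp (w : X → ℝ≥0) (F : X → ℝ) (hFm : Measurable F) (hF : ∀ x, |F x| ≤ c) :
    LInf w →L[ℂ] LInf w :=
  LinearMap.mkContinuous
    { toFun := fun h => LInf.mk (fun x => F x * h x)
        ((Complex.measurable_ofReal.comp hFm).mul h.measurable)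
        ⟨c * ‖h‖₊, fun x => by simpa using norm_ofReal_mul_apply_le hF h x⟩
      map_add' := fun g h => LInf.ext' fun x => mul_add _ (g x) (h x)
      map_smul' := fun z h => LInf.ext' fun x => mul_left_comm (F x : ℂ) z (h x) } c fun h =>
    LInf.norm_le (by positivity) (norm_ofReal_mul_apply_le hF h)

theorem mulOp_apply (h : LInf w) (x : X) : mulOp w F hFm hF h x = F x * h x := rfl

theorem smul_mulOp_pow_apply (z : ℂ) (n : ℕ) (h : LInf w) (x : X) :
    ((z • mulOp w F hFm hF) ^ n) h x = (z * F x) ^ n * h x := by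
  induction n with
  | zero => simp
  | succ n ih =>
    rw [pow_succ', mul_apply_eq_comp, smul_apply, LInf.smul_apply, mulOp_apply, ih]
    ring

theorem exp_smul_mulOp_apply (z : ℂ) (h : LInf w) (x : X) :
    NormedSpace.exp (z • mulOp w F hFm hF) h x = Complex.exp (z * F x) * h x := by
  have hop := ((LInf.eval w x).comp (ContinuousLinearMap.apply ℂ (LInf w) h)).hasSum
    (NormedSpace.exp_series_hasSum_exp' (𝕂 := ℂ) (z • mulOp w F hFm hF))
  have hnum := (NormedSpace.exp_series_hasSum_exp' (𝕂 := ℂ) (z * F x)).mul_right (h x)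
  rw [Complex.exp_eq_exp_ℂ]
  refine hop.unique (hnum.congr_fun fun n => ?_)
  change ((n.factorial : ℂ)⁻¹ • ((z • mulOp w F hFm hF) ^ n) h) x = _
  rw [LInf.smul_apply, smul_mulOp_pow_apply, smul_eq_mul, mul_assoc]

include hFm hF in
theorem hasFiniteNorm_tilted {P : Kernel X X} [IsSFiniteKernel P] (hP : HasFiniteNorm P w) (a : ℝ) :
    HasFiniteNorm (tilted P F a) w := by
  obtain ⟨C, hC⟩ := hP
  refine ⟨(Real.exp (|a| * c)).toNNReal * C, fun x => ?_⟩
  rw [tilted_apply hFm, lintegral_smul_measure, ENNReal.coe_mul, mul_assoc, smul_eq_mul]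
  refine mul_le_mul' (ENNReal.ofReal_le_ofReal (Real.exp_le_exp.2 ?_)) (hC x)
  calc a * F x ≤ |a * F x| := le_abs_self _
    _ = |a| * |F x| := abs_mul _ _
    _ ≤ |a| * c := mul_le_mul_of_nonneg_left (hF x) (abs_nonneg a)

include hFm hF in
theorem hasFiniteNorm_of_tilted {P : Kernel X X} [IsSFiniteKernel P] {a : ℝ}
    (h : HasFiniteNorm (tilted P F a) w) : HasFiniteNorm P w := by
  simpa only [tilted_tilted hFm, neg_add_cancel, tilted_zero] using
    hasFiniteNorm_tilted hFm hF h (-a)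

variable {P : Kernel X X} [IsSFiniteKernel P]

include hFm hF in
theorem kernelOp_tilted_apply (hP : HasFiniteNorm P w) (a : ℝ) (h : LInf w) (x : X) :
    kernelOp (tilted P F a) w h x = (Real.exp (a * F x) : ℂ) * kernelOp P w h x := by
  rw [kernelOp_apply (hasFiniteNorm_tilted hFm hF hP a), kernelOp_apply hP, tilted_apply hFm,
    integral_smul_measure, ENNReal.toReal_ofReal (Real.exp_nonneg _)]
  exact Complex.real_smul

theorem kernelOp_tilted_eq (hP : HasFiniteNorm P w) (a : ℝ) :
    kernelOp (tilted P F a) w = NormedSpace.exp (a • mulOp w F hFm hF) * kernelOp P w := by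
  ext1 h
  refine LInf.ext' fun x => ?_
  rw [kernelOp_tilted_apply hFm hF hP, mul_apply_eq_comp, ← Complex.coe_smul,
    exp_smul_mulOp_apply, Complex.ofReal_exp, Complex.ofReal_mul]

include hFm hF in
theorem contDiff_kernelOp_tilted (hP : HasFiniteNorm P w) (n : WithTop ℕ∞) :
    ContDiff ℝ n fun a => kernelOp (tilted P F a) w := by
  simp only [kernelOp_tilted_eq hFm hF hP]
  refine ContDiff.mul (contDiff_iff_contDiffAt.2 fun a => ?_) contDiff_const
  exact ((NormedSpace.exp_analytic (𝕂 := ℝ) _).contDiffAt).comp a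
    (contDiff_id.smul contDiff_const).contDiffAt

theorem hasDerivAt_kernelOp_tilted (hP : HasFiniteNorm P w) (a : ℝ) :
    HasDerivAt (fun t => kernelOp (tilted P F t) w)
      (mulOp w F hFm hF * kernelOp (tilted P F a) w) a := by
  simp only [kernelOp_tilted_eq hFm hF hP, ← mul_assoc]
  exact (hasDerivAt_exp_smul_const' (𝕂 := ℝ) (mulOp w F hFm hF) a).mul_const (kernelOp P w)

end Tilted

section PositiveEigenfunction

variable {X : Type*} [MeasurableSpace X] {w : X → ℝ≥0} {F : X → ℝ} {c : ℝ≥0}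
  (hFm : Measurable F) (hF : ∀ x, |F x| ≤ c) {P : Kernel X X} {π : Measure X}

theorem ae_eq_zero_of_kernelOp_apply_eq_zero [IsSFiniteKernel P] (hP : HasFiniteNorm P w)
    {g : LInf w} (hg : IsNonneg g) {x : X} (h : kernelOp P w g x = 0) : ∀ᵐ y ∂(P x), g y = 0 := by
  rw [kernelOp_apply_of_isNonneg hP hg, Complex.ofReal_eq_zero,
    integral_eq_zero_iff_of_nonneg (fun _ => norm_nonneg _)
      (integrable_of_hasFiniteNorm hP g x).norm] at h
  exact h.mono fun y hy => norm_eq_zero.1 hy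

variable [IsMarkovKernel P] [IsFiniteMeasure π] {ψ : Measure X}
  (hψ : IsIrreducibilityMeasure P ψ) (hπ : Kernel.Invariant P π)

include hFm hF hψ hπ in
/-- The zeros of a nonnegative eigenfunction form an absorbing set. -/
theorem apply_ne_zero_of_eigenvector_tilted {a : ℝ} (hPa : HasFiniteNorm (tilted P F a) w)
    {g : LInf w} (hg : IsNonneg g) (hgπ : ¬ ∀ᵐ x ∂π, g x = 0) {κ : ℂ}
    (hge : kernelOp (tilted P F a) w g = κ • g) (x : X) : g x ≠ 0 := by
  have hP := hasFiniteNorm_of_tilted hFm hF hPa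
  refine fun hx => hgπ (measure_compl_eq_zero_of_absorbing hψ hπ
    (Z := {x | g x = 0}) (g.measurable (measurableSet_singleton 0)) ⟨x, hx⟩ fun y hy => ?_)
  refine ae_eq_zero_of_kernelOp_apply_eq_zero hP hg ?_
  have hzero : kernelOp (tilted P F a) w g y = 0 := by
    rw [hge, LInf.smul_apply, show g y = 0 from hy, mul_zero]
  rw [kernelOp_tilted_apply hFm hF hP, mul_eq_zero] at hzero
  exact hzero.resolve_left (Complex.ofReal_ne_zero.2 (Real.exp_ne_zero _))

include hFm hF hψ hπ in
theorem IsDominant.exists_isPrincipal_tilted (hwm : Measurable w) (hw : ∀ x, 1 ≤ w x) {a : ℝ}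
    {lam : ℂ} {f : LInf w} {φ : LInf w →L[ℂ] ℂ} (h : IsDominant (kernelOp (tilted P F a) w) lam f φ)
    (hfπ : ¬ ∀ᵐ x ∂π, f x = 0) : ∃ g ψ, IsPrincipal (tilted P F a) hw ‖lam‖ g ψ := by
  have habs : ∀ x, f.abs x ≠ 0 := apply_ne_zero_of_eigenvector_tilted hFm hF hψ hπ h.hasFiniteNorm
    f.isNonneg_abs (fun h0 => hfπ (h0.mono fun x hx => by simpa [LInf.abs_apply] using hx))
    h.kernelOp_abs
  exact h.exists_isPrincipal (fun x hx => habs x (by simp [LInf.abs_apply, hx])) hwm hw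

end PositiveEigenfunction

section LocalFamily

variable {X : Type*} [MeasurableSpace X] {w : X → ℝ≥0}

theorem IsPrincipal.integral_ne_zero {K : Kernel X X} [IsSFiniteKernel K] {hw : ∀ x, 1 ≤ w x}
    {lam : ℝ} {f : LInf w} {φ : LInf w →L[ℂ] ℂ} (h : IsPrincipal K hw lam f φ)
    {m : Measure X} [NeZero m] (hm : ∫⁻ y, w y ∂m ≠ ∞) : ∫ y, f y ∂m ≠ 0 := by
  have hpos : 0 < ∫ y, ‖f y‖ ∂m := by
    rw [integral_pos_iff_support_of_nonneg (fun _ => norm_nonneg _)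
      (f.integrable_of_lintegral_ne_top hm).norm,
      Set.eq_univ_of_forall fun y => Function.mem_support.2 (norm_ne_zero_iff.2 (h.apply_ne y))]
    exact Measure.measure_univ_pos.2 (NeZero.ne m)
  rw [integral_congr_ae (Eventually.of_forall h.isNonneg), integral_complex_ofReal]
  exact Complex.ofReal_ne_zero.2 hpos.ne'

theorem exists_absolutelyContinuous_lintegral_ne_top (hwm : Measurable w) (hw : ∀ x, 1 ≤ w x)
    (m : Measure X) [IsFiniteMeasure m] [NeZero m] :
    ∃ ρ : Measure X, ρ ≠ 0 ∧ ρ ≪ m ∧ ∫⁻ x, w x ∂ρ ≠ ∞ := by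
  have hw0 : ∀ x, w x ≠ 0 := fun x => (zero_lt_one.trans_le (hw x)).ne'
  refine ⟨m.withDensity fun x => ((w x)⁻¹ : ℝ≥0), fun h0 => ?_,
    withDensity_absolutelyContinuous _ _, ?_⟩
  · rw [withDensity_eq_zero_iff (by fun_prop)] at h0
    refine NeZero.ne m (ae_eq_bot.1 (eventually_false_iff_eq_bot.1 (h0.mono fun x hx => ?_)))
    exact hw0 x (by simpa using hx)
  · rw [lintegral_withDensity_eq_lintegral_mul _ (by fun_prop) (by fun_prop)]
    simp [← ENNReal.coe_mul, inv_mul_cancel₀ (hw0 _)]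

theorem IsDominant.exists_perturbation_normalized {E G : Type*} [NormedAddCommGroup E]
    [NormedSpace ℂ E] [CompleteSpace E] [NormedAddCommGroup G] [NormedSpace ℝ G]
    [CompleteSpace G]
    {T : G → E →L[ℂ] E} {a₀ : G} {n : WithTop ℕ∞} (hn : n ≠ 0) (hT : ContDiffAt ℝ n T a₀)
    {lam : ℂ} {f : E} {φ : E →L[ℂ] ℂ} (h : IsDominant (T a₀) lam f φ) {u : E} (hu : φ u = 1) :
    ∃ (l : G → ℂ) (g : G → E) (ψ : G → E →L[ℂ] ℂ), g a₀ = f ∧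
      ContDiffAt ℝ n l a₀ ∧ ContDiffAt ℝ n g a₀ ∧ ContDiffAt ℝ n ψ a₀ ∧
      ∀ᶠ a in 𝓝 a₀, IsDominant (T a) (l a) (g a) (ψ a) ∧ ψ a u = 1 := by
  obtain ⟨l, g, ψ, -, rfl, rfl, hl, hg, hψ, hdom⟩ := h.exists_perturbation hn hT
  have hψu : ContDiffAt ℝ n (fun a => ψ a u) a₀ := contDiffAt_complexCLM_apply hψ contDiffAt_const
  have hψu0 : ∀ᶠ a in 𝓝 a₀, ψ a u ≠ 0 :=
    hψu.continuousAt.eventually_ne (by simp [hu])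
  refine ⟨l, fun a => ψ a u • g a, fun a => (ψ a u)⁻¹ • ψ a, by simp [hu], hl, hψu.smul hg,
    (hψu.inv hψu0.self_of_nhds).smul hψ, ?_⟩
  filter_upwards [hdom, hψu0] with a ha ha0
  exact ⟨by simpa using ha.rescale (inv_ne_zero ha0), by simp [ha0]⟩

theorem IsPrincipal.exists_contDiffAt_isPrincipal_tilted {F : X → ℝ} {c : ℝ≥0}
    (hFm : Measurable F) (hF : ∀ x, |F x| ≤ c) {P : Kernel X X} [IsMarkovKernel P] {π ψ : Measure X}
    [IsFiniteMeasure π] [NeZero π] (hψ : IsIrreducibilityMeasure P ψ) (hπ : Kernel.Invariant P π)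
    (hwm : Measurable w) {hw : ∀ x, 1 ≤ w x} {n : WithTop ℕ∞} (hn : n ≠ 0) {a₀ lam : ℝ} {f : LInf w}
    {φ : LInf w →L[ℂ] ℂ} (h : IsPrincipal (tilted P F a₀) hw lam f φ) :
    ∃ (l : ℝ → ℝ) (g : ℝ → LInf w) (χ : ℝ → LInf w →L[ℂ] ℂ),
      ContDiffAt ℝ n l a₀ ∧ ContDiffAt ℝ n g a₀ ∧ ContDiffAt ℝ n χ a₀ ∧
      ∀ᶠ a in 𝓝 a₀, IsPrincipal (tilted P F a) hw (l a) (g a) (χ a) := by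
  have hP := hasFiniteNorm_of_tilted hFm hF h.dom.hasFiniteNorm
  obtain ⟨l, g, χ, rfl, hl, hg, hχ, hdom⟩ := h.dom.exists_perturbation_normalized hn
    (contDiff_kernelOp_tilted hFm hF hP n).contDiffAt h.mass
  obtain ⟨ρ, hρ0, hρπ, hρ⟩ := exists_absolutelyContinuous_lintegral_ne_top hwm hw π
  have : NeZero ρ := ⟨hρ0⟩
  have hint : ∀ᶠ a in 𝓝 a₀, ∫ x, g a x ∂ρ ≠ 0 := by
    simp only [← integralCLM_apply ρ hρ]
    exact ((integralCLM ρ hρ).continuous.continuousAt.comp hg.continuousAt).eventually_ne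
      (h.integral_ne_zero hρ)
  refine ⟨fun a => (l a).re, g, χ, Complex.reCLM.contDiff.contDiffAt.comp a₀ hl, hg, hχ, ?_⟩
  filter_upwards [hdom, hint] with a ⟨ha, hmass⟩ ha0
  obtain ⟨g', χ', hp⟩ := ha.exists_isPrincipal_tilted hFm hF hψ hπ hwm hw fun h0 =>
    ha0 (integral_eq_zero_of_ae (hρπ.ae_le h0))
  obtain ⟨hl', rfl, rfl⟩ := ha.unique_of_normalized hp.dom hmass hp.mass
  rwa [show (l a).re = ‖l a‖ from congrArg Complex.re hl'.symm]

end LocalFamily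

section KernelComposition

variable {X : Type*} [MeasurableSpace X] {w : X → ℝ≥0} {K L : Kernel X X}

theorem hasFiniteNorm_comp (hwm : Measurable w) (hK : HasFiniteNorm K w) (hL : HasFiniteNorm L w) :
    HasFiniteNorm (K ∘ₖ L) w := by
  obtain ⟨C, hC⟩ := hK
  obtain ⟨D, hD⟩ := hL
  refine ⟨C * D, fun x => ?_⟩
  rw [Kernel.lintegral_comp _ _ _ (by fun_prop)]
  calc ∫⁻ y, ∫⁻ z, w z ∂(K y) ∂(L x) ≤ ∫⁻ y, C * w y ∂(L x) := lintegral_mono hC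
    _ = C * ∫⁻ y, w y ∂(L x) := lintegral_const_mul' _ _ ENNReal.coe_ne_top
    _ ≤ C * (D * w x) := by gcongr; exact hD x
    _ = (C * D : ℝ≥0) * w x := by rw [ENNReal.coe_mul, mul_assoc]

theorem kernelOp_comp [IsSFiniteKernel K] [IsSFiniteKernel L] (hwm : Measurable w)
    (hK : HasFiniteNorm K w) (hL : HasFiniteNorm L w) :
    kernelOp (K ∘ₖ L) w = kernelOp L w * kernelOp K w := by
  have hKL := hasFiniteNorm_comp hwm hK hL
  ext1 h
  refine LInf.ext' fun x => ?_
  rw [mul_apply_eq_comp, kernelOp_apply hKL, kernelOp_apply hL,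
    Kernel.integral_comp (integrable_of_hasFiniteNorm hKL h x)]
  simp only [kernelOp_apply hK]

theorem hasFiniteNorm_id (hwm : Measurable w) : HasFiniteNorm (Kernel.id : Kernel X X) w :=
  ⟨1, fun x => by
    rw [Kernel.id_apply, lintegral_dirac' x (by fun_prop : Measurable fun y => (w y : ℝ≥0∞))]
    simp⟩

theorem hasFiniteNorm_pow (hwm : Measurable w) (hK : HasFiniteNorm K w) (n : ℕ) :
    HasFiniteNorm (K ^ n) w := by
  induction n with
  | zero => exact hasFiniteNorm_id hwm
  | succ n ih => rw [pow_succ]; exact hasFiniteNorm_comp hwm ih hK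

theorem kernelOp_pow [IsMarkovKernel K] (hwm : Measurable w) (hK : HasFiniteNorm K w) (n : ℕ) :
    kernelOp (K ^ n) w = kernelOp K w ^ n := by
  induction n with
  | zero =>
    ext1 h
    refine LInf.ext' fun x => ?_
    change kernelOp Kernel.id w h x = h x
    rw [kernelOp_apply (hasFiniteNorm_id hwm), Kernel.id_apply,
      integral_dirac' _ _ h.measurable.stronglyMeasurable]
  | succ n ih =>
    rw [pow_succ' (kernelOp K w), ← ih, ← kernelOp_comp hwm (hasFiniteNorm_pow hwm hK n) hK]
    simp only [pow_succ]
    rfl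

end KernelComposition

section Invariant

variable {X : Type*} [MeasurableSpace X] {w : X → ℝ≥0} {K : Kernel X X} [IsMarkovKernel K]

theorem IsDominant.tendsto_pow_apply (hwm : Measurable w) (hw : ∃ C : ℝ≥0, ∀ x, 1 ≤ C * w x)
    {e : LInf w} (he : ∀ x, e x = 1) {m : Measure X} [IsProbabilityMeasure m]
    {hm : ∫⁻ y, w y ∂m ≠ ∞} (h : IsDominant (kernelOp K w) 1 e (integralCLM m hm)) {A : Set X}
    (hA : MeasurableSet A) (x : X) : Tendsto (fun n => (K ^ n) x A) atTop (𝓝 (m A)) := by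
  have hlim := LInf.tendsto_apply (h.tendsto_inv_pow_smul (LInf.ind hw A)) x
  simp only [one_pow, inv_one, one_smul, ← kernelOp_pow hwm h.hasFiniteNorm,
    kernelOp_apply (hasFiniteNorm_pow hwm h.hasFiniteNorm _), integralCLM_apply, LInf.smul_apply,
    he, mul_one, integral_ind hw _ hA] at hlim
  refine (ENNReal.tendsto_toReal_iff (fun n => measure_ne_top _ _) (measure_ne_top _ _)).1 ?_
  exact Complex.reCLM.continuous.continuousAt.tendsto.comp hlim

theorem invariant_of_integralCLM_kernelOp (hK : HasFiniteNorm K w)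
    (hw : ∃ C : ℝ≥0, ∀ x, 1 ≤ C * w x) {m : Measure X} [IsFiniteMeasure m] {hm : ∫⁻ y, w y ∂m ≠ ∞}
    (h : ∀ g, integralCLM m hm (kernelOp K w g) = integralCLM m hm g) : Kernel.Invariant K m := by
  refine Measure.ext fun A hA => ?_
  have hind := h (LInf.ind hw A)
  simp only [integralCLM_apply, kernelOp_apply hK, integral_ind hw _ hA, integral_complex_ofReal,
    Complex.ofReal_inj] at hind
  rw [← measureReal_eq_measureReal_iff, ← hind, measureReal_def,
    Measure.bind_apply hA K.aemeasurable]
  exact (integral_toReal (K.measurable_coe hA).aemeasurable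
    (Eventually.of_forall fun x => measure_lt_top _ _)).symm

theorem IsDominant.existsUnique_invariant (hwm : Measurable w) (hw : ∃ C : ℝ≥0, ∀ x, 1 ≤ C * w x)
    {e : LInf w} (he : ∀ x, e x = 1) {φ : LInf w →L[ℂ] ℂ} (h : IsDominant (kernelOp K w) 1 e φ) :
    ∃ (m : Measure X) (hm : ∫⁻ y, w y ∂m ≠ ∞), φ = integralCLM m hm ∧ IsProbabilityMeasure m ∧
      Kernel.Invariant K m ∧
      ∀ ρ : Measure X, IsProbabilityMeasure ρ → Kernel.Invariant K ρ → ρ = m := by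
  have he0 : IsNonneg e := fun x => by simp [he]
  obtain ⟨m, hm, rfl⟩ := (h.isSigmaCont hwm).exists_measure hwm hw fun A hA =>
    h.map_isNonneg he0 (LInf.isNonneg_ind hw hA)
  have hprob : IsProbabilityMeasure m := by
    have hpair := h.pair
    simp only [integralCLM_apply, he, integral_const, Complex.real_smul, mul_one,
      Complex.ofReal_eq_one, measureReal_def, ENNReal.toReal_eq_one_iff] at hpair
    exact ⟨hpair⟩
  exact ⟨m, hm, rfl, hprob,
    invariant_of_integralCLM_kernelOp h.hasFiniteNorm hw fun g => by rw [h.adj, one_mul],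
    fun ρ _ hρ => eq_of_invariant_of_tendsto hρ fun A hA => h.tendsto_pow_apply hwm hw he hA⟩

end Invariant

section Conj

variable {E G : Type*} [NormedAddCommGroup E] [NormedSpace ℂ E] [NormedAddCommGroup G]
  [NormedSpace ℂ G]

theorem IsDominant.conj {T : E →L[ℂ] E} {lam : ℂ} {f : E} {φ : E →L[ℂ] ℂ}
    (h : IsDominant T lam f φ) (J : G ≃L[ℂ] E) {S : G →L[ℂ] G} {c : ℂ} (hc : c ≠ 0)
    (hS : ∀ g, J (S g) = c • T (J g)) :
    IsDominant S (c * lam) (J.symm f) (φ.comp (J : G →L[ℂ] E)) where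
  eig := J.injective <| by rw [hS, map_smul, J.apply_symm_apply, h.eig, smul_smul]
  adj g := by
    change φ (J (S g)) = c * lam * φ (J g)
    rw [hS, map_smul, h.adj, smul_eq_mul, mul_assoc]
  pair := by
    change φ (J (J.symm f)) = 1
    rw [J.apply_symm_apply, h.pair]
  gap := by
    obtain ⟨r, hr0, hr1, hr⟩ := h.gap
    have hcn : 0 < ‖c‖ := norm_pos_iff.2 hc
    refine ⟨‖c‖ * r, by positivity, by rw [norm_mul]; gcongr, fun z hz => ?_⟩
    have hconj : S - (c * lam) • (φ.comp (J : G →L[ℂ] E)).smulRight (J.symm f)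
        = (J.symm.conjContinuousAlgEquiv) ((Units.mk0 c hc) • (T - lam • φ.smulRight f)) := by
      ext1 g
      apply J.injective
      simp [hS, Units.smul_def, mul_smul, smul_sub, smul_comm lam]
    rw [hconj, AlgEquiv.spectrum_eq, spectrum.unit_smul_eq_smul] at hz
    obtain ⟨y, hy, rfl⟩ := hz
    change ‖c * y‖ ≤ _
    rw [norm_mul]
    exact mul_le_mul_of_nonneg_left (hr y hy) hcn.le

end Conj

section LogBound

variable {X : Type*} [MeasurableSpace X] {w : X → ℝ≥0} {K : Kernel X X} [IsMarkovKernel K]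

theorem norm_kernelOp_apply_le (hK : HasFiniteNorm K w) {h : LInf w} {C : ℝ}
    (hC : ∀ x, ‖h x‖ ≤ C) (x : X) : ‖kernelOp K w h x‖ ≤ C := by
  rw [kernelOp_apply hK]
  exact (norm_integral_le_of_norm_le_const (Eventually.of_forall hC)).trans (by simp)

theorem norm_kernelOp_pow_apply_sub_le (hK : HasFiniteNorm K w) {h : LInf w} {κ : ℝ}
    (hκ : ∀ x, ‖(kernelOp K w h - h) x‖ ≤ κ) (n : ℕ) (x : X) :
    ‖((kernelOp K w ^ n) h - h) x‖ ≤ n * κ := by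
  induction n generalizing x with
  | zero => simp [LInf.zero_apply]
  | succ n ih =>
    have hsplit : (kernelOp K w ^ (n + 1)) h - h
        = kernelOp K w ((kernelOp K w ^ n) h - h) + (kernelOp K w h - h) := by
      rw [pow_succ', mul_apply_eq_comp, map_sub]
      abel
    rw [hsplit, LInf.add_apply, Nat.cast_succ, add_mul, one_mul]
    exact (norm_add_le _ _).trans (add_le_add (norm_kernelOp_apply_le hK ih x) (hκ x))

theorem exists_pow_mul_le_one {ρ : ℝ} (hρ0 : 0 < ρ) (hρ1 : ρ < 1) :
    ∃ c : ℝ, 0 ≤ c ∧ ∀ t : ℝ, 0 ≤ t → ∃ n : ℕ, ρ ^ n * t ≤ 1 ∧ (n : ℝ) ≤ c * Real.posLog t + 1 := by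
  have hlogρ : 0 < -Real.log ρ := neg_pos.2 (Real.log_neg hρ0 hρ1)
  refine ⟨(-Real.log ρ)⁻¹, inv_nonneg.2 hlogρ.le, fun t ht => ?_⟩
  have hposLog : 0 ≤ Real.posLog t := Real.posLog_nonneg
  obtain ⟨n, hn, hn'⟩ : ∃ n : ℕ, (-Real.log ρ)⁻¹ * Real.posLog t ≤ n ∧
      (n : ℝ) ≤ (-Real.log ρ)⁻¹ * Real.posLog t + 1 :=
    ⟨_, Nat.le_ceil _, (Nat.ceil_lt_add_one (by positivity)).le⟩
  refine ⟨n, ?_, hn'⟩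
  rcases ht.eq_or_lt with rfl | ht
  · simp
  rw [inv_mul_le_iff₀ hlogρ] at hn
  have hlogt : Real.log t ≤ Real.posLog t := le_max_right _ _
  refine (Real.log_nonpos_iff (by positivity)).1 ?_
  rw [Real.log_mul (by positivity) ht.ne', Real.log_pow]
  linarith

/-- Compare `h` with its limit `φ h` through `K ^ n h`, with `n` of the order of `log⁺ w x`. -/
theorem IsDominant.exists_norm_apply_le_posLog {e : LInf w} (he : ∀ x, e x = 1)
    {φ : LInf w →L[ℂ] ℂ} (hdom : IsDominant (kernelOp K w) 1 e φ) {h : LInf w} {κ : ℝ}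
    (hκ : ∀ x, ‖(kernelOp K w h - h) x‖ ≤ κ) :
    ∃ C : ℝ, ∀ x, ‖h x‖ ≤ C * (1 + Real.posLog (w x)) := by
  rcases isEmpty_or_nonempty X with hX | ⟨⟨x₀⟩⟩
  · exact ⟨0, fun x => (hX.false x).elim⟩
  have hκ0 : 0 ≤ κ := (norm_nonneg _).trans (hκ x₀)
  obtain ⟨C, ρ, hC, hρ0, hρ1, hdec⟩ := hdom.norm_inv_pow_smul_sub_le
  obtain ⟨c, hc, hn⟩ := exists_pow_mul_le_one hρ0 hρ1
  refine ⟨κ * (c + 1) + (C * ‖h‖ + ‖φ h‖), fun x => ?_⟩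
  obtain ⟨n, hρn, hnlog⟩ := hn (w x) (w x).2
  set u := (kernelOp K w ^ n) h
  have hmove : ‖(u - h) x‖ ≤ κ * (c + 1) * (1 + Real.posLog (w x)) := by
    have hlog : 0 ≤ Real.posLog (w x : ℝ) := Real.posLog_nonneg
    calc ‖(u - h) x‖ ≤ n * κ := norm_kernelOp_pow_apply_sub_le hdom.hasFiniteNorm hκ n x
      _ ≤ (c * Real.posLog (w x) + 1) * κ := mul_le_mul_of_nonneg_right hnlog hκ0
      _ ≤ κ * (c + 1) * (1 + Real.posLog (w x)) := by
          nlinarith [mul_nonneg hκ0 hc, mul_nonneg hκ0 hlog]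
  have hlimit : ‖(u - φ h • e) x‖ ≤ C * ‖h‖ := by
    have hdecn := hdec n h
    rw [one_pow, inv_one, one_smul] at hdecn
    calc ‖(u - φ h • e) x‖ ≤ C * ρ ^ n * ‖h‖ * w x :=
          (LInf.le_norm _ x).trans (mul_le_mul_of_nonneg_right hdecn (w x).2)
      _ = C * ‖h‖ * (ρ ^ n * w x) := by ring
      _ ≤ C * ‖h‖ := mul_le_of_le_one_right (by positivity) hρn
  have hsplit : h x = -(u - h) x + (u - φ h • e) x + φ h := by
    rw [LInf.sub_apply, LInf.sub_apply, LInf.smul_apply, he]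
    ring
  have hone : 1 ≤ 1 + Real.posLog (w x : ℝ) := le_add_of_nonneg_right Real.posLog_nonneg
  calc ‖h x‖ ≤ ‖(u - h) x‖ + ‖(u - φ h • e) x‖ + ‖φ h‖ := by
        rw [hsplit, ← norm_neg ((u - h) x)]
        exact norm_add₃_le
    _ ≤ κ * (c + 1) * (1 + Real.posLog (w x)) + C * ‖h‖ + ‖φ h‖ := by gcongr
    _ ≤ (κ * (c + 1) + (C * ‖h‖ + ‖φ h‖)) * (1 + Real.posLog (w x)) := by
        rw [add_mul, add_assoc]
        gcongr
        exact le_mul_of_one_le_right (by positivity) hone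

end LogBound

section WeightChange

variable {X : Type*} {w : X → ℝ≥0} {f : X → ℝ}

theorem coe_twistedWeight (hf : ∀ x, 0 < f x) (x : X) : (twistedWeight w f x : ℝ) = w x / f x := by
  rw [twistedWeight, NNReal.coe_div, Real.coe_toNNReal _ (hf x).le]

theorem exists_one_le_twistedWeight (hf : ∀ x, 0 < f x) (hb : ∃ C : ℝ≥0, ∀ x, f x ≤ C * w x) :
    ∃ C : ℝ≥0, ∀ x, 1 ≤ C * twistedWeight w f x := by
  obtain ⟨C, hC⟩ := hb
  refine ⟨C, fun x => ?_⟩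
  rw [← NNReal.coe_le_coe, NNReal.coe_mul, coe_twistedWeight hf, ← mul_div_assoc, NNReal.coe_one,
    one_le_div (hf x)]
  exact hC x

theorem norm_ofReal_mul_le_iff (hf : ∀ x, 0 < f x) {C : ℝ} {z : ℂ} (x : X) :
    ‖(f x : ℂ) * z‖ ≤ C * w x ↔ ‖z‖ ≤ C * twistedWeight w f x := by
  rw [coe_twistedWeight hf, ← mul_div_assoc, le_div_iff₀ (hf x), norm_mul, Complex.norm_real,
    Real.norm_of_nonneg (hf x).le, mul_comm]

variable [MeasurableSpace X]

theorem measurable_twistedWeight (hwm : Measurable w) (hfm : Measurable f) :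
    Measurable (twistedWeight w f) := hwm.div hfm.real_toNNReal

/-- Multiplication by a positive function `f`, as an isometry from `L_∞^{w/f}` onto `L_∞^w`. -/
def mulIsometry (w : X → ℝ≥0) (hfm : Measurable f) (hf : ∀ x, 0 < f x) :
    LInf (twistedWeight w f) ≃ₗᵢ[ℂ] LInf w where
  toFun h := LInf.mk (fun x => f x * h x)
    ((Complex.measurable_ofReal.comp hfm).mul h.measurable)
    (h.bound.imp fun _ hC x => (norm_ofReal_mul_le_iff hf x).2 (hC x))
  invFun h := LInf.mk (fun x => (f x : ℂ)⁻¹ * h x)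
    ((Complex.measurable_ofReal.comp hfm).inv.mul h.measurable)
    (h.bound.imp fun _ hC x => (norm_ofReal_mul_le_iff hf x).1 <| by
      rw [mul_inv_cancel_left₀ (Complex.ofReal_ne_zero.2 (hf x).ne')]
      exact hC x)
  map_add' g h := LInf.ext' fun x => mul_add _ (g x) (h x)
  map_smul' c h := LInf.ext' fun x => mul_left_comm (f x : ℂ) c (h x)
  left_inv h := LInf.ext' fun x => inv_mul_cancel_left₀ (Complex.ofReal_ne_zero.2 (hf x).ne') (h x)
  right_inv h := LInf.ext' fun x => mul_inv_cancel_left₀ (Complex.ofReal_ne_zero.2 (hf x).ne') (h x)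
  norm_map' h := by
    change (⨆ x, ‖(f x : ℂ) * h x‖ / (w x : ℝ)) = ⨆ x, ‖h x‖ / (twistedWeight w f x : ℝ)
    congr! 2 with x
    rw [norm_mul, Complex.norm_real, Real.norm_of_nonneg (hf x).le, coe_twistedWeight hf,
      div_div_eq_mul_div, mul_comm]

theorem mulIsometry_apply (hfm : Measurable f) (hf : ∀ x, 0 < f x)
    (h : LInf (twistedWeight w f)) (x : X) : mulIsometry w hfm hf h x = f x * h x := rfl

theorem mulIsometry_symm_apply (hfm : Measurable f) (hf : ∀ x, 0 < f x) (h : LInf w) (x : X) :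
    (mulIsometry w hfm hf).symm h x = (f x : ℂ)⁻¹ * h x := rfl

end WeightChange

section DoobTransform

variable {X : Type*} [MeasurableSpace X] {w : X → ℝ≥0}

/-- The Doob transform `lam⁻¹ f(x)⁻¹ K(x, dy) f(y)` of a kernel `K`, for `lam > 0` and a positive
function `f`. The kernel `twisted P F a lam f` is, by definition, the Doob transform of
`tilted P F a`. -/
def doobTransform (K : Kernel X X) [IsSFiniteKernel K] (lam : ℝ) (f : X → ℝ) : Kernel X X :=
  K.withDensity fun x y => ((lam⁻¹ * (f x)⁻¹ * f y).toNNReal : ℝ≥0∞)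

instance (K : Kernel X X) [IsSFiniteKernel K] (lam : ℝ) (f : X → ℝ) :
    IsSFiniteKernel (doobTransform K lam f) :=
  inferInstanceAs (IsSFiniteKernel (K.withDensity fun x y =>
    ((lam⁻¹ * (f x)⁻¹ * f y).toNNReal : ℝ≥0∞)))

variable {K : Kernel X X} [IsSFiniteKernel K] {lam : ℝ} {f : X → ℝ}

theorem lintegral_doobTransform (hfm : Measurable f) (x : X) {g : X → ℝ≥0∞} (hg : Measurable g) :
    ∫⁻ y, g y ∂(doobTransform K lam f x)
      = ∫⁻ y, ENNReal.ofReal (lam⁻¹ * (f x)⁻¹ * f y) * g y ∂(K x) :=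
  Kernel.lintegral_withDensity _ (by fun_prop) x hg

variable (hfm : Measurable f) (hf : ∀ x, 0 < f x) (hlam : 0 < lam)

include hfm hf hlam

theorem integral_doobTransform (x : X) (h : X → ℂ) :
    ∫ y, h y ∂(doobTransform K lam f x)
      = (lam : ℂ)⁻¹ * (f x : ℂ)⁻¹ * ∫ y, f y * h y ∂(K x) := by
  have hdens : Measurable (Function.uncurry fun x y => (lam⁻¹ * (f x)⁻¹ * f y).toNNReal) :=
    ((measurable_const.mul (hfm.comp measurable_fst).inv).mul
      (hfm.comp measurable_snd)).real_toNNReal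
  rw [← integral_const_mul]
  refine (Kernel.integral_withDensity hdens).trans
    (integral_congr_ae (Eventually.of_forall fun y => ?_))
  have hx := hf x
  have hy := hf y
  change (lam⁻¹ * (f x)⁻¹ * f y).toNNReal • h y = _
  rw [NNReal.smul_def, Real.coe_toNNReal _ (by positivity), Complex.real_smul]
  push_cast
  ring

theorem hasFiniteNorm_doobTransform (hwm : Measurable w) (hK : HasFiniteNorm K w) :
    HasFiniteNorm (doobTransform K lam f) (twistedWeight w f) := by
  obtain ⟨C, hC⟩ := hK
  have hcancel : ∀ x y, ENNReal.ofReal (lam⁻¹ * (f x)⁻¹ * f y) * twistedWeight w f y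
      = (lam⁻¹.toNNReal * (f x).toNNReal⁻¹ : ℝ≥0) * (w y : ℝ≥0∞) := fun x y => by
    have hx := hf x
    have hy : (f y).toNNReal ≠ 0 := (Real.toNNReal_pos.2 (hf y)).ne'
    rw [ENNReal.ofReal, ← ENNReal.coe_mul, ← ENNReal.coe_mul, twistedWeight,
      Real.toNNReal_mul (by positivity), Real.toNNReal_mul (by positivity),
      Real.toNNReal_inv (x := f x)]
    congr 1
    field_simp
  refine ⟨lam⁻¹.toNNReal * C, fun x => ?_⟩
  rw [lintegral_doobTransform hfm x (measurable_twistedWeight hwm hfm).coe_nnreal_ennreal]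
  calc ∫⁻ y, ENNReal.ofReal (lam⁻¹ * (f x)⁻¹ * f y) * twistedWeight w f y ∂(K x)
      = (lam⁻¹.toNNReal * (f x).toNNReal⁻¹ : ℝ≥0) * ∫⁻ y, w y ∂(K x) := by
        simp only [hcancel, lintegral_const_mul' _ _ ENNReal.coe_ne_top]
    _ ≤ (lam⁻¹.toNNReal * (f x).toNNReal⁻¹ : ℝ≥0) * (C * w x) := by gcongr; exact hC x
    _ = (lam⁻¹.toNNReal * C : ℝ≥0) * twistedWeight w f x := by
        simp only [twistedWeight, ← ENNReal.coe_mul, div_eq_mul_inv]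
        congr 1
        ring

theorem mulIsometry_kernelOp_doobTransform (hwm : Measurable w) (hK : HasFiniteNorm K w)
    (h : LInf (twistedWeight w f)) :
    mulIsometry w hfm hf (kernelOp (doobTransform K lam f) (twistedWeight w f) h)
      = (lam : ℂ)⁻¹ • kernelOp K w (mulIsometry w hfm hf h) := by
  refine LInf.ext' fun x => ?_
  have hx : (f x : ℂ) ≠ 0 := Complex.ofReal_ne_zero.2 (hf x).ne'
  rw [mulIsometry_apply, LInf.smul_apply,
    kernelOp_apply (hasFiniteNorm_doobTransform hfm hf hlam hwm hK), kernelOp_apply hK,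
    integral_doobTransform hfm hf hlam]
  simp only [mulIsometry_apply]
  field_simp

theorem isMarkovKernel_doobTransform (hint : ∀ x, Integrable f (K x))
    (heig : ∀ x, ∫ y, f y ∂(K x) = lam * f x) : IsMarkovKernel (doobTransform K lam f) := by
  refine ⟨fun x => ⟨?_⟩⟩
  have hx := hf x
  have hnonneg : ∀ y, 0 ≤ lam⁻¹ * (f x)⁻¹ * f y := fun y => by
    have hy := hf y
    positivity
  rw [← lintegral_one, lintegral_doobTransform hfm x measurable_const]
  simp only [mul_one]
  rw [← ofReal_integral_eq_lintegral_ofReal ((hint x).const_mul _) (Eventually.of_forall hnonneg),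
    integral_const_mul, heig, ENNReal.ofReal_eq_one]
  field_simp

end DoobTransform

section PrincipalTransform

variable {X : Type*} [MeasurableSpace X] {w : X → ℝ≥0} {hw : ∀ x, 1 ≤ w x} {K : Kernel X X}
  [IsSFiniteKernel K] {lam : ℝ} {f : LInf w} {φ : LInf w →L[ℂ] ℂ}

theorem LInf.measurable_re (f : LInf w) : Measurable fun x => (f x).re :=
  Complex.measurable_re.comp f.measurable

namespace IsPrincipal

theorem coe_re (h : IsPrincipal K hw lam f φ) (x : X) : ((f x).re : ℂ) = f x := by
  rw [h.isNonneg x, Complex.ofReal_re]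

theorem re_pos (h : IsPrincipal K hw lam f φ) (x : X) : 0 < (f x).re := by
  rw [h.isNonneg x, Complex.ofReal_re]
  exact norm_pos_iff.2 (h.apply_ne x)

theorem exists_one_le_twistedWeight (h : IsPrincipal K hw lam f φ) :
    ∃ C : ℝ≥0, ∀ x, 1 ≤ C * twistedWeight w (fun x => (f x).re) x :=
  VGeo.exists_one_le_twistedWeight h.re_pos
    ⟨‖f‖₊, fun x => (Complex.re_le_norm _).trans (f.le_norm x)⟩

theorem isMarkovKernel_doobTransform (h : IsPrincipal K hw lam f φ) :
    IsMarkovKernel (doobTransform K lam fun x => (f x).re) := by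
  refine VGeo.isMarkovKernel_doobTransform f.measurable_re h.re_pos h.pos
    (fun x => (integrable_of_hasFiniteNorm h.dom.hasFiniteNorm f x).re) fun x => ?_
  have heig : kernelOp K w f x = lam * f x := by rw [h.dom.eig, LInf.smul_apply]
  rw [kernelOp_apply h.dom.hasFiniteNorm, ← h.coe_re x,
    ← funext h.coe_re, integral_complex_ofReal] at heig
  exact_mod_cast heig

/-- Multiplication by the principal eigenfunction `f`, as an isometry from `L_∞^{w/f}` onto
`L_∞^w`. -/
def mulIsometry (h : IsPrincipal K hw lam f φ) :
    LInf (twistedWeight w fun x => (f x).re) ≃ₗᵢ[ℂ] LInf w :=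
  VGeo.mulIsometry w f.measurable_re h.re_pos

theorem mulIsometry_apply (h : IsPrincipal K hw lam f φ)
    (g : LInf (twistedWeight w fun x => (f x).re)) (x : X) : h.mulIsometry g x = f x * g x := by
  rw [← h.coe_re x]; rfl

theorem mulIsometry_symm_apply (h : IsPrincipal K hw lam f φ) (g : LInf w) (x : X) :
    h.mulIsometry.symm g x = (f x)⁻¹ * g x := by
  rw [← h.coe_re x]; rfl

theorem mulIsometry_symm_self (h : IsPrincipal K hw lam f φ) (x : X) :
    h.mulIsometry.symm f x = 1 := by
  rw [h.mulIsometry_symm_apply, inv_mul_cancel₀ (h.apply_ne x)]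

theorem isDominant_doobTransform (hwm : Measurable w) (h : IsPrincipal K hw lam f φ) :
    IsDominant (kernelOp (doobTransform K lam fun x => (f x).re)
        (twistedWeight w fun x => (f x).re)) 1 (h.mulIsometry.symm f)
      (φ.comp (h.mulIsometry.toContinuousLinearEquiv :
        LInf (twistedWeight w fun x => (f x).re) →L[ℂ] LInf w)) := by
  have hlam : (lam : ℂ) ≠ 0 := Complex.ofReal_ne_zero.2 h.pos.ne'
  have hconj := h.dom.conj h.mulIsometry.toContinuousLinearEquiv (inv_ne_zero hlam) fun g =>
    mulIsometry_kernelOp_doobTransform f.measurable_re h.re_pos h.pos hwm h.dom.hasFiniteNorm g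
  rwa [inv_mul_cancel₀ hlam] at hconj

theorem isUniform_doobTransform (hwm : Measurable w) (h : IsPrincipal K hw lam f φ) :
    IsUniform (doobTransform K lam fun x => (f x).re) (twistedWeight w fun x => (f x).re) := by
  have hdom := h.isDominant_doobTransform hwm
  have hwm' := measurable_twistedWeight hwm f.measurable_re
  obtain ⟨ν, hν⟩ := (hdom.isSigmaCont hwm').exists_M1 hwm' h.exists_one_le_twistedWeight
  rw [← hν] at hdom
  exact ⟨1, hdom.hasFiniteNorm, hdom.isUniformOpWith⟩

theorem existsUnique_invariant_doobTransform (hwm : Measurable w) (h : IsPrincipal K hw lam f φ) :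
    ∃ m : Measure X, (IsProbabilityMeasure m ∧
      Kernel.Invariant (doobTransform K lam fun x => (f x).re) m) ∧
      (∀ ρ : Measure X, IsProbabilityMeasure ρ →
        Kernel.Invariant (doobTransform K lam fun x => (f x).re) ρ → ρ = m) ∧
      ∀ g : LInf w, φ g = ∫ x, (f x)⁻¹ * g x ∂m := by
  have := h.isMarkovKernel_doobTransform
  obtain ⟨m, hm, hφ, hprob, hinv, huniq⟩ :=
    (h.isDominant_doobTransform hwm).existsUnique_invariant
      (measurable_twistedWeight hwm f.measurable_re) h.exists_one_le_twistedWeight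
      h.mulIsometry_symm_self
  refine ⟨m, ⟨hprob, hinv⟩, huniq, fun g => ?_⟩
  calc φ g = φ (h.mulIsometry (h.mulIsometry.symm g)) := by rw [h.mulIsometry.apply_symm_apply]
    _ = integralCLM m hm (h.mulIsometry.symm g) := by rw [← hφ]; rfl
    _ = ∫ x, (f x)⁻¹ * g x ∂m := by simp only [integralCLM_apply, h.mulIsometry_symm_apply]

end IsPrincipal

end PrincipalTransform

section Potential

variable {E : Type*} [NormedAddCommGroup E] [NormedSpace ℂ E] {T : E →L[ℂ] E} {lam : ℂ} {f : E}
  {φ : E →L[ℂ] ℂ}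

theorem IsEigentriple.eq_smul_resolvent (h : IsEigentriple T lam f φ) {s₀ u : E} {φ₀ : E →L[ℂ] ℂ}
    (hu : φ u = 1) (hU : lam ∈ resolventSet ℂ (T - φ₀.smulRight s₀)) :
    let U := resolvent (T - φ₀.smulRight s₀) lam
    φ₀ (U u) ≠ 0 ∧ φ (U s₀) ≠ 0 ∧ φ = (φ₀ (U u))⁻¹ • φ₀.comp U ∧ f = (φ (U s₀))⁻¹ • U s₀ := by
  intro U
  have hf : f = φ₀ f • U s₀ := eq_smul_resolvent_of_eigenvector hU h.eig
  have hφ : ∀ v, φ v = φ s₀ * φ₀ (U v) := left_eigenvector_apply_eq hU h.adj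
  have hφu : φ s₀ * φ₀ (U u) = 1 := by rw [← hφ, hu]
  have hφf : φ₀ f * φ (U s₀) = 1 := by rw [← smul_eq_mul, ← map_smul, ← hf, h.pair]
  refine ⟨right_ne_zero_of_mul_eq_one hφu, right_ne_zero_of_mul_eq_one hφf, ?_, ?_⟩
  · ext1 v
    rw [hφ v, eq_inv_of_mul_eq_one_left hφu]
    rfl
  · rwa [← eq_inv_of_mul_eq_one_left hφf]

end Potential

section Derivative

variable {E G : Type*} [NormedAddCommGroup E] [NormedSpace ℂ E] [NormedAddCommGroup G]
  [NormedSpace ℂ G]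

theorem hasDerivAt_complexCLM_apply {A : ℝ → E →L[ℂ] G} {A' : E →L[ℂ] G} {u : ℝ → E} {u' : E}
    {a : ℝ} (hA : HasDerivAt A A' a) (hu : HasDerivAt u u' a) :
    HasDerivAt (fun t => A t (u t)) (A' (u a) + A a u') a :=
  ((ContinuousLinearMap.restrictScalarsL ℂ E G ℝ ℝ).hasFDerivAt.comp_hasDerivAt a hA).clm_apply hu

variable {lam : ℝ → ℝ} {dl a : ℝ} {f : ℝ → E} {df : E}

theorem apply_deriv_eigenvector {T : ℝ → E →L[ℂ] E} {M : E →L[ℂ] E}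
    (hT : HasDerivAt T (M * T a) a) (hl : HasDerivAt lam dl a) (hf : HasDerivAt f df a)
    (hlam : lam a ≠ 0) (heig : ∀ᶠ t in 𝓝 a, T t (f t) = (lam t : ℂ) • f t) :
    T a df = (lam a : ℂ) • (df - M (f a) + ((dl / lam a : ℝ) : ℂ) • f a) := by
  have hleft : HasDerivAt (fun t => T t (f t)) ((M * T a) (f a) + T a df) a :=
    hasDerivAt_complexCLM_apply hT hf
  have hright : HasDerivAt (fun t => (lam t : ℂ) • f t) ((lam a : ℂ) • df + (dl : ℂ) • f a) a :=
    hl.ofReal_comp.smul hf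
  have hderiv := hleft.unique (hright.congr_of_eventuallyEq heig)
  have hdl : (lam a : ℂ) • ((dl / lam a : ℝ) : ℂ) • f a = (dl : ℂ) • f a := by
    rw [smul_smul, ← Complex.ofReal_mul, mul_div_cancel₀ _ hlam]
  have hM : (M * T a) (f a) = (lam a : ℂ) • M (f a) := by
    change M (T a (f a)) = _
    rw [heig.self_of_nhds, map_smul]
  rw [smul_add, smul_sub, hdl, eq_sub_of_add_eq' hderiv, hM]
  abel

theorem IsEigentriple.logDeriv_eq {T : E →L[ℂ] E} {z κ : ℂ} {f g df : E} {φ : E →L[ℂ] ℂ}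
    (h : IsEigentriple T z f φ) (hz : z ≠ 0) (hd : T df = z • (df - g + κ • f)) : κ = φ g := by
  have hφ := congrArg φ hd
  simp only [map_add, map_sub, map_smul, h.adj, h.pair, smul_eq_mul, mul_one] at hφ
  linear_combination -mul_left_cancel₀ hz hφ

theorem apply_deriv_eq_zero {φ : ℝ → E →L[ℂ] ℂ} (hφ : DifferentiableAt ℝ φ a)
    (hf : HasDerivAt f df a) (hpair : ∀ᶠ t in 𝓝 a, φ t (f t) = 1)
    (hmass : ∀ᶠ t in 𝓝 a, φ t (f a) = 1) : φ a df = 0 := by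
  have hone : HasDerivAt (fun _ : ℝ => (1 : ℂ)) 0 a := hasDerivAt_const a 1
  have hderiv_pair := (hasDerivAt_complexCLM_apply hφ.hasDerivAt hf).unique
    (hone.congr_of_eventuallyEq hpair)
  have hderiv_mass := (hasDerivAt_complexCLM_apply hφ.hasDerivAt (hasDerivAt_const a (f a))).unique
    (hone.congr_of_eventuallyEq hmass)
  rw [map_zero, add_zero] at hderiv_mass
  rwa [hderiv_mass, zero_add] at hderiv_pair

end Derivative

section WeightedDerivative

variable {X : Type*} [MeasurableSpace X] {w : X → ℝ≥0}

theorem LInf.hasDerivAt_apply {f : ℝ → LInf w} {df : LInf w} {a : ℝ} (hf : HasDerivAt f df a)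
    (x : X) : HasDerivAt (fun t => f t x) (df x) a :=
  ((LInf.eval w x).restrictScalars ℝ).hasFDerivAt.comp_hasDerivAt a hf

theorem LInf.im_deriv_eq_zero {f : ℝ → LInf w} {df : LInf w} {a : ℝ} (hf : HasDerivAt f df a)
    (hnn : ∀ᶠ t in 𝓝 a, IsNonneg (f t)) (x : X) : (df x).im = 0 := by
  have him : HasDerivAt (fun t => (f t x).im) (df x).im a :=
    Complex.imCLM.hasFDerivAt.comp_hasDerivAt a (LInf.hasDerivAt_apply hf x)
  exact (him.congr_of_eventuallyEq (hnn.mono fun t ht => (ht.im_eq_zero x).symm)).unique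
    (hasDerivAt_const a 0)

theorem LInf.hasDerivAt_log_re {f : ℝ → LInf w} {df : LInf w} {a : ℝ} (hf : HasDerivAt f df a)
    {x : X} (hx : (f a x).re ≠ 0) :
    HasDerivAt (fun t => Real.log (f t x).re) ((df x).re / (f a x).re) a := by
  have hre : HasDerivAt (fun t => (f t x).re) (df x).re a :=
    Complex.reCLM.hasFDerivAt.comp_hasDerivAt a (LInf.hasDerivAt_apply hf x)
  exact hre.log hx

theorem M1.exists_hasDerivAt (hwm : Measurable w) (hw : ∃ C : ℝ≥0, ∀ x, 1 ≤ C * w x)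
    {μ : ℝ → M1 w} {a : ℝ} (hμ : DifferentiableAt ℝ (fun t => (μ t).toDual) a) :
    ∃ dμ : M1 w, HasDerivAt (fun t => (μ t).toDual) dμ.toDual a := by
  have hslope := hasDerivAt_iff_tendsto_slope.1 hμ.hasDerivAt
  have hcont := IsSigmaCont.of_tendsto (Eventually.of_forall fun t => by
    rw [slope_def_module, ← Complex.coe_smul]
    exact (((μ t).isSigmaCont hwm).sub ((μ a).isSigmaCont hwm)).smul _) hslope
  obtain ⟨dμ, hdμ⟩ := hcont.exists_M1 hwm hw
  exact ⟨dμ, hdμ ▸ hμ.hasDerivAt⟩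

end WeightedDerivative

section Poisson

variable {X : Type*} [MeasurableSpace X] {w : X → ℝ≥0} {hw : ∀ x, 1 ≤ w x} {K : Kernel X X}
  [IsSFiniteKernel K] {F : X → ℝ} {c : ℝ≥0} {hFm : Measurable F} {hF : ∀ x, |F x| ≤ c}
  {lam κ : ℝ} {f df : LInf w} {φ : LInf w →L[ℂ] ℂ}

namespace IsPrincipal

theorem kernelOp_doobTransform_logDeriv (hwm : Measurable w) (h : IsPrincipal K hw lam f φ)
    (hd : kernelOp K w df = (lam : ℂ) • (df - mulOp w F hFm hF f + (κ : ℂ) • f)) (x : X) :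
    kernelOp (doobTransform K lam fun x => (f x).re) (twistedWeight w fun x => (f x).re)
      (h.mulIsometry.symm df) x = h.mulIsometry.symm df x - F x + κ := by
  have hconj : h.mulIsometry (kernelOp (doobTransform K lam fun x => (f x).re)
      (twistedWeight w fun x => (f x).re) (h.mulIsometry.symm df))
      = df - mulOp w F hFm hF f + (κ : ℂ) • f := by
    rw [IsPrincipal.mulIsometry, mulIsometry_kernelOp_doobTransform f.measurable_re h.re_pos h.pos
      hwm h.dom.hasFiniteNorm, LinearIsometryEquiv.apply_symm_apply, hd,
      inv_smul_smul₀ (Complex.ofReal_ne_zero.2 h.pos.ne')]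
  rw [← h.mulIsometry.symm_apply_apply (kernelOp _ _ _), hconj]
  have hx := h.apply_ne x
  simp only [h.mulIsometry_symm_apply, LInf.add_apply, LInf.sub_apply, LInf.smul_apply,
    mulOp_apply]
  field_simp

theorem mulIsometry_symm_eq_ofReal (h : IsPrincipal K hw lam f φ) (him : ∀ x, (df x).im = 0)
    (x : X) : h.mulIsometry.symm df x = (((df x).re / (f x).re : ℝ) : ℂ) := by
  rw [h.mulIsometry_symm_apply, Complex.ofReal_div, h.coe_re, div_eq_inv_mul]
  congr 1
  exact Complex.ext rfl (him x)

theorem integral_logDeriv_doobTransform (hwm : Measurable w) (h : IsPrincipal K hw lam f φ)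
    (hd : kernelOp K w df = (lam : ℂ) • (df - mulOp w F hFm hF f + (κ : ℂ) • f))
    (him : ∀ x, (df x).im = 0) (x : X) :
    Integrable (fun y => (df y).re / (f y).re) (doobTransform K lam (fun y => (f y).re) x) ∧
      ∫ y, (df y).re / (f y).re ∂(doobTransform K lam (fun y => (f y).re) x)
        = (df x).re / (f x).re - F x + κ := by
  have hfin := (h.isDominant_doobTransform hwm).hasFiniteNorm
  have hint := integrable_of_hasFiniteNorm hfin (h.mulIsometry.symm df) x
  have hpoisson := h.kernelOp_doobTransform_logDeriv hwm hd x
  rw [kernelOp_apply hfin, h.mulIsometry_symm_eq_ofReal him x] at hpoisson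
  rw [funext (h.mulIsometry_symm_eq_ofReal him)] at hint
  rw [funext (h.mulIsometry_symm_eq_ofReal him), integral_complex_ofReal] at hpoisson
  exact ⟨hint.re, by exact_mod_cast hpoisson⟩

theorem exists_abs_logDeriv_le_posLog (hwm : Measurable w) (h : IsPrincipal K hw lam f φ)
    (hd : kernelOp K w df = (lam : ℂ) • (df - mulOp w F hFm hF f + (κ : ℂ) • f)) :
    ∃ C : ℝ, ∀ x, |(df x).re / (f x).re| ≤ C * (1 + Real.posLog (w x / (f x).re)) := by
  have := h.isMarkovKernel_doobTransform
  have hdefect : ∀ x, ‖(kernelOp (doobTransform K lam fun x => (f x).re)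
      (twistedWeight w fun x => (f x).re) (h.mulIsometry.symm df) - h.mulIsometry.symm df) x‖
      ≤ c + |κ| := fun x => by
    rw [LInf.sub_apply, h.kernelOp_doobTransform_logDeriv hwm hd]
    calc ‖h.mulIsometry.symm df x - F x + κ - h.mulIsometry.symm df x‖ = ‖-(F x : ℂ) + κ‖ := by
          congr 1; ring
      _ ≤ |F x| + |κ| := by
          simpa only [norm_neg, Complex.norm_real, Real.norm_eq_abs] using
            norm_add_le (-(F x : ℂ)) κ
      _ ≤ c + |κ| := by gcongr; exact hF x
  obtain ⟨C, hC⟩ := (h.isDominant_doobTransform hwm).exists_norm_apply_le_posLog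
    h.mulIsometry_symm_self hdefect
  refine ⟨C, fun x => ?_⟩
  have hCx := hC x
  rw [coe_twistedWeight h.re_pos, h.mulIsometry_symm_apply, ← h.coe_re, ← div_eq_inv_mul] at hCx
  refine le_trans ?_ hCx
  rw [← Complex.div_ofReal_re]
  exact Complex.abs_re_le_norm _

theorem existsUnique_invariant_logDeriv (hwm : Measurable w) (h : IsPrincipal K hw lam f φ)
    (hd : kernelOp K w df = (lam : ℂ) • (df - mulOp w F hFm hF f + (κ : ℂ) • f)) :
    ∃ m : Measure X, (IsProbabilityMeasure m ∧
      Kernel.Invariant (doobTransform K lam fun x => (f x).re) m) ∧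
      (∀ ρ : Measure X, IsProbabilityMeasure ρ →
        Kernel.Invariant (doobTransform K lam fun x => (f x).re) ρ → ρ = m) ∧
      ∫ x, F x ∂m = κ := by
  obtain ⟨m, hm, huniq, hφ⟩ := h.existsUnique_invariant_doobTransform hwm
  refine ⟨m, hm, huniq, ?_⟩
  have hκ := h.dom.logDeriv_eq h.dom.ne_zero hd
  rw [hφ] at hκ
  simp only [mulOp_apply, mul_comm ((F _ : ℂ)), inv_mul_cancel_left₀ (h.apply_ne _)] at hκ
  rw [integral_complex_ofReal] at hκ
  exact_mod_cast hκ.symm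

end IsPrincipal

end Poisson

section Untilted

variable {X : Type*} [MeasurableSpace X] {w : X → ℝ≥0} {hw : ∀ x, 1 ≤ w x} {K : Kernel X X}
  [IsMarkovKernel K] {lam : ℝ} {f : LInf w} {φ : LInf w →L[ℂ] ℂ} {π : Measure X}

theorem kernelOp_one (hw : ∀ x, 1 ≤ w x) (hK : HasFiniteNorm K w) :
    kernelOp K w (LInf.one hw) = LInf.one hw := by
  refine LInf.ext' fun x => ?_
  rw [kernelOp_apply hK]
  change ∫ _, (1 : ℂ) ∂(K x) = 1
  simp

/-- A real function dominated by the weight, as an element of `L_∞^w`. -/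
def LInf.ofReal (G : X → ℝ) (hGm : Measurable G) (hG : ∃ C : ℝ, ∀ x, |G x| ≤ C * w x) : LInf w :=
  LInf.mk (fun x => (G x : ℂ)) (Complex.measurable_ofReal.comp hGm) <| by
    obtain ⟨C, hC⟩ := hG
    refine ⟨C.toNNReal, fun x => ?_⟩
    rw [Complex.norm_real]
    exact (hC x).trans (mul_le_mul_of_nonneg_right (Real.le_coe_toNNReal C) (w x).2)

theorem LInf.ofReal_apply {G : X → ℝ} (hGm : Measurable G)
    (hG : ∃ C : ℝ, ∀ x, |G x| ≤ C * w x) (x : X) : LInf.ofReal G hGm hG x = (G x : ℂ) := rfl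

namespace IsPrincipal

theorem eq_one (h : IsPrincipal K hw lam f φ) : lam = 1 ∧ f = LInf.one hw := by
  have heig := kernelOp_one hw h.dom.hasFiniteNorm
  have hlam := h.dom.adj (LInf.one hw)
  rw [heig, h.mass, mul_one] at hlam
  have hf := h.dom.eq_smul_of_eig (g := LInf.one hw) (by rw [heig, ← hlam, one_smul])
  rw [h.mass, one_smul] at hf
  exact ⟨by exact_mod_cast hlam.symm, hf.symm⟩

theorem apply_eq_one (h : IsPrincipal K hw lam f φ) (x : X) : f x = 1 := by
  rw [h.eq_one.2]
  rfl

theorem doobTransform_eq_self (h : IsPrincipal K hw lam f φ) :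
    doobTransform K lam (fun x => (f x).re) = K := by
  rw [doobTransform]
  simp [h.apply_eq_one, h.eq_one.1]

variable [IsProbabilityMeasure π]

theorem apply_eq_integral (hwm : Measurable w) (h : IsPrincipal K hw lam f φ)
    (hπ : Kernel.Invariant K π) (g : LInf w) : φ g = ∫ x, g x ∂π := by
  obtain ⟨m, -, huniq, hφ⟩ := h.existsUnique_invariant_doobTransform hwm
  rw [h.doobTransform_eq_self] at huniq
  simp only [hφ, huniq π ‹_› hπ, h.apply_eq_one, inv_one, one_mul]

theorem eq_of_kernelOp_sub_eq (hwm : Measurable w) (h : IsPrincipal K hw lam f φ)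
    (hπ : Kernel.Invariant K π) {g g' : LInf w} (hgg : kernelOp K w g - g = kernelOp K w g' - g')
    (hint : ∫ x, g x ∂π = ∫ x, g' x ∂π) : g = g' := by
  have hfix : kernelOp K w (g - g') = (lam : ℂ) • (g - g') := by
    rw [h.eq_one.1, Complex.ofReal_one, one_smul, map_sub, sub_eq_sub_iff_sub_eq_sub, hgg]
  have hdiff := h.dom.eq_smul_of_eig hfix
  rwa [map_sub, h.apply_eq_integral hwm hπ, h.apply_eq_integral hwm hπ, hint, sub_self, zero_smul,
    sub_eq_zero] at hdiff

theorem poisson_unique (hwm : Measurable w) (h : IsPrincipal K hw lam f φ)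
    (hπ : Kernel.Invariant K π) {G H F : X → ℝ} {κ : ℝ} (hGm : Measurable G) (hHm : Measurable H)
    (hG : ∃ C : ℝ, ∀ x, |G x| ≤ C * w x) (hH : ∃ C : ℝ, ∀ x, |H x| ≤ C * w x)
    (hGF : ∀ x, ∫ y, G y ∂(K x) = G x - F x + κ) (hHF : ∀ x, ∫ y, H y ∂(K x) = H x - F x + κ)
    (hGH : ∫ x, G x ∂π = ∫ x, H x ∂π) : G = H := by
  have hpoisson : ∀ {J : X → ℝ} (hJm : Measurable J) (hJ : ∃ C : ℝ, ∀ x, |J x| ≤ C * w x),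
      (∀ x, ∫ y, J y ∂(K x) = J x - F x + κ) → ∀ x,
      (kernelOp K w (LInf.ofReal J hJm hJ) - LInf.ofReal J hJm hJ) x = -F x + κ := by
    intro J hJm hJ hJF x
    rw [LInf.sub_apply, kernelOp_apply h.dom.hasFiniteNorm]
    simp only [LInf.ofReal_apply]
    rw [integral_complex_ofReal, hJF]
    push_cast
    ring
  have heq := h.eq_of_kernelOp_sub_eq hwm hπ (g := .ofReal G hGm hG) (g' := .ofReal H hHm hH)
    (LInf.ext' fun x => (hpoisson hGm hG hGF x).trans (hpoisson hHm hH hHF x).symm) (by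
      simp only [LInf.ofReal_apply]
      rw [integral_complex_ofReal, integral_complex_ofReal, hGH])
  exact funext fun x => Complex.ofReal_injective (congrArg (fun g : LInf w => g x) heq)

theorem existsUnique_poisson {F : X → ℝ} {c : ℝ≥0} {hFm : Measurable F} {hF : ∀ x, |F x| ≤ c}
    {κ : ℝ} {df : LInf w} (hwm : Measurable w) (h : IsPrincipal K hw lam f φ)
    (hπ : Kernel.Invariant K π)
    (hd : kernelOp K w df = (lam : ℂ) • (df - mulOp w F hFm hF f + (κ : ℂ) • f))
    (him : ∀ x, (df x).im = 0) (hφ : φ df = 0) :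
    let H : X → ℝ := fun x => (df x).re / (f x).re
    (∃ C : ℝ, ∀ x, |H x| ≤ C * w x) ∧ (∀ x, ∫ y, H y ∂(K x) = H x - F x + ∫ y, F y ∂π) ∧
      ∫ x, H x ∂π = 0 ∧
      ∀ G : X → ℝ, Measurable G → (∃ C : ℝ, ∀ x, |G x| ≤ C * w x) →
        (∀ x, ∫ y, G y ∂(K x) = G x - F x + ∫ y, F y ∂π) → ∫ x, G x ∂π = 0 → G = H := by
  intro H
  have hHdf : ∀ x, df x = (H x : ℂ) := fun x => by
    simp only [H, h.apply_eq_one, Complex.one_re, div_one]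
    exact Complex.ext rfl (him x)
  have hHm : Measurable H := df.measurable_re.div f.measurable_re
  have hHw : ∃ C : ℝ, ∀ x, |H x| ≤ C * w x := ⟨‖df‖, fun x => by
    rw [← Real.norm_eq_abs, ← Complex.norm_real, ← hHdf]
    exact df.le_norm x⟩
  have hκ : ∫ y, F y ∂π = κ := by
    obtain ⟨m, -, huniq, hm⟩ := h.existsUnique_invariant_logDeriv hwm hd
    rw [h.doobTransform_eq_self] at huniq
    rw [huniq π ‹_› hπ, hm]
  have hHF : ∀ x, ∫ y, H y ∂(K x) = H x - F x + κ := fun x => by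
    have := (h.integral_logDeriv_doobTransform hwm hd him x).2
    rwa [h.doobTransform_eq_self] at this
  have hH0 : ∫ x, H x ∂π = 0 := by
    rw [h.apply_eq_integral hwm hπ, funext hHdf, integral_complex_ofReal] at hφ
    exact_mod_cast hφ
  rw [hκ]
  exact ⟨hHw, hHF, hH0, fun G hGm hG hGF hG0 =>
    h.poisson_unique hwm hπ hGm hHm hG hHw hGF hHF (hG0.trans hH0.symm)⟩

end IsPrincipal

end Untilted

section PrincipalSet

variable {X : Type*} [MeasurableSpace X] {w : X → ℝ≥0} {hw : ∀ x, 1 ≤ w x}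

theorem M1.toDual_one (hw : ∀ x, 1 ≤ w x) (μ : M1 w) :
    μ.toDual (LInf.one hw) = μ.toComplexMeasure Set.univ := by
  have hw' : ∃ C : ℝ≥0, ∀ x, 1 ≤ C * w x := ⟨1, by simpa using hw⟩
  have hone : LInf.one hw = LInf.ind hw' Set.univ := LInf.ext' fun x => by
    rw [LInf.ind_apply MeasurableSet.univ, Set.indicator_univ]
    rfl
  rw [hone, μ.toDual_ind hw' MeasurableSet.univ]

namespace IsPrincipal

variable {K : Kernel X X} [IsSFiniteKernel K] {lam : ℝ} {f : LInf w}

theorem exists_M1 (hwm : Measurable w) {φ : LInf w →L[ℂ] ℂ} (h : IsPrincipal K hw lam f φ) :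
    ∃ μ : M1 w, μ.toDual = φ :=
  (h.dom.isSigmaCont hwm).exists_M1 hwm ⟨1, by simpa using hw⟩

variable {μ : M1 w}

theorem isGPE (h : IsPrincipal K hw lam f μ.toDual) : IsGPE K w (lam : ℂ) :=
  ⟨h.dom.hasFiniteNorm, h.dom.isUniformOpWith⟩

theorem isNormalizedEigenpair (h : IsPrincipal K hw lam f μ.toDual) :
    IsNormalizedEigenpair K (lam : ℂ) f μ where
  eigenfunction := h.dom.eig
  eigenmeasure := ContinuousLinearMap.ext h.dom.adj
  pairing := h.dom.pair
  mass := by rw [← μ.toDual_one hw, h.mass]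

theorem eq_of_isNormalizedEigenpair (h : IsPrincipal K hw lam f μ.toDual) {g : LInf w} {ν : M1 w}
    (hg : IsNormalizedEigenpair K (lam : ℂ) g ν) : g = f ∧ ν = μ := by
  have hν := h.dom.eq_smul_of_adj (ψ := ν.toDual) fun k => DFunLike.congr_fun hg.eigenmeasure k
  have hνf : ν.toDual f = 1 := by
    simpa [h.mass, ν.toDual_one hw, hg.mass] using (DFunLike.congr_fun hν (LInf.one hw)).symm
  rw [hνf, one_smul] at hν
  have hgf := h.dom.eq_smul_of_eig hg.eigenfunction
  rw [← hν, hg.pairing, one_smul] at hgf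
  exact ⟨hgf, M1.toDual_injective ⟨1, by simpa using hw⟩ hν⟩

theorem exists_forall_hasPotential (h : IsPrincipal K hw lam f μ.toDual) :
    ∃ (s₀ : LInf w) (ν₀ : M1 w), ∃ ε > 0, ∀ z : ℂ, lam - ε ≤ ‖z‖ →
      HasPotential (kernelOp K w) s₀ ν₀ z := by
  obtain ⟨ε, hε, hmem⟩ := h.dom.exists_forall_mem_resolventSet
  rw [Complex.norm_real, Real.norm_of_nonneg h.pos.le] at hmem
  exact ⟨(lam : ℂ) • f, μ, ε, hε, hmem⟩

end IsPrincipal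

variable {P : Kernel X X} {F : X → ℝ} {c : ℝ≥0} {a : ℝ}

/-- The parameters at which the tilted kernel has a dominant eigenvalue with a positive
eigenfunction and an eigenmeasure in `M_1^w`. -/
def principalSet (P : Kernel X X) [IsSFiniteKernel P] (F : X → ℝ) (hw : ∀ x, 1 ≤ w x) : Set ℝ :=
  {a | ∃ (lam : ℝ) (f : LInf w) (μ : M1 w), IsPrincipal (tilted P F a) hw lam f μ.toDual}

theorem mem_principalSet [IsSFiniteKernel P] (hwm : Measurable w) {lam : ℝ} {f : LInf w}
    {φ : LInf w →L[ℂ] ℂ} (h : IsPrincipal (tilted P F a) hw lam f φ) : a ∈ principalSet P F hw := by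
  obtain ⟨μ, rfl⟩ := h.exists_M1 hwm
  exact ⟨lam, f, μ, h⟩

section Irreducible

variable [IsMarkovKernel P] {π ψ : Measure X} [IsFiniteMeasure π] (hFm : Measurable F)
  (hF : ∀ x, |F x| ≤ c) (hψ : IsIrreducibilityMeasure P ψ) (hπ : Kernel.Invariant P π)
  (hwm : Measurable w)

include hFm hF hψ hπ hwm

theorem mem_principalSet_of_isGPE {lam₀ : ℂ} {h₀ : LInf w}
    (hgpe : IsGPE (tilted P F a) w lam₀) (heig : kernelOp (tilted P F a) w h₀ = lam₀ • h₀)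
    (hne : ¬ ∀ᵐ x ∂π, h₀ x = 0) : a ∈ principalSet P F hw := by
  obtain ⟨f₀, ν, hdom⟩ := hgpe.2.exists_isDominant
  obtain ⟨g, χ, hg⟩ := hdom.exists_isPrincipal_tilted hFm hF hψ hπ hwm hw fun hf₀ => hne <| by
    filter_upwards [hf₀] with x hx
    rw [hdom.eq_smul_of_eig heig, LInf.smul_apply, hx, mul_zero]
  exact mem_principalSet hwm hg

variable [NeZero π]

theorem isOpen_principalSet : IsOpen (principalSet P F hw) := by
  refine isOpen_iff_mem_nhds.2 fun a ⟨_, _, _, h⟩ => ?_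
  obtain ⟨l, g, χ, -, -, -, hev⟩ :=
    h.exists_contDiffAt_isPrincipal_tilted hFm hF hψ hπ hwm one_ne_zero
  exact hev.mono fun t ht => mem_principalSet hwm ht

theorem contDiffAt_of_eventually_isPrincipal_tilted {lam : ℝ → ℝ} {f : ℝ → LInf w}
    {φ : ℝ → LInf w →L[ℂ] ℂ} {n : WithTop ℕ∞} (hn : n ≠ 0)
    (h : ∀ᶠ t in 𝓝 a, IsPrincipal (tilted P F t) hw (lam t) (f t) (φ t)) :
    ContDiffAt ℝ n lam a ∧ ContDiffAt ℝ n f a ∧ ContDiffAt ℝ n φ a := by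
  obtain ⟨l, g, χ, hl, hg, hχ, hev⟩ :=
    h.self_of_nhds.exists_contDiffAt_isPrincipal_tilted hFm hF hψ hπ hwm hn
  have heq := h.and hev
  exact ⟨hl.congr_of_eventuallyEq (heq.mono fun t ht => (ht.2.unique ht.1).1),
    hg.congr_of_eventuallyEq (heq.mono fun t ht => (ht.2.unique ht.1).2.1),
    hχ.congr_of_eventuallyEq (heq.mono fun t ht => (ht.2.unique ht.1).2.2)⟩

end Irreducible

section Family

theorem eventually_eq_smul_potential [IsSFiniteKernel P] (hFm : Measurable F)
    (hF : ∀ x, |F x| ≤ c) {lam : ℝ → ℝ} {f : ℝ → LInf w} {μ : ℝ → M1 w}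
    (h : ∀ᶠ t in 𝓝 a, IsPrincipal (tilted P F t) hw (lam t) (f t) (μ t).toDual)
    (hlam : ContinuousAt lam a) {s₀ : LInf w} {ν₀ : M1 w}
    (hU : ∃ ε > 0, ∀ z : ℂ, lam a - ε ≤ ‖z‖ →
      HasPotential (kernelOp (tilted P F a) w) s₀ ν₀ z) :
    ∀ᶠ t in 𝓝 a, HasPotential (kernelOp (tilted P F t) w) s₀ ν₀ (lam t) ∧
      (let U := potential (kernelOp (tilted P F t) w) s₀ ν₀ (lam t);
        ν₀.toDual (U (LInf.one hw)) ≠ 0 ∧ (μ t).toDual (U s₀) ≠ 0 ∧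
        (μ t).toDual = (ν₀.toDual (U (LInf.one hw)))⁻¹ • ν₀.toDual.comp U ∧
        f t = ((μ t).toDual (U s₀))⁻¹ • U s₀) := by
  obtain ⟨ε, hε, hmem⟩ := hU
  have ha := h.self_of_nhds
  have hlam_mem := hmem (lam a) (by rw [Complex.norm_real, Real.norm_of_nonneg ha.pos.le]; linarith)
  have hT : ContinuousAt (fun t => kernelOp (tilted P F t) w) a :=
    (contDiff_kernelOp_tilted hFm hF (hasFiniteNorm_of_tilted hFm hF ha.dom.hasFiniteNorm)
      0).continuous.continuousAt
  filter_upwards [h, eventually_mem_resolventSet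
    (Complex.continuous_ofReal.continuousAt.comp hlam) (hT.sub continuousAt_const) hlam_mem]
    with t ht hpot
  exact ⟨hpot, ht.dom.eq_smul_resolvent ht.mass hpot⟩

variable {lam : ℝ → ℝ} {f : ℝ → LInf w} {φ : ℝ → LInf w →L[ℂ] ℂ}

theorem kernelOp_tilted_deriv [IsSFiniteKernel P] (hFm : Measurable F) (hF : ∀ x, |F x| ≤ c)
    (h : ∀ᶠ t in 𝓝 a, IsPrincipal (tilted P F t) hw (lam t) (f t) (φ t))
    (hlam : DifferentiableAt ℝ lam a) (hf : DifferentiableAt ℝ f a) :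
    kernelOp (tilted P F a) w (deriv f a) = (lam a : ℂ) •
      (deriv f a - mulOp w F hFm hF (f a) + ((deriv lam a / lam a : ℝ) : ℂ) • f a) :=
  have ha := h.self_of_nhds
  have hP := hasFiniteNorm_of_tilted hFm hF ha.dom.hasFiniteNorm
  apply_deriv_eigenvector (hasDerivAt_kernelOp_tilted hFm hF hP a) hlam.hasDerivAt hf.hasDerivAt
    ha.pos.ne' (h.mono fun _ ht => ht.dom.eig)

theorem exists_invariant_twisted [IsSFiniteKernel P] (hFm : Measurable F) (hF : ∀ x, |F x| ≤ c)
    (hwm : Measurable w)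
    (h : ∀ᶠ t in 𝓝 a, IsPrincipal (tilted P F t) hw (lam t) (f t) (φ t))
    (hlam : DifferentiableAt ℝ lam a) (hf : DifferentiableAt ℝ f a) :
    ∃ m : Measure X,
      (IsProbabilityMeasure m ∧
        Kernel.Invariant (twisted P F a (lam a) fun x => (f a x).re) m) ∧
      (∀ ρ : Measure X, IsProbabilityMeasure ρ →
        Kernel.Invariant (twisted P F a (lam a) fun x => (f a x).re) ρ → ρ = m) ∧
      HasDerivAt (fun t => Real.log (lam t)) (∫ x, F x ∂m) a ∧
      ∀ x, Integrable (fun y => (deriv f a y).re / (f a y).re)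
          (twisted P F a (lam a) (fun y => (f a y).re) x) ∧
        ∫ y, (deriv f a y).re / (f a y).re ∂(twisted P F a (lam a) (fun y => (f a y).re) x) =
          (deriv f a x).re / (f a x).re - F x + ∫ y, F y ∂m := by
  have ha := h.self_of_nhds
  have hd := kernelOp_tilted_deriv hFm hF h hlam hf
  obtain ⟨m, hm, huniq, hκ⟩ := ha.existsUnique_invariant_logDeriv hwm hd
  refine ⟨m, hm, huniq, ?_, fun x => ?_⟩
  · rw [hκ]
    exact hlam.hasDerivAt.log ha.pos.ne'
  · rw [hκ]
    exact ha.integral_logDeriv_doobTransform hwm hd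
      (LInf.im_deriv_eq_zero hf.hasDerivAt (h.mono fun _ ht => ht.isNonneg)) x

theorem existsUnique_poisson_deriv_zero [IsMarkovKernel P] {π : Measure X} [IsProbabilityMeasure π]
    (hFm : Measurable F) (hF : ∀ x, |F x| ≤ c) (hπ : Kernel.Invariant P π) (hwm : Measurable w)
    (h : ∀ᶠ t in 𝓝 0, IsPrincipal (tilted P F t) hw (lam t) (f t) (φ t))
    (hlam : DifferentiableAt ℝ lam 0) (hf : DifferentiableAt ℝ f 0) (hφ : DifferentiableAt ℝ φ 0) :
    let H : X → ℝ := fun x => (deriv f 0 x).re / (f 0 x).re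
    (∃ C : ℝ, ∀ x, |H x| ≤ C * w x) ∧ (∀ x, ∫ y, H y ∂(P x) = H x - F x + ∫ y, F y ∂π) ∧
      ∫ x, H x ∂π = 0 ∧
      ∀ G : X → ℝ, Measurable G → (∃ C : ℝ, ∀ x, |G x| ≤ C * w x) →
        (∀ x, ∫ y, G y ∂(P x) = G x - F x + ∫ y, F y ∂π) → ∫ x, G x ∂π = 0 → G = H := by
  have h0 := h.self_of_nhds
  have : IsMarkovKernel (tilted P F 0) := by rw [tilted_zero]; infer_instance
  have hφ0 : φ 0 (deriv f 0) = 0 := apply_deriv_eq_zero hφ hf.hasDerivAt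
    (h.mono fun _ ht => ht.dom.pair) (h.mono fun _ ht => by rw [h0.eq_one.2, ht.mass])
  have hpoisson := h0.existsUnique_poisson (π := π) hwm (by rwa [tilted_zero])
    (kernelOp_tilted_deriv hFm hF h hlam hf)
    (LInf.im_deriv_eq_zero hf.hasDerivAt (h.mono fun _ ht => ht.isNonneg)) hφ0
  simpa only [tilted_zero] using hpoisson

end Family

end PrincipalSet

end VGeo

end

open VGeo in
theorem mainTheorem11_general {X : Type*} [MeasurableSpace X]
    (P : Kernel X X) [IsMarkovKernel P] (ψ : Measure X) (hψ : IsIrreducibilityMeasure P ψ)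
    (V : X → ℝ≥0) (hVm : Measurable V) (hV : ∀ x, 1 ≤ V x)
    (π : Measure X) [IsProbabilityMeasure π] (hπ : Kernel.Invariant P π)
    (F : X → ℝ) (hFm : Measurable F) (c : ℝ≥0) (hF : ∀ x, |F x| ≤ c) (a₀ : ℝ)
    (hpos : ∃ (lam₀ : ℂ) (h₀ : LInf V), IsGPE (tilted P F a₀) V lam₀ ∧
      kernelOp (tilted P F a₀) V h₀ = lam₀ • h₀ ∧ ¬ (∀ᵐ x ∂π, h₀ x = 0)) :
    ∃ (O : Set ℝ) (lam : ℝ → ℝ) (f : ℝ → LInf V) (μ : ℝ → M1 V)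
      (Fhat : ℝ → X → ℝ), IsOpen O ∧ a₀ ∈ O ∧
      (∀ a ∈ O,
        IsGPE (tilted P F a) V (lam a : ℂ) ∧ 0 < lam a ∧
        IsNormalizedEigenpair (tilted P F a) (lam a : ℂ) (f a) (μ a) ∧
        (∀ (g : LInf V) (ν : M1 V),
          IsNormalizedEigenpair (tilted P F a) (lam a : ℂ) g ν → g = f a ∧ ν = μ a) ∧
        (∀ x, (f a x).im = 0 ∧ 0 < (f a x).re)) ∧
      (∃ (s₀ : LInf V) (ν₀ : M1 V), ∃ ε > 0, ∀ z : ℂ, lam a₀ - ε ≤ ‖z‖ →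
        HasPotential (kernelOp (tilted P F a₀) V) s₀ ν₀ z) ∧
      (∀ (s₀ : LInf V) (ν₀ : M1 V),
        (∃ ε > 0, ∀ z : ℂ, lam a₀ - ε ≤ ‖z‖ →
          HasPotential (kernelOp (tilted P F a₀) V) s₀ ν₀ z) →
        ∀ᶠ a in 𝓝 a₀,
          HasPotential (kernelOp (tilted P F a) V) s₀ ν₀ (lam a) ∧
          (let U := potential (kernelOp (tilted P F a) V) s₀ ν₀ (lam a);
            ν₀.toDual (U (LInf.one hV)) ≠ 0 ∧ (μ a).toDual (U s₀) ≠ 0 ∧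
            (μ a).toDual = (ν₀.toDual (U (LInf.one hV)))⁻¹ • ν₀.toDual.comp U ∧
            f a = ((μ a).toDual (U s₀))⁻¹ • U s₀)) ∧
      (∀ a ∈ O, ∀ x, HasDerivAt (fun t => Real.log (f t x).re) (Fhat a x) a) ∧
      (∀ a ∈ O,
        IsMarkovKernel (twisted P F a (lam a) fun x => (f a x).re) ∧
        IsUniform (twisted P F a (lam a) fun x => (f a x).re)
          (twistedWeight V fun x => (f a x).re) ∧
        (∃ π' : Measure X,
          (IsProbabilityMeasure π' ∧
            Kernel.Invariant (twisted P F a (lam a) fun x => (f a x).re) π') ∧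
          (∀ ρ : Measure X, IsProbabilityMeasure ρ →
            Kernel.Invariant (twisted P F a (lam a) fun x => (f a x).re) ρ → ρ = π') ∧
          HasDerivAt (fun t => Real.log (lam t)) (∫ x, F x ∂π') a ∧
          (∀ x, Integrable (Fhat a) (twisted P F a (lam a) (fun y => (f a y).re) x) ∧
            ∫ y, Fhat a y ∂(twisted P F a (lam a) (fun y => (f a y).re) x) =
              Fhat a x - F x + ∫ y, F y ∂π')) ∧
        (∃ df : LInf V, HasDerivAt f df a) ∧
        (∃ dμ : M1 V, HasDerivAt (fun t => (μ t).toDual) dμ.toDual a) ∧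
        Measurable (Fhat a) ∧
        ∃ C : ℝ, ∀ x, |Fhat a x| ≤ C * (1 + Real.posLog (V x / (f a x).re))) ∧
      (0 ∈ O →
        (∃ C : ℝ, ∀ x, |Fhat 0 x| ≤ C * V x) ∧
        (∀ x, ∫ y, Fhat 0 y ∂(P x) = Fhat 0 x - F x + ∫ y, F y ∂π) ∧
        ∫ x, Fhat 0 x ∂π = 0 ∧
        ∀ G : X → ℝ, Measurable G → (∃ C : ℝ, ∀ x, |G x| ≤ C * V x) →
          (∀ x, ∫ y, G y ∂(P x) = G x - F x + ∫ y, F y ∂π) →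
          ∫ x, G x ∂π = 0 → G = Fhat 0) := by
  obtain ⟨lam₀, h₀, hgpe, heig, hne⟩ := hpos
  have ha₀ := mem_principalSet_of_isGPE (hw := hV) hFm hF hψ hπ hVm hgpe heig hne
  have hO := isOpen_principalSet (hw := hV) hFm hF hψ hπ hVm
  have : Nonempty (M1 V) := let ⟨_, _, μ₀, _⟩ := ha₀; ⟨μ₀⟩
  choose! lam f μ hp using fun a (ha : a ∈ principalSet P F hV) => ha.out
  have hev a ha := (hO.eventually_mem (x := a) ha).mono hp
  have hdiff a ha :=
    contDiffAt_of_eventually_isPrincipal_tilted hFm hF hψ hπ hVm one_ne_zero (hev a ha)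
  have hlam a ha := (hdiff a ha).1.differentiableAt one_ne_zero
  have hf a ha := (hdiff a ha).2.1.differentiableAt one_ne_zero
  have hμ a ha := (hdiff a ha).2.2.differentiableAt one_ne_zero
  refine ⟨principalSet P F hV, lam, f, μ, fun a x => (deriv f a x).re / (f a x).re, hO, ha₀,
    fun a ha => ⟨(hp a ha).isGPE, (hp a ha).pos, (hp a ha).isNormalizedEigenpair,
      fun _ _ => (hp a ha).eq_of_isNormalizedEigenpair,
      fun x => ⟨(hp a ha).isNonneg.im_eq_zero x, (hp a ha).re_pos x⟩⟩,
    (hp a₀ ha₀).exists_forall_hasPotential,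
    fun s₀ ν₀ => eventually_eq_smul_potential hFm hF (hev a₀ ha₀) (hlam a₀ ha₀).continuousAt,
    fun a ha x => LInf.hasDerivAt_log_re (hf a ha).hasDerivAt ((hp a ha).re_pos x).ne',
    fun a ha => ⟨(hp a ha).isMarkovKernel_doobTransform, (hp a ha).isUniform_doobTransform hVm,
      exists_invariant_twisted hFm hF hVm (hev a ha) (hlam a ha) (hf a ha),
      ⟨_, (hf a ha).hasDerivAt⟩, M1.exists_hasDerivAt hVm ⟨1, by simpa using hV⟩ (hμ a ha),
      (deriv f a).measurable_re.div (f a).measurable_re,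
      (hp a ha).exists_abs_logDeriv_le_posLog hVm
        (kernelOp_tilted_deriv hFm hF (hev a ha) (hlam a ha) (hf a ha))⟩,
    fun h0 => existsUnique_poisson_deriv_zero hFm hF hπ hVm (hev 0 h0) (hlam 0 h0)
      (hf 0 h0) (hμ 0 h0)⟩

theorem mainTheorem11 {X : Type*} [MeasurableSpace X] [MeasurableSpace.CountablyGenerated X]
    (P : Kernel X X) [IsMarkovKernel P]
    (V : X → ℝ≥0) (hVm : Measurable V) (hV : ∀ x, 1 ≤ V x)
    (hgeo : VGeo.IsGeometricallyErgodic P V)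
    (π : Measure X) [IsProbabilityMeasure π] (hπ : Kernel.Invariant P π)
    (hπV : ∫⁻ x, (V x : ℝ≥0∞) ^ 2 ∂π < ∞)
    (F : X → ℝ) (hFm : Measurable F) (hF : ∀ x, |F x| ≤ 1) (hπF : ∫ x, F x ∂π = 0)
    (a₀ : ℝ) (hunif : VGeo.IsUniform (VGeo.tilted P F a₀) V)
    -- the principal eigenfunction at `a₀` does not vanish `π`-almost everywhere
    (hpos : ∃ (lam₀ : ℂ) (h₀ : VGeo.LInf V), VGeo.IsGPE (VGeo.tilted P F a₀) V lam₀ ∧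
      VGeo.kernelOp (VGeo.tilted P F a₀) V h₀ = lam₀ • h₀ ∧ ¬ (∀ᵐ x ∂π, h₀ x = 0)) :
    ∃ (O : Set ℝ) (lam : ℝ → ℝ) (f : ℝ → VGeo.LInf V) (μ : ℝ → VGeo.M1 V)
      (Fhat : ℝ → X → ℝ), IsOpen O ∧ a₀ ∈ O ∧
      -- the principal eigenvalue, eigenfunction and eigenmeasure, for `a ∈ O`
      (∀ a ∈ O,
        VGeo.IsGPE (VGeo.tilted P F a) V (lam a : ℂ) ∧ 0 < lam a ∧
        VGeo.IsNormalizedEigenpair (VGeo.tilted P F a) (lam a : ℂ) (f a) (μ a) ∧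
        (∀ (g : VGeo.LInf V) (ν : VGeo.M1 V),
          VGeo.IsNormalizedEigenpair (VGeo.tilted P F a) (lam a : ℂ) g ν → g = f a ∧ ν = μ a) ∧
        (∀ x, (f a x).im = 0 ∧ 0 < (f a x).re)) ∧
      -- the expression of the eigenfunction and eigenmeasure through potential operators
      (∃ (s₀ : VGeo.LInf V) (ν₀ : VGeo.M1 V), ∃ ε > 0, ∀ z : ℂ, lam a₀ - ε ≤ ‖z‖ →
        VGeo.HasPotential (VGeo.kernelOp (VGeo.tilted P F a₀) V) s₀ ν₀ z) ∧
      (∀ (s₀ : VGeo.LInf V) (ν₀ : VGeo.M1 V),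
        (∃ ε > 0, ∀ z : ℂ, lam a₀ - ε ≤ ‖z‖ →
          VGeo.HasPotential (VGeo.kernelOp (VGeo.tilted P F a₀) V) s₀ ν₀ z) →
        ∀ᶠ a in 𝓝 a₀,
          VGeo.HasPotential (VGeo.kernelOp (VGeo.tilted P F a) V) s₀ ν₀ (lam a) ∧
          (let U := VGeo.potential (VGeo.kernelOp (VGeo.tilted P F a) V) s₀ ν₀ (lam a);
            ν₀.toDual (U (VGeo.LInf.one hV)) ≠ 0 ∧ (μ a).toDual (U s₀) ≠ 0 ∧
            (μ a).toDual = (ν₀.toDual (U (VGeo.LInf.one hV)))⁻¹ • ν₀.toDual.comp U ∧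
            f a = ((μ a).toDual (U s₀))⁻¹ • U s₀)) ∧
      -- `Fhat a` is the derivative of `log f a`
      (∀ a ∈ O, ∀ x, HasDerivAt (fun t => Real.log (f t x).re) (Fhat a x) a) ∧
      (∀ a ∈ O,
        -- the twisted kernel is probabilistic
        IsMarkovKernel (VGeo.twisted P F a (lam a) fun x => (f a x).re) ∧
        -- (i)
        VGeo.IsUniform (VGeo.twisted P F a (lam a) fun x => (f a x).re)
          (VGeo.twistedWeight V fun x => (f a x).re) ∧
        (∃ π' : Measure X,
          (IsProbabilityMeasure π' ∧
            Kernel.Invariant (VGeo.twisted P F a (lam a) fun x => (f a x).re) π') ∧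
          (∀ ρ : Measure X, IsProbabilityMeasure ρ →
            Kernel.Invariant (VGeo.twisted P F a (lam a) fun x => (f a x).re) ρ → ρ = π') ∧
          -- (ii)
          HasDerivAt (fun t => Real.log (lam t)) (∫ x, F x ∂π') a ∧
          -- (iii), the Poisson equation
          (∀ x, Integrable (Fhat a) (VGeo.twisted P F a (lam a) (fun y => (f a y).re) x) ∧
            ∫ y, Fhat a y ∂(VGeo.twisted P F a (lam a) (fun y => (f a y).re) x) =
              Fhat a x - F x + ∫ y, F y ∂π')) ∧
        -- (iv)
        (∃ df : VGeo.LInf V, HasDerivAt f df a) ∧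
        (∃ dμ : VGeo.M1 V, HasDerivAt (fun t => (μ t).toDual) dμ.toDual a) ∧
        -- (v)
        Measurable (Fhat a) ∧
        ∃ C : ℝ, ∀ x, |Fhat a x| ≤ C * (1 + Real.posLog (V x / (f a x).re))) ∧
      -- (iii) at `a = 0`
      (0 ∈ O →
        (∃ C : ℝ, ∀ x, |Fhat 0 x| ≤ C * V x) ∧
        (∀ x, ∫ y, Fhat 0 y ∂(P x) = Fhat 0 x - F x + ∫ y, F y ∂π) ∧
        ∫ x, Fhat 0 x ∂π = 0 ∧
        ∀ G : X → ℝ, Measurable G → (∃ C : ℝ, ∀ x, |G x| ≤ C * V x) →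
          (∀ x, ∫ y, G y ∂(P x) = G x - F x + ∫ y, F y ∂π) →
          ∫ x, G x ∂π = 0 → G = Fhat 0) := by
  obtain ⟨ψ, ⟨hψ, -⟩, -⟩ := hgeo.1
  exact mainTheorem11_general P ψ hψ V hVm hV π hπ F hFm 1 (by simpa using hF) a₀ hpos
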